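/- **Definitions.** For $v\in\mathbb Z^d$ let $\sigma_v$ be the automorphism $f(\mathbf x)\mapsto f(\mathbf x+v)$ of $\mathbb Q(\mathbf x)=\mathbb Q(x_1,\dots,x_d)$. A conservative matrix field (CMF) of dimension $d$ and rank $r\ge 1$ over $\mathbb Q$ is a map $\mathcal M:\mathbb Z^d\to \mathrm{GL}_r(\mathbb Q(\mathbf x))$, $v\mapsto\mathcal M_v$, with $\mathcal M_{v+w}=\mathcal M_v\,\sigma_v(\mathcal M_w)$ for all $v,w$. For $x\in\mathbb Q^d$, $v\in\mathbb Z^d$ its trajectory matrix is $T_{x,v}(n)=\mathcal M_v(x+nv)$, a matrix over $\mathbb Q(n)$; for $p,q\in\mathbb Q^r$ its CMF ratio is $$\mathcal L^{p,q}_{x,v}(n)=\frac{p^t\,\mathcal M_{nv}(x)\,e_r}{q^t\,\mathcal M_{nv}(x)\,e_r}.$$ The companion matrix of the recurrence operator $L=S^r+a_{r-1}(n)S^{r-1}+\dots+a_0(n)$, $a_i\in\mathbb Q(n)$, where $S$ is the shift $n\mapsto n+1$, is the $r\times r$ matrix with ones below the diagonal, last column $(-a_0(n),\dots,-a_{r-1}(n))^t$,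 and zeros elsewhere. $L$ is Poincaré–Perron if the limits $\alpha_i=\lim_{n\to\infty}a_i(n)\in\mathbb R$ exist and the roots $\lambda_1,\dots,\lambda_r$ of $t^r+\sum_i\alpha_it^i$ can be ordered so that $|\lambda_1|>\dots>|\lambda_r|$. $L$ is irreducible if no real sequence that solves $L$ for all large $n$ and is not eventually zero satisfies (for all large $n$) a nonzero linear recurrence over $\mathbb Q(n)$ of order less than $r$. A sequence $s_n\in\mathbb Q$ with limit $\ell\in\mathbb R$ has convergence rate $\rho\in[-\infty,\infty]$ if $\frac1n\log|s_n-\ell|\to\rho$, where $\log 0=-\infty$. **Theorem.** (1) Let $\mathcal M$ be a CMF of dimension $d$ and rank $r$ over $\mathbb Q$, $x\in\mathbb Q^d$, $v\in\mathbb Z^d$, and let $A\in\mathrm{GL}_r(\mathbb Q(\mathbf x))$ be such that $$C(n)=A(x+nv)^{-1}\,T_{x,v}(n)\,A(x+(n+1)v)$$ is the companion matrix of an irreducible Poincaré–Perron recurrence $L$. Assume that everything involved is defined: $\mathcal M_{nv}$ is defined at $x$ for all $n\ge 0$, $A$ is defined at $x$, $A^{-1}$ restricts to the line $x+nv$ as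 a matrix over $\mathbb Q(n)$, and the coefficients $a_i(n)$ have no pole at any $n\in\mathbb N$. Let $p,q\in\mathbb Q^r$, and let $u,w$ be the solutions of $L$ on $\mathbb N$ with initial values $(u(0),\dots,u(r-1))^t=A^t(x)p$ and $(w(0),\dots,w(r-1))^t=A^t(x)q$; assume that $w$ is not eventually zero. Then $w(n)$ and the denominator $q^t\mathcal M_{nv}(x)e_r$ of $\mathcal L^{p,q}_{x,v}(n)$ are nonzero for all large $n$, and for every $\ell\in\mathbb R$ $$\mathcal L^{p,q}_{x,v}(n)\to\ell\iff \frac{u(n)}{w(n)}\to\ell ,$$ in which case both sequences have a convergence rate in $[-\infty,\infty]$, and the two rates are equal. (2) There is a CMF $\mathcal M$ of dimension $2$ and rank $2$ over $\mathbb Q$ with $$\mathcal M_{(1,0)}=\begin{pmatrix}0&-1\\ \frac{(x_1+1)^3}{x_1^3}&\frac{x_1^3+2x_2(2x_1+1)(x_2-1)+(x_1+1)^3}{x_1^3}\end{pmatrix},$$ $$\mathcal M_{(0,1)}=\begin{pmatrix}\frac{-x_1^3+2x_1^2x_2-2x_1x_2^2+x_2^3}{x_2^3}&-\frac{x_1^3}{x_2^3}\\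 \frac{x_1^3}{x_2^3}&\frac{x_1^3+2x_1^2x_2+2x_1x_2^2+x_2^3}{x_2^3}\end{pmatrix}.$$ For $x=v=(1,1)$ and $$A=\begin{pmatrix}\frac1{x_1^3}&-\frac1{x_2^3}\\0&\frac{x_1^3+2x_1^2x_2+2x_1x_2^2+x_2^3}{x_1^3x_2^3}\end{pmatrix}$$ all the assumptions of (1) on $\mathcal M,x,v,A,L$ hold, where $L$ is Apéry's recurrence $$(n+2)^3u(n+2)-(2n+3)(17n^2+51n+39)u(n+1)+(n+1)^3u(n)=0$$ made monic. For $p=(0,1)$, $q=(1,1)$ the initial values are Apéry's: $A^t(x)p=(0,6)$ and $A^t(x)q=(1,5)$; and $\mathcal L^{(0,1),(1,1)}_{(1,1),(1,1)}(n)\to\zeta(3)$ with convergence rate $-8\log(\sqrt2+1)$. -/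

import Mathlib

open Filter Topology

noncomputable section

/-! ### Rational functions in several variables -/

/-- The field `K(x₁, …, x_d)`. -/
abbrev MvRat (K : Type) [Field K] (d : ℕ) : Type := FractionRing (MvPolynomial (Fin d) K)

namespace MvRat

variable {K : Type} [Field K] {d : ℕ}

/-- Numerator in lowest terms. -/
def num (f : MvRat K d) : MvPolynomial (Fin d) K :=
  IsFractionRing.num (MvPolynomial (Fin d) K) f

/-- Denominator in lowest terms. -/
def den (f : MvRat K d) : MvPolynomial (Fin d) K :=
  (IsFractionRing.den (MvPolynomial (Fin d) K) f : MvPolynomial (Fin d) K)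

/-- `f` is defined at the point `x`. -/
def RegularAt (f : MvRat K d) (x : Fin d → K) : Prop :=
  MvPolynomial.eval x f.den ≠ 0

/-- The value `f(x)` (meaningful when `f` is defined at `x`). -/
def evalAt (f : MvRat K d) (x : Fin d → K) : K :=
  MvPolynomial.eval x f.num / MvPolynomial.eval x f.den

/-- Substitution of the line `n ↦ x + n v` (with `n` an indeterminate) in a polynomial. -/
def polyOnLine (x : Fin d → K) (v : Fin d → ℤ) :
    MvPolynomial (Fin d) K →ₐ[K] Polynomial K :=
  MvPolynomial.aeval fun i => Polynomial.C (x i) + Polynomial.C (v i : K) * Polynomial.X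

/-- `f(x + n v)` makes sense as an element of `K(n)`. -/
def RegularOnLine (f : MvRat K d) (x : Fin d → K) (v : Fin d → ℤ) : Prop :=
  polyOnLine x v f.den ≠ 0

/-- The rational function `f(x + n v) ∈ K(n)` (meaningful under `RegularOnLine`). -/
def onLine (f : MvRat K d) (x : Fin d → K) (v : Fin d → ℤ) : RatFunc K :=
  algebraMap (Polynomial K) (RatFunc K) (polyOnLine x v f.num) /
    algebraMap (Polynomial K) (RatFunc K) (polyOnLine x v f.den)

/-- The substitution `x ↦ x + v` on polynomials. -/
def polyShift (v : Fin d → ℤ) : MvPolynomial (Fin d) K ≃ₐ[K] MvPolynomial (Fin d) K :=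
  AlgEquiv.ofAlgHom
    (MvPolynomial.aeval fun i => MvPolynomial.X i + MvPolynomial.C (v i : K))
    (MvPolynomial.aeval fun i => MvPolynomial.X i - MvPolynomial.C (v i : K))
    (by ext i; simp)
    (by ext i; simp)

/-- The shift automorphism `σ_v` of `K(x₁, …, x_d)`: `(σ_v f)(x) = f(x + v)`. -/
def shift (v : Fin d → ℤ) : MvRat K d ≃+* MvRat K d :=
  IsFractionRing.ringEquivOfRingEquiv (polyShift (K := K) v).toRingEquiv

end MvRat

/-! ### Conservative matrix fields -/

/-- A conservative matrix field of dimension `d` and rank `r` over `K`. -/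
structure CMF (K : Type) [Field K] (d r : ℕ) where
  mat : (Fin d → ℤ) → Matrix.GeneralLinearGroup (Fin r) (MvRat K d)
  cocycle : ∀ v w, mat (v + w) =
    mat v * Matrix.GeneralLinearGroup.map (MvRat.shift (K := K) v : MvRat K d →+* MvRat K d) (mat w)

namespace CMF

variable {K : Type} [Field K] {d r : ℕ}

/-- The entries of a matrix of rational functions evaluated at `x`. -/
def matEval (A : Matrix (Fin r) (Fin r) (MvRat K d)) (x : Fin d → K) :
    Matrix (Fin r) (Fin r) K :=
  A.map fun f => f.evalAt x

/-- All entries of `A` are defined at `x`. -/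
def MatRegularAt (A : Matrix (Fin r) (Fin r) (MvRat K d)) (x : Fin d → K) : Prop :=
  ∀ i j, (A i j).RegularAt x

/-- The matrix `A(x + n v)` over `K(n)`. -/
def matOnLine (A : Matrix (Fin r) (Fin r) (MvRat K d)) (x : Fin d → K) (v : Fin d → ℤ) :
    Matrix (Fin r) (Fin r) (RatFunc K) :=
  A.map fun f => f.onLine x v

/-- `A(x + n v)` makes sense as a matrix over `K(n)`. -/
def MatRegularOnLine (A : Matrix (Fin r) (Fin r) (MvRat K d)) (x : Fin d → K)
    (v : Fin d → ℤ) : Prop :=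
  ∀ i j, (A i j).RegularOnLine x v

/-- The trajectory matrix `T_{x,v}(n) = M_v(x + n v)`, a matrix over `K(n)`. -/
def trajectory (M : CMF K d r) (x : Fin d → K) (v : Fin d → ℤ) :
    Matrix (Fin r) (Fin r) (RatFunc K) :=
  matOnLine (M.mat v).val x v

/-- The ratio `(pᵗ M_{nv}(x) p') / (qᵗ M_{nv}(x) q')`. -/
def ratio₄ (M : CMF K d r) (x : Fin d → K) (v : Fin d → ℤ) (p p' q q' : Fin r → K) (n : ℕ) : K :=
  (p ⬝ᵥ (matEval (M.mat (n • v)).val x).mulVec p') /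
    (q ⬝ᵥ (matEval (M.mat (n • v)).val x).mulVec q')

/-- The index of the last coordinate. -/
def lastIdx (r : ℕ) [NeZero r] : Fin r := ⟨r - 1, Nat.sub_one_lt (NeZero.ne r)⟩

/-- The last standard basis vector `e_r`. -/
def lastVec (K : Type) [Field K] (r : ℕ) [NeZero r] : Fin r → K := Pi.single (lastIdx r) 1

/-- The CMF ratio `L^{p,q}_{x,v}(n) = (pᵗ M_{nv}(x) e_r) / (qᵗ M_{nv}(x) e_r)`. -/
def ratio [NeZero r] (M : CMF K d r) (x : Fin d → K) (v : Fin d → ℤ) (p q : Fin r → K)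
    (n : ℕ) : K :=
  M.ratio₄ x v p (lastVec K r) q (lastVec K r) n

end CMF

/-! ### Recurrences

A tuple `a : Fin r → ℚ(n)` stands for the monic recurrence operator
`L = S^r + a_{r-1}(n) S^{r-1} + ⋯ + a_0(n)`. -/

/-- The value at a natural number of a rational function in one variable. -/
def RatFunc.atNat (f : RatFunc ℚ) (n : ℕ) : ℚ := RatFunc.eval (RingHom.id ℚ) (n : ℚ) f

/-- The companion matrix of a monic recurrence: ones below the diagonal, last column `-a_i`. -/
def companion {r : ℕ} [NeZero r] (a : Fin r → RatFunc ℚ) : Matrix (Fin r) (Fin r) (RatFunc ℚ) :=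
  Matrix.of fun i j =>
    if j = CMF.lastIdx r then -a i else if i.val = j.val + 1 then 1 else 0

/-- No coefficient of the recurrence has a pole at a natural number. -/
def CoeffsDefined {r : ℕ} (a : Fin r → RatFunc ℚ) : Prop :=
  ∀ (i : Fin r) (n : ℕ), (a i).denom.eval (n : ℚ) ≠ 0

/-- `u(n+r) + ∑_{i<r} a_i(n) u(n+i) = 0` for all `n ≥ 0`. -/
def IsSolution {r : ℕ} (a : Fin r → RatFunc ℚ) (u : ℕ → ℚ) : Prop :=
  ∀ n : ℕ, u (n + r) + ∑ i : Fin r, (a i).atNat n * u (n + i) = 0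

/-- The Poincaré–Perron conditions: the coefficients converge, and the roots
`λ_1, …, λ_r` of the characteristic polynomial of the limit recurrence satisfy
`|λ_1| > ⋯ > |λ_r|`. -/
def IsPoincarePerron {r : ℕ} (a : Fin r → RatFunc ℚ) : Prop :=
  ∃ (α : Fin r → ℝ) (l : Fin r → ℂ),
    (∀ i, Tendsto (fun n : ℕ => (((a i).atNat n : ℚ) : ℝ)) atTop (𝓝 (α i))) ∧
    (Polynomial.X ^ r + ∑ i : Fin r, Polynomial.C (α i : ℂ) * Polynomial.X ^ (i : ℕ) =
      ∏ i : Fin r, (Polynomial.X - Polynomial.C (l i))) ∧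
    StrictAnti fun i => ‖l i‖

/-- Irreducibility of a recurrence of order `r`: no nontrivial solution satisfies a nonzero
linear recurrence of order `< r` over `ℚ(n)`.  As usual for operators with coefficients in
`ℚ(n)`, finitely many `n` are disregarded: sequences are considered for large `n` only. -/
def IsIrreducibleRecurrence {r : ℕ} (a : Fin r → RatFunc ℚ) : Prop :=
  ∀ y : ℕ → ℝ,
    (∀ᶠ n in atTop, y (n + r) + ∑ i : Fin r, (((a i).atNat n : ℚ) : ℝ) * y (n + i) = 0) →
    (¬ ∀ᶠ n in atTop, y n = 0) →
    ∀ b : Fin r → RatFunc ℚ,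
      (∀ᶠ n in atTop, ∑ i : Fin r, (((b i).atNat n : ℚ) : ℝ) * y (n + i) = 0) → b = 0

/-- The convergence rate of a sequence `s` with limit `l`: the limit of `log |s_n - l| / n`,
where `log 0 = -∞`. -/
def HasConvergenceRate (s : ℕ → ℚ) (l : ℝ) (ρ : EReal) : Prop :=
  Tendsto (fun n : ℕ => ENNReal.log (ENNReal.ofReal |(s n : ℝ) - l|) / (n : EReal)) atTop (𝓝 ρ)

/-! ### Transforming a trajectory to companion form -/

/-- The coboundary matrix `A` transforms the trajectory `x + n v` of `M` to companion form: the
matrix `C(n) = A(x + n v)⁻¹ T_{x,v}(n) A(x + (n+1) v)` over `ℚ(n)` is the companion matrix of the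
recurrence `a`.  The other fields say that the quantities involved are defined: the matrices
`M_{nv}(x)`, the matrix `A(x)`, the matrix `A⁻¹(x + n v)` over `ℚ(n)`, and the numbers `a_i(n)`. -/
structure IsCompanionTransform {d r : ℕ} [NeZero r] (M : CMF ℚ d r) (x : Fin d → ℚ)
    (v : Fin d → ℤ) (A : Matrix.GeneralLinearGroup (Fin r) (MvRat ℚ d))
    (a : Fin r → RatFunc ℚ) : Prop where
  field_regular : ∀ n : ℕ, CMF.MatRegularAt (M.mat (n • v)).val x
  regular : CMF.MatRegularAt A.val x
  inv_regular : CMF.MatRegularOnLine (A⁻¹).val x v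
  coeffs_defined : CoeffsDefined a
  companion_eq :
    CMF.matOnLine (A⁻¹).val x v * M.trajectory x v *
      CMF.matOnLine A.val (fun i => x i + (v i : ℚ)) v = companion a

/-! ### The field of `ζ(3)` and Apéry's recurrence -/

namespace Zeta3

/-- The first variable. -/
def x₁ : MvRat ℚ 2 := algebraMap (MvPolynomial (Fin 2) ℚ) (MvRat ℚ 2) (MvPolynomial.X 0)

/-- The second variable. -/
def x₂ : MvRat ℚ 2 := algebraMap (MvPolynomial (Fin 2) ℚ) (MvRat ℚ 2) (MvPolynomial.X 1)

/-- The generator in direction `(1, 0)`. -/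
def M₁ : Matrix (Fin 2) (Fin 2) (MvRat ℚ 2) :=
  !![0, -1;
     (x₁ + 1) ^ 3 / x₁ ^ 3,
      (x₁ ^ 3 + 2 * x₂ * (2 * x₁ + 1) * (x₂ - 1) + (x₁ + 1) ^ 3) / x₁ ^ 3]

/-- The generator in direction `(0, 1)`. -/
def M₂ : Matrix (Fin 2) (Fin 2) (MvRat ℚ 2) :=
  !![(-x₁ ^ 3 + 2 * x₁ ^ 2 * x₂ - 2 * x₁ * x₂ ^ 2 + x₂ ^ 3) / x₂ ^ 3, -(x₁ ^ 3 / x₂ ^ 3);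
     x₁ ^ 3 / x₂ ^ 3,
      (x₁ ^ 3 + 2 * x₁ ^ 2 * x₂ + 2 * x₁ * x₂ ^ 2 + x₂ ^ 3) / x₂ ^ 3]

/-- The coboundary matrix. -/
def A : Matrix (Fin 2) (Fin 2) (MvRat ℚ 2) :=
  !![1 / x₁ ^ 3, -(1 / x₂ ^ 3);
     0, (x₁ ^ 3 + 2 * x₁ ^ 2 * x₂ + 2 * x₁ * x₂ ^ 2 + x₂ ^ 3) / (x₁ ^ 3 * x₂ ^ 3)]

/-- Apéry's recurrence
`(n+2)³ u(n+2) - (2n+3)(17n²+51n+39) u(n+1) + (n+1)³ u(n) = 0`, made monic. -/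
def apery : Fin 2 → RatFunc ℚ :=
  ![(RatFunc.X + 1) ^ 3 / (RatFunc.X + 2) ^ 3,
    -((2 * RatFunc.X + 3) * (17 * RatFunc.X ^ 2 + 51 * RatFunc.X + 39) / (RatFunc.X + 2) ^ 3)]

end Zeta3

end

noncomputable section

/-! ### Decay of solutions of first order inequalities -/

/-! Part (1). Telescoping the transformed trajectory gives `M_{nv}(x) A(x+nv) = A(x) C(0) ⋯ C(n-1)`,
and right multiplication by `C(n)` moves a window `(u(n), …, u(n+r-1))` of a solution one step on.
Hence `pᵗ M_{nv}(x) e_r = ∑ b_i(n) u(n+i)` for large `n`, where `b` is the last column of `A⁻¹` on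
the line: one nonzero operator `B` over `ℚ(n)`, of order less than `r`, that does not depend on `p`
(`IsCompanionTransform.exists_operator`). So the quotients `u/w` and `Bu/Bw` have to be compared.
With `y = u - ℓw`, again a solution, the two errors are `y/w` and `By/Bw`. If `y` is eventually
zero, so are both.

Otherwise `y(n+1)/y(n)` tends to a characteristic root with error `O(1/n)`
(`PerronRecurrence.Solves.exists_root`). The quotient satisfies a Riccati equation whose
linearization at that root is invertible on sequences of order `n⁻ᴺ`, because the moduli of the
roots differ. Therefore the quotient has an asymptotic expansion in powers of `1/n`, and to all
orders it depends on the root only (`expandable_of_riccati`, `sub_mem_decay_of_riccati`). It follows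
that `By/y` has an expansion up to a power of `n`. This expansion does not vanish: by irreducibility
`B` is invertible modulo the recurrence (`exists_inverse_op`), so `By` cannot be smaller than `y` by
more than every power of `n`. Thus `By/y` is asymptotic to `c nᵏ` with `c ≠ 0`, which is invisible
at the exponential scale (`opQuot_ratio`). If `y` and `w` follow different roots, `y/w` is decided
by exponential growth or decay. If they follow the same root, `By/y` and `Bw/w` are asymptotically
equal. Either way convergence to zero and the limits of successive error quotients agree
(`quotient_comparison`), and these limits determine the rates.

Part (2). The generators commute in a semidirect product, which yields the field. The characteristic
roots `17 ± 12√2` of Apéry's recurrence are irrational, whereas a first order relation over `ℚ(n)`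
would force a rational limit of `y(n+1)/y(n)`; this gives irreducibility. Walking from `(1,1)` to
`(n+1,n+1)` first horizontally and then vertically, the horizontal leg produces the partial sums of
`ζ(3)`, and the vertical leg changes the ratio by at most `3/(n+1)` (`ratio_sub_partialSum`). By
part (1) Apéry's `u/w` has the same limit. Its error form `u - ζ(3) w` stays bounded, so it follows
the small root, while `w` follows the large one; the rate is the logarithm of the quotient of the
two. -/

lemma tendsto_inv_succ_pow_div (N : ℕ) :
    Tendsto (fun n : ℕ => (((n + 1 : ℕ) : ℝ) + 1)⁻¹ ^ N / ((n : ℝ) + 1)⁻¹ ^ N) atTop (𝓝 1) := by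
  have h1 : Tendsto (fun n : ℕ => 1 - (1 : ℝ) / ((n + 1 : ℕ) + 1)) atTop (𝓝 (1 - 0)) :=
    tendsto_const_nhds.sub
      ((tendsto_add_atTop_iff_nat 1).2 tendsto_one_div_add_atTop_nhds_zero_nat)
  have h2 := h1.pow N
  simp only [sub_zero, one_pow] at h2
  refine h2.congr fun n => ?_
  rw [← div_pow]
  congr 1
  push_cast
  have : (n : ℝ) + 1 ≠ 0 := by positivity
  have : (n : ℝ) + 1 + 1 ≠ 0 := by positivity
  field_simp
  ring

/-- The weights `(n+1)⁻ᴺ` decrease more slowly than any geometric sequence, so the contraction by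
`q` wins and a sufficiently large constant reproduces itself by induction. -/
lemma decay_forward {u : ℕ → ℝ} {q C : ℝ} (N : ℕ) (hq : 0 ≤ q) (hq1 : q < 1)
    (h : ∀ᶠ n : ℕ in atTop, u (n + 1) ≤ q * u n + C * ((n : ℝ) + 1)⁻¹ ^ N) :
    ∃ K, ∀ᶠ n : ℕ in atTop, u n ≤ K * ((n : ℝ) + 1)⁻¹ ^ N := by
  set H : ℕ → ℝ := fun n => ((n : ℝ) + 1)⁻¹ ^ N with hH
  have Hpos : ∀ n, 0 < H n := fun n => by positivity
  have h1 : ∀ᶠ n : ℕ in atTop, (1 + q) / 2 * H n ≤ H (n + 1) := by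
    have := (tendsto_inv_succ_pow_div N).eventually (lt_mem_nhds (show (1 + q) / 2 < 1 by linarith))
    filter_upwards [this] with n hn
    exact ((lt_div_iff₀ (Hpos n)).1 hn).le
  obtain ⟨n0, hn0⟩ := eventually_atTop.1 (h.and h1)
  -- The first entry starts the induction at `n0`. The second gives `qK + C ≤ K(1+q)/2`, and the
  -- factor `(1+q)/2` is absorbed in passing from `H n` to `H (n+1)`.
  refine ⟨max (u n0 / H n0) (2 * |C| / (1 - q)), eventually_atTop.2 ⟨n0, fun n hn => ?_⟩⟩
  set K := max (u n0 / H n0) (2 * |C| / (1 - q)) with hK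
  have hK0 : 0 ≤ K :=
    (div_nonneg (by positivity) (by linarith)).trans (le_max_right _ _)
  have hC := le_abs_self C
  have hKC : 2 * |C| ≤ K * (1 - q) := (div_le_iff₀ (by linarith)).1 (le_max_right _ _)
  induction n, hn using Nat.le_induction with
  | base => exact (div_le_iff₀ (Hpos n0)).1 (le_max_left _ _)
  | succ n hn ih =>
    obtain ⟨h2, h3⟩ := hn0 n hn
    calc u (n + 1) ≤ q * u n + C * H n := h2
      _ ≤ q * (K * H n) + C * H n := by gcongr
      _ = (q * K + C) * H n := by ring
      _ ≤ (K * ((1 + q) / 2)) * H n := by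
          refine mul_le_mul_of_nonneg_right ?_ (Hpos n).le
          linarith
      _ = K * ((1 + q) / 2 * H n) := by ring
      _ ≤ K * H (n + 1) := by gcongr

/-- Iterating the inequality towards infinity makes the contribution of the far end at most `qᵏ B`,
which vanishes in the limit. Since the weights decrease, the errors met on the way sum to a
geometric series times the weight at `n`. -/
lemma decay_backward {u : ℕ → ℝ} {q C B : ℝ} (N : ℕ) (hq : 0 ≤ q) (hq1 : q < 1) (hC : 0 ≤ C)
    (hB : ∀ᶠ n : ℕ in atTop, u n ≤ B)
    (h : ∀ᶠ n : ℕ in atTop, u n ≤ q * u (n + 1) + C * ((n : ℝ) + 1)⁻¹ ^ N) :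
    ∃ K, ∀ᶠ n : ℕ in atTop, u n ≤ K * ((n : ℝ) + 1)⁻¹ ^ N := by
  set H : ℕ → ℝ := fun n => ((n : ℝ) + 1)⁻¹ ^ N with hH
  obtain ⟨n0, hn0⟩ := eventually_atTop.1 (h.and hB)
  refine ⟨C / (1 - q), eventually_atTop.2 ⟨n0, fun n hn => ?_⟩⟩
  have hanti : ∀ k, H (n + k) ≤ H n := fun k => by
    simp only [hH]
    gcongr
    simp
  have key : ∀ k, u n ≤ q ^ k * u (n + k) + C / (1 - q) * (1 - q ^ k) * H n := by
    intro k
    induction k with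
    | zero => simp
    | succ k ih =>
      have h2 := (hn0 (n + k) (by omega)).1
      have h3 : u (n + k) ≤ q * u (n + (k + 1)) + C * H n :=
        h2.trans (by rw [add_assoc]; gcongr; exact hanti k)
      calc u n ≤ q ^ k * u (n + k) + C / (1 - q) * (1 - q ^ k) * H n := ih
        _ ≤ q ^ k * (q * u (n + (k + 1)) + C * H n) + C / (1 - q) * (1 - q ^ k) * H n := by
          gcongr
        _ = _ := by
          have : 1 - q ≠ 0 := by linarith
          field_simp
          ring
  have hlim : Tendsto (fun k => q ^ k * B + C / (1 - q) * (1 - q ^ k) * H n) atTop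
      (𝓝 (0 * B + C / (1 - q) * (1 - 0) * H n)) := by
    have := tendsto_pow_atTop_nhds_zero_of_lt_one hq hq1
    exact (this.mul_const B).add (((this.const_sub 1).const_mul _).mul_const _)
  rw [zero_mul, zero_add, sub_zero, mul_one] at hlim
  refine ge_of_tendsto' hlim fun k => (key k).trans ?_
  gcongr
  exact (hn0 (n + k) (by omega)).2

/-! ### Sequences of order `n⁻ᴺ` -/

/-- The sequence `1 / (n + 1)`. -/
def invSucc (n : ℕ) : ℂ := ((n : ℂ) + 1)⁻¹

lemma invSucc_ne_zero (n : ℕ) : invSucc n ≠ 0 := by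
  unfold invSucc
  exact inv_ne_zero (by exact_mod_cast n.succ_ne_zero)

lemma norm_invSucc (n : ℕ) : ‖invSucc n‖ = ((n : ℝ) + 1)⁻¹ := by
  unfold invSucc
  rw [norm_inv]
  congr 1
  have : ((n : ℂ) + 1) = ((n + 1 : ℝ) : ℂ) := by push_cast; rfl
  rw [this, Complex.norm_real, Real.norm_of_nonneg (by positivity)]

/-- The sequences that are `O(n⁻ᴺ)`. -/
def Decay (N : ℕ) : Submodule ℂ (ℕ → ℂ) where
  carrier := {f | f =O[atTop] fun n => invSucc n ^ N}
  add_mem' := fun ha hb => ha.add hb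
  zero_mem' := Asymptotics.isBigO_zero _ _
  smul_mem' := fun c _ hf => hf.const_smul_left c

lemma mem_decay {N : ℕ} {f : ℕ → ℂ} :
    f ∈ Decay N ↔ f =O[atTop] fun n => invSucc n ^ N := Iff.rfl

lemma mem_decay_iff {N : ℕ} {f : ℕ → ℂ} :
    f ∈ Decay N ↔ ∃ K : ℝ, ∀ᶠ n : ℕ in atTop, ‖f n‖ ≤ K * ((n : ℝ) + 1)⁻¹ ^ N := by
  rw [mem_decay, Asymptotics.isBigO_iff]
  simp [norm_invSucc]

lemma decay_congr {N : ℕ} {f g : ℕ → ℂ} (hf : f ∈ Decay N) (h : f =ᶠ[atTop] g) : g ∈ Decay N :=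
  Asymptotics.IsBigO.congr' hf h EventuallyEq.rfl

lemma decay_mul {N M : ℕ} {f g : ℕ → ℂ} (hf : f ∈ Decay N) (hg : g ∈ Decay M) :
    f * g ∈ Decay (N + M) := by
  have := Asymptotics.IsBigO.mul hf hg
  refine this.congr_right fun n => by rw [pow_add]

lemma decay_mono {N M : ℕ} (h : N ≤ M) : Decay M ≤ Decay N := by
  intro f hf
  refine Asymptotics.IsBigO.trans hf ?_
  refine Asymptotics.isBigO_of_le _ fun n => ?_
  rw [norm_pow, norm_pow, norm_invSucc]
  refine pow_le_pow_of_le_one (by positivity) (inv_le_one_of_one_le₀ ?_) h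
  simp

lemma decay_zero_mul {N : ℕ} {f g : ℕ → ℂ} (hf : f ∈ Decay 0) (hg : g ∈ Decay N) :
    f * g ∈ Decay N := by
  simpa using decay_mul hf hg

lemma decay_mul_zero {N : ℕ} {f g : ℕ → ℂ} (hf : f ∈ Decay N) (hg : g ∈ Decay 0) :
    f * g ∈ Decay N := decay_mul hf hg

lemma invSucc_pow_mem_decay (N : ℕ) : invSucc ^ N ∈ Decay N := Asymptotics.isBigO_refl _ _

lemma invSucc_mem_decay : invSucc ∈ Decay 1 := by simpa using invSucc_pow_mem_decay 1

lemma tendsto_invSucc : Tendsto invSucc atTop (𝓝 0) := by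
  rw [tendsto_zero_iff_norm_tendsto_zero]
  simp only [norm_invSucc]
  simpa using tendsto_one_div_add_atTop_nhds_zero_nat (𝕜 := ℝ)

lemma tendsto_zero_of_decay {f : ℕ → ℂ} (hf : f ∈ Decay 1) : Tendsto f atTop (𝓝 0) := by
  refine Asymptotics.IsBigO.trans_tendsto hf ?_
  simpa using tendsto_invSucc

lemma tendsto_of_sub_decay {f : ℕ → ℂ} {c : ℂ} (hf : (f - fun _ => c) ∈ Decay 1) :
    Tendsto f atTop (𝓝 c) := by
  have := (tendsto_zero_of_decay hf).add_const c
  simpa using this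

lemma decay_zero_of_tendsto {f : ℕ → ℂ} {c : ℂ} (hf : Tendsto f atTop (𝓝 c)) : f ∈ Decay 0 := by
  have := hf.isBigO_one ℂ
  exact this.congr_right fun n => by simp

lemma const_mem_decay (c : ℂ) : (fun _ : ℕ => c) ∈ Decay 0 :=
  decay_zero_of_tendsto tendsto_const_nhds

lemma decay_div_invSucc {N : ℕ} {f : ℕ → ℂ} (h : f * invSucc ∈ Decay (N + 1)) : f ∈ Decay N := by
  have := Asymptotics.IsBigO.mul h (Asymptotics.isBigO_refl (fun n => (invSucc n)⁻¹) atTop)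
  refine this.congr (fun n => ?_) (fun n => ?_)
  · simp [mul_assoc, mul_inv_cancel₀ (invSucc_ne_zero n)]
  · simp [pow_succ, mul_assoc, mul_inv_cancel₀ (invSucc_ne_zero n)]

/-! ### The shift of sequences -/

/-- The shift operator on sequences. -/
def seqShift : Module.End ℂ (ℕ → ℂ) where
  toFun f n := f (n + 1)
  map_add' _ _ := rfl
  map_smul' _ _ := rfl

@[simp] lemma seqShift_apply (f : ℕ → ℂ) (n : ℕ) : seqShift f n = f (n + 1) := rfl

@[simp] lemma seqShift_pow_apply (k : ℕ) (f : ℕ → ℂ) (n : ℕ) :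
    (seqShift ^ k) f n = f (n + k) := by
  induction k generalizing n with
  | zero => simp
  | succ k ih => rw [pow_succ', Module.End.mul_apply, seqShift_apply, ih]; congr 1; ring

lemma seqShift_mem_decay {N : ℕ} {f : ℕ → ℂ} (hf : f ∈ Decay N) : seqShift f ∈ Decay N := by
  rw [mem_decay_iff] at hf ⊢
  obtain ⟨K, hK⟩ := hf
  refine ⟨|K|, ?_⟩
  filter_upwards [(tendsto_add_atTop_nat 1).eventually hK] with n hn
  refine hn.trans ?_
  refine mul_le_mul (le_abs_self K) ?_ (by positivity) (abs_nonneg K)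
  gcongr
  simp

lemma seqShift_pow_mem_decay {N : ℕ} {f : ℕ → ℂ} (hf : f ∈ Decay N) (k : ℕ) :
    (seqShift ^ k) f ∈ Decay N := by
  induction k with
  | zero => simpa
  | succ k ih => rw [pow_succ', Module.End.mul_apply]; exact seqShift_mem_decay ih

/-- The equation is solved in its contracting direction: forwards if `‖b‖ < ‖a‖`, backwards if `‖a‖
< ‖b‖`. Boundedness of `f` excludes the growing homogeneous solution in the second case. -/
lemma decay_of_first_order {N : ℕ} {f : ℕ → ℂ} {a b : ℂ} (hab : ‖a‖ ≠ ‖b‖) (hf : f ∈ Decay 0)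
    (h : Polynomial.aeval seqShift (Polynomial.C a * Polynomial.X - Polynomial.C b) f ∈ Decay N) :
    f ∈ Decay N := by
  rw [mem_decay_iff] at h hf ⊢
  obtain ⟨C, hC⟩ := h
  have hC' : ∀ᶠ n : ℕ in atTop, ‖a * f (n + 1) - b * f n‖ ≤ |C| * ((n : ℝ) + 1)⁻¹ ^ N := by
    filter_upwards [hC] with n hn
    have h1 : Polynomial.aeval seqShift (Polynomial.C a * Polynomial.X - Polynomial.C b) f n =
        a * f (n + 1) - b * f n := by
      simp [Module.algebraMap_end_apply]
    rw [h1] at hn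
    refine hn.trans ?_
    gcongr
    exact le_abs_self C
  obtain ⟨B, hB⟩ := hf
  simp only [pow_zero, mul_one] at hB
  rcases lt_or_gt_of_ne hab with hlt | hlt
  · have hb : 0 < ‖b‖ := (norm_nonneg a).trans_lt hlt
    refine decay_backward (u := fun n => ‖f n‖) (q := ‖a‖ / ‖b‖) (C := |C| / ‖b‖) (B := B) N
      (by positivity) ((div_lt_one hb).2 hlt) (by positivity) hB ?_
    filter_upwards [hC'] with n hn
    have h2 : ‖b‖ * ‖f n‖ ≤ ‖a‖ * ‖f (n + 1)‖ + |C| * ((n : ℝ) + 1)⁻¹ ^ N := by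
      rw [← norm_mul, ← norm_mul]
      calc ‖b * f n‖ = ‖a * f (n + 1) - (a * f (n + 1) - b * f n)‖ := by congr 1; ring
        _ ≤ _ := (norm_sub_le _ _).trans (by gcongr)
    calc ‖f n‖ = (‖b‖ * ‖f n‖) / ‖b‖ := by field_simp
      _ ≤ (‖a‖ * ‖f (n + 1)‖ + |C| * ((n : ℝ) + 1)⁻¹ ^ N) / ‖b‖ := by gcongr
      _ = _ := by ring
  · have ha : 0 < ‖a‖ := (norm_nonneg b).trans_lt hlt
    refine decay_forward (u := fun n => ‖f n‖) (q := ‖b‖ / ‖a‖) (C := |C| / ‖a‖) N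
      (by positivity) ((div_lt_one ha).2 hlt) ?_
    filter_upwards [hC'] with n hn
    have h2 : ‖a‖ * ‖f (n + 1)‖ ≤ ‖b‖ * ‖f n‖ + |C| * ((n : ℝ) + 1)⁻¹ ^ N := by
      rw [← norm_mul, ← norm_mul]
      calc ‖a * f (n + 1)‖ = ‖b * f n + (a * f (n + 1) - b * f n)‖ := by congr 1; ring
        _ ≤ _ := (norm_add_le _ _).trans (by gcongr)
    calc ‖f (n + 1)‖ = (‖a‖ * ‖f (n + 1)‖) / ‖a‖ := by field_simp
      _ ≤ (‖b‖ * ‖f n‖ + |C| * ((n : ℝ) + 1)⁻¹ ^ N) / ‖a‖ := by gcongr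
      _ = _ := by ring

lemma aeval_seqShift_mem_decay {N : ℕ} {f : ℕ → ℂ} (hf : f ∈ Decay N) (P : Polynomial ℂ) :
    Polynomial.aeval seqShift P f ∈ Decay N := by
  rw [Polynomial.aeval_eq_sum_range, LinearMap.sum_apply]
  exact Submodule.sum_mem _ fun k _ => Submodule.smul_mem _ _ (seqShift_pow_mem_decay hf k)

/-- Factors are removed one at a time. What the remaining factors produce from a bounded sequence is
bounded, as the first order case requires. -/
lemma decay_of_aeval_prod {ι : Type*} {N : ℕ} {f : ℕ → ℂ} {a : ℂ} {b : ι → ℂ} (s : Finset ι)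
    (hab : ∀ i ∈ s, ‖a‖ ≠ ‖b i‖) (hf : f ∈ Decay 0)
    (h : Polynomial.aeval seqShift
      (∏ i ∈ s, (Polynomial.C a * Polynomial.X - Polynomial.C (b i))) f ∈ Decay N) :
    f ∈ Decay N := by
  classical
  induction s using Finset.induction_on with
  | empty => simpa using h
  | insert i s hi ih =>
    rw [Finset.prod_insert hi, map_mul, Module.End.mul_apply] at h
    exact ih (fun j hj => hab j (Finset.mem_insert_of_mem hj))
      (decay_of_first_order (hab i (Finset.mem_insert_self i s)) (aeval_seqShift_mem_decay hf _) h)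

/-! ### Asymptotic expansions in powers of `1 / n` -/

lemma aeval_invSucc_mem_decay (P : Polynomial ℂ) : Polynomial.aeval invSucc P ∈ Decay 0 := by
  induction P using Polynomial.induction_on' with
  | add p q hp hq => rw [map_add]; exact Submodule.add_mem _ hp hq
  | monomial k c =>
    rw [Polynomial.aeval_monomial, ← Algebra.smul_def]
    exact Submodule.smul_mem _ _ (decay_mono (Nat.zero_le k) (invSucc_pow_mem_decay k))

/-- The sequences with an asymptotic expansion in powers of `1 / n`. -/
def Expandable : Subalgebra ℂ (ℕ → ℂ) where
  carrier := {f | ∀ N, ∃ P : Polynomial ℂ, f - Polynomial.aeval invSucc P ∈ Decay N}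
  mul_mem' := by
    intro f g hf hg N
    obtain ⟨P, hP⟩ := hf N
    obtain ⟨Q, hQ⟩ := hg N
    refine ⟨P * Q, ?_⟩
    have hg0 : g ∈ Decay 0 := by
      have := Submodule.add_mem _ (decay_mono (Nat.zero_le N) hQ) (aeval_invSucc_mem_decay Q)
      simpa using this
    have := Submodule.add_mem _ (decay_mul_zero hP hg0)
      (decay_zero_mul (aeval_invSucc_mem_decay P) hQ)
    convert this using 1
    rw [map_mul]
    ring
  add_mem' := by
    intro f g hf hg N
    obtain ⟨P, hP⟩ := hf N
    obtain ⟨Q, hQ⟩ := hg N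
    refine ⟨P + Q, ?_⟩
    have := Submodule.add_mem _ hP hQ
    convert this using 1
    rw [map_add]
    ring
  algebraMap_mem' := fun c N => ⟨Polynomial.C c, by simp⟩

lemma aeval_invSucc_mem_expandable (P : Polynomial ℂ) :
    Polynomial.aeval invSucc P ∈ Expandable := fun N => ⟨P, by simp⟩

lemma invSucc_mem_expandable : invSucc ∈ Expandable := by
  simpa using aeval_invSucc_mem_expandable Polynomial.X

lemma decay_zero_of_expandable {f : ℕ → ℂ} (hf : f ∈ Expandable) : f ∈ Decay 0 := by
  obtain ⟨P, hP⟩ := hf 0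
  simpa using Submodule.add_mem _ hP (aeval_invSucc_mem_decay P)

lemma aeval_invSucc_eq (P : Polynomial ℂ) :
    Polynomial.aeval invSucc P =
      Polynomial.aeval invSucc P.divX * invSucc + fun _ => P.coeff 0 := by
  conv_lhs => rw [← Polynomial.divX_mul_X_add P]
  rw [map_add, map_mul, Polynomial.aeval_X, Polynomial.aeval_C]
  rfl

lemma exists_limit_of_expandable {f : ℕ → ℂ} (hf : f ∈ Expandable) :
    ∃ c, (f - fun _ => c) ∈ Decay 1 := by
  obtain ⟨P, hP⟩ := hf 1
  refine ⟨P.coeff 0, ?_⟩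
  have := Submodule.add_mem _ hP
    (decay_zero_mul (aeval_invSucc_mem_decay P.divX) invSucc_mem_decay)
  convert this using 1
  rw [aeval_invSucc_eq P]
  ring

lemma inv_mem_decay_zero {f : ℕ → ℂ} {c : ℂ} (hc : c ≠ 0) (hf : Tendsto f atTop (𝓝 c)) :
    f⁻¹ ∈ Decay 0 := decay_zero_of_tendsto (hf.inv₀ hc)

/-- Truncated geometric series: with `g = 1 - f/c = O(1/n)`, the inverse of `f` is `c⁻¹ ∑_{j<N} gʲ +
gᴺ/f`, and the last term is `O(n⁻ᴺ)`. -/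
lemma inv_mem_expandable {f : ℕ → ℂ} (hf : f ∈ Expandable) {c : ℂ} (hc : c ≠ 0)
    (h : (f - fun _ => c) ∈ Decay 1) : f⁻¹ ∈ Expandable := by
  intro N
  set g : ℕ → ℂ := 1 - c⁻¹ • f with hg
  have hgE : g ∈ Expandable := sub_mem (one_mem _) (Subalgebra.smul_mem _ hf _)
  have hg1 : g ∈ Decay 1 := by
    have := Submodule.smul_mem _ (-c⁻¹) h
    convert this using 1
    funext n
    simp only [hg, Pi.sub_apply, Pi.one_apply, Pi.smul_apply, smul_eq_mul]
    field_simp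
    ring
  have hgN : g ^ N ∈ Decay N := by
    clear_value g
    induction N with
    | zero => rw [pow_zero]; exact const_mem_decay 1
    | succ N ih => rw [pow_succ]; exact decay_mul ih hg1
  have hsum : c⁻¹ • ∑ j ∈ Finset.range N, g ^ j ∈ Expandable :=
    Subalgebra.smul_mem _ (sum_mem fun j _ => pow_mem hgE j) _
  obtain ⟨P, hP⟩ := hsum N
  refine ⟨P, ?_⟩
  have hlim := tendsto_of_sub_decay h
  have := Submodule.add_mem _ hP (decay_mul_zero hgN (inv_mem_decay_zero hc hlim))
  refine decay_congr this ?_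
  filter_upwards [hlim.eventually_ne hc] with n hn
  have h1 := geom_sum_mul (g n) N
  have h2 : g n - 1 = -(c⁻¹ * f n) := by simp [hg]
  rw [h2] at h1
  simp only [Pi.add_apply, Pi.sub_apply, Pi.smul_apply, Finset.sum_apply, Pi.pow_apply,
    Pi.mul_apply, Pi.inv_apply, smul_eq_mul]
  have h3 : g n ^ N = 1 - c⁻¹ * f n * ∑ j ∈ Finset.range N, g n ^ j := by linear_combination -h1
  rw [h3]
  field_simp
  ring

lemma seqShift_aeval (f : ℕ → ℂ) (P : Polynomial ℂ) :
    seqShift (Polynomial.aeval f P) = Polynomial.aeval (seqShift f) P := by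
  induction P using Polynomial.induction_on' with
  | add p q hp hq => rw [map_add, map_add, map_add, hp, hq]
  | monomial k c => funext n; simp [Polynomial.aeval_monomial]

lemma aeval_mem_expandable {f : ℕ → ℂ} (hf : f ∈ Expandable) (P : Polynomial ℂ) :
    Polynomial.aeval f P ∈ Expandable := by
  induction P using Polynomial.induction_on' with
  | add p q hp hq => rw [map_add]; exact add_mem hp hq
  | monomial k c =>
    rw [Polynomial.aeval_monomial]
    exact mul_mem (Expandable.algebraMap_mem c) (pow_mem hf k)

lemma one_add_invSucc_sub_mem_decay : ((1 + invSucc) - fun _ => (1 : ℂ)) ∈ Decay 1 := by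
  have : ((1 + invSucc) - fun _ => (1 : ℂ)) = invSucc := by funext n; simp
  rw [this]
  exact invSucc_mem_decay

lemma seqShift_invSucc : seqShift invSucc = invSucc * (1 + invSucc)⁻¹ := by
  funext n
  simp only [seqShift_apply, Pi.mul_apply, Pi.inv_apply, Pi.add_apply, Pi.one_apply, invSucc]
  have h1 : ((n : ℂ) + 1) ≠ 0 := by exact_mod_cast n.succ_ne_zero
  have h2 : ((n : ℂ) + 1 + 1) ≠ 0 := by exact_mod_cast (n + 1).succ_ne_zero
  push_cast
  field_simp

lemma inv_one_add_invSucc_mem_expandable : (1 + invSucc)⁻¹ ∈ Expandable :=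
  inv_mem_expandable (add_mem (one_mem _) invSucc_mem_expandable) one_ne_zero
    one_add_invSucc_sub_mem_decay

lemma seqShift_mem_expandable {f : ℕ → ℂ} (hf : f ∈ Expandable) : seqShift f ∈ Expandable := by
  intro N
  obtain ⟨P, hP⟩ := hf N
  have hs : seqShift invSucc ∈ Expandable := by
    rw [seqShift_invSucc]
    exact mul_mem invSucc_mem_expandable inv_one_add_invSucc_mem_expandable
  obtain ⟨Q, hQ⟩ := aeval_mem_expandable hs P N
  refine ⟨Q, ?_⟩
  have := Submodule.add_mem _ (seqShift_mem_decay hP) hQ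
  rw [map_sub, seqShift_aeval] at this
  simpa using this

lemma seqShift_pow_mem_expandable {f : ℕ → ℂ} (hf : f ∈ Expandable) (k : ℕ) :
    (seqShift ^ k) f ∈ Expandable := by
  induction k with
  | zero => simpa
  | succ k ih => rw [pow_succ', Module.End.mul_apply]; exact seqShift_mem_expandable ih

lemma coeff_zero_eq_zero_of_decay {f : ℕ → ℂ} {P : Polynomial ℂ}
    (hf : f ∈ Decay 1) (hP : f - Polynomial.aeval invSucc P ∈ Decay 1) : P.coeff 0 = 0 := by
  have h1 : (fun _ : ℕ => P.coeff 0) ∈ Decay 1 := by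
    have := Submodule.sub_mem _ (Submodule.sub_mem _ hf hP)
      (decay_zero_mul (aeval_invSucc_mem_decay P.divX) invSucc_mem_decay)
    convert this using 1
    rw [aeval_invSucc_eq P]
    ring
  exact tendsto_nhds_unique tendsto_const_nhds (tendsto_zero_of_decay h1)

/-- Since `f` is bounded, `f/(n+1)` tends to zero, so its expansion has no constant term and can be
divided by `1/(n+1)`. -/
lemma expandable_of_mul_invSucc {f : ℕ → ℂ} (hf : f ∈ Decay 0) (h : f * invSucc ∈ Expandable) :
    f ∈ Expandable := by
  intro N
  obtain ⟨P, hP⟩ := h (N + 1)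
  have h0 : P.coeff 0 = 0 := coeff_zero_eq_zero_of_decay
    (decay_zero_mul hf invSucc_mem_decay) (decay_mono (by omega) hP)
  refine ⟨P.divX, decay_div_invSucc ?_⟩
  convert hP using 1
  rw [aeval_invSucc_eq P, h0]
  funext n
  simp
  ring

lemma expandable_of_mul_invSucc_pow {f : ℕ → ℂ} (hf : f ∈ Decay 0) (k : ℕ)
    (h : f * invSucc ^ k ∈ Expandable) : f ∈ Expandable := by
  induction k with
  | zero => simpa using h
  | succ k ih =>
    refine ih (expandable_of_mul_invSucc (decay_mul_zero hf ?_) (by rwa [mul_assoc, ← pow_succ]))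
    exact decay_mono (Nat.zero_le k) (invSucc_pow_mem_decay k)

/-- Powers of `1/(n+1)` are divided out until the limit is nonzero. Failure of `O(n⁻ᴺ)` means that
this happens after fewer than `N` divisions. -/
lemma exists_leading_term {f : ℕ → ℂ} (hf : f ∈ Expandable) {N : ℕ} (hN : f ∉ Decay N) :
    ∃ (k : ℕ) (g : ℕ → ℂ) (c : ℂ), f = invSucc ^ k * g ∧ c ≠ 0 ∧ Tendsto g atTop (𝓝 c) := by
  induction N generalizing f with
  | zero => exact absurd (decay_zero_of_expandable hf) hN
  | succ N ih =>
    obtain ⟨c, hc⟩ := exists_limit_of_expandable hf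
    by_cases hc0 : c = 0
    · subst hc0
      set f' : ℕ → ℂ := fun n => f n * (invSucc n)⁻¹ with hf'
      have hff : f' * invSucc = f := by
        funext n
        simp [hf', mul_assoc, inv_mul_cancel₀ (invSucc_ne_zero n)]
      have h1 : f' ∈ Decay 0 := decay_div_invSucc (by
        rw [hff]
        convert hc using 1
        funext n
        simp)
      have h2 : f' ∈ Expandable := expandable_of_mul_invSucc h1 (by rwa [hff])
      have h3 : f' ∉ Decay N := fun h => hN (by
        rw [← hff]
        exact decay_mul h invSucc_mem_decay)
      obtain ⟨k, g, c, hg, hc, hlim⟩ := ih h2 h3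
      refine ⟨k + 1, g, c, ?_, hc, hlim⟩
      rw [← hff, hg]
      ring
    · exact ⟨0, f, c, by simp, hc0, tendsto_of_sub_decay hc⟩

/-! ### Rational functions at natural numbers -/

/-- The sequence of values of a rational function at the natural numbers. -/
def ratSeq (a : RatFunc ℚ) : ℕ → ℂ := fun n => ((RatFunc.atNat a n : ℚ) : ℂ)

lemma atNat_eq (a : RatFunc ℚ) (n : ℕ) :
    RatFunc.atNat a n = a.num.eval (n : ℚ) / a.denom.eval (n : ℚ) := by
  simp [RatFunc.atNat, RatFunc.eval]

lemma natCast_mul_invSucc : (fun n : ℕ => (n : ℂ)) * invSucc = 1 - invSucc := by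
  funext n
  simp only [Pi.mul_apply, Pi.sub_apply, Pi.one_apply, invSucc]
  have h1 : ((n : ℂ) + 1) ≠ 0 := by exact_mod_cast n.succ_ne_zero
  field_simp
  ring

/-- Because `n/(n+1) = 1 - 1/(n+1)`, the normalized value `p(n)/(n+1)^deg p` is itself a polynomial
in `1/(n+1)`. -/
lemma polynomial_mul_invSucc_pow (p : Polynomial ℚ) :
    (fun n : ℕ => ((p.eval (n : ℚ) : ℚ) : ℂ)) * invSucc ^ p.natDegree ∈ Expandable ∧
    ((fun n : ℕ => ((p.eval (n : ℚ) : ℚ) : ℂ)) * invSucc ^ p.natDegree -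
      fun _ => (p.leadingCoeff : ℂ)) ∈ Decay 1 := by
  have h1 : (fun n : ℕ => ((p.eval (n : ℚ) : ℚ) : ℂ)) * invSucc ^ p.natDegree =
      ∑ k ∈ Finset.range (p.natDegree + 1),
        (p.coeff k : ℂ) • ((1 - invSucc) ^ k * invSucc ^ (p.natDegree - k)) := by
    funext n
    rw [Finset.sum_apply, Pi.mul_apply, Polynomial.eval_eq_sum_range]
    push_cast
    rw [Finset.sum_mul]
    refine Finset.sum_congr rfl fun k hk => ?_
    rw [← natCast_mul_invSucc]
    simp only [Pi.smul_apply, Pi.mul_apply, Pi.pow_apply, smul_eq_mul]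
    have : p.natDegree = k + (p.natDegree - k) := by
      have := Finset.mem_range.1 hk
      omega
    conv_lhs => rw [this, pow_add]
    rw [mul_pow]
    ring
  have hE : (1 - invSucc) ∈ Expandable := sub_mem (one_mem _) invSucc_mem_expandable
  rw [h1]
  refine ⟨sum_mem fun k _ => Subalgebra.smul_mem _
    (mul_mem (pow_mem hE k) (pow_mem invSucc_mem_expandable _)) _, ?_⟩
  have h2 : ∀ k : ℕ, (1 - invSucc) ^ k - (1 : ℕ → ℂ) ∈ Decay 1 := by
    intro k
    induction k with
    | zero => simp
    | succ k ih =>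
      have : (1 - invSucc) ^ (k + 1) - (1 : ℕ → ℂ) =
          ((1 - invSucc) ^ k - 1) - (1 - invSucc) ^ k * invSucc := by ring
      rw [this]
      exact Submodule.sub_mem _ ih
        (decay_zero_mul (decay_zero_of_expandable (pow_mem hE k)) invSucc_mem_decay)
  rw [Finset.sum_range_succ, add_sub_assoc]
  refine Submodule.add_mem _ (Submodule.sum_mem _ fun k hk => Submodule.smul_mem _ _ ?_) ?_
  · refine decay_zero_mul (decay_zero_of_expandable (pow_mem hE k)) ?_
    exact decay_mono (by have := Finset.mem_range.1 hk; omega) (invSucc_pow_mem_decay _)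
  · have := Submodule.smul_mem _ (p.leadingCoeff : ℂ) (h2 p.natDegree)
    convert this using 1
    funext n
    simp [mul_sub]

/-- The normalized denominator has a nonzero limit, hence an expandable inverse. Only the degree of
the numerator has to be compensated by a power of `1/(n+1)`. -/
lemma exists_ratSeq_mul_mem_expandable (a : RatFunc ℚ) :
    ∃ K, ratSeq a * invSucc ^ K ∈ Expandable := by
  refine ⟨a.num.natDegree, ?_⟩
  have h1 := (polynomial_mul_invSucc_pow a.num).1
  obtain ⟨h2, h3⟩ := polynomial_mul_invSucc_pow a.denom
  have hc : (a.denom.leadingCoeff : ℂ) ≠ 0 := by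
    have := Polynomial.leadingCoeff_ne_zero.2 a.denom_ne_zero
    exact_mod_cast this
  have h4 := inv_mem_expandable h2 hc h3
  have h5 := mul_mem (mul_mem h1 h4) (pow_mem invSucc_mem_expandable a.denom.natDegree)
  convert h5 using 1
  funext n
  simp only [ratSeq, atNat_eq, Pi.mul_apply, Pi.pow_apply, Pi.inv_apply]
  push_cast
  have := invSucc_ne_zero n
  field_simp

lemma ratSeq_mem_expandable {a : RatFunc ℚ} {c : ℂ} (h : Tendsto (ratSeq a) atTop (𝓝 c)) :
    ratSeq a ∈ Expandable := by
  obtain ⟨K, hK⟩ := exists_ratSeq_mul_mem_expandable a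
  exact expandable_of_mul_invSucc_pow (decay_zero_of_tendsto h) K hK

lemma sub_limit_mem_decay {f : ℕ → ℂ} (hf : f ∈ Expandable) {c : ℂ}
    (h : Tendsto f atTop (𝓝 c)) : (f - fun _ => c) ∈ Decay 1 := by
  obtain ⟨d, hd⟩ := exists_limit_of_expandable hf
  rwa [tendsto_nhds_unique h (tendsto_of_sub_decay hd)]

/-! ### Poincaré's theorem with a rate -/

lemma norm_le_of_perturbed {z z' l : ℂ} {δ : ℝ} (h : ‖z' - l * z‖ ≤ δ) : ‖z'‖ ≤ ‖l‖ * ‖z‖ + δ := by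
  rw [← norm_mul]
  calc ‖z'‖ = ‖l * z + (z' - l * z)‖ := by congr 1; ring
    _ ≤ _ := (norm_add_le _ _).trans (by gcongr)

lemma le_norm_of_perturbed {z z' l : ℂ} {δ : ℝ} (h : ‖z' - l * z‖ ≤ δ) : ‖l‖ * ‖z‖ ≤ ‖z'‖ + δ := by
  rw [← norm_mul]
  calc ‖l * z‖ = ‖z' - (z' - l * z)‖ := by congr 1; ring
    _ ≤ _ := (norm_sub_le _ _).trans (by gcongr)

lemma eventually_div_succ_le (C : ℝ) {ε : ℝ} (hε : 0 < ε) :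
    ∀ᶠ n : ℕ in atTop, C * ((n : ℝ) + 1)⁻¹ ≤ ε := by
  have h := (tendsto_one_div_add_atTop_nhds_zero_nat (𝕜 := ℝ)).const_mul C
  rw [mul_zero] at h
  filter_upwards [h.eventually (gt_mem_nhds hε)] with n hn
  rw [← one_div]
  exact hn.le

/-- The quotient `z/w` satisfies a first order inequality with an `O(1/n)` error. If `‖l‖ < ‖m‖` it
contracts forwards. If `‖l‖ > ‖m‖` it would grow, and the bound `‖z‖ ≤ ‖w‖` is what allows the
backward argument. -/
lemma decay_of_dominated {z w : ℕ → ℂ} {l m : ℂ} {C : ℝ} (hlm : ‖l‖ ≠ ‖m‖) (hC : 0 ≤ C)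
    (hw : ∀ᶠ n in atTop, w n ≠ 0) (hzw : ∀ᶠ n in atTop, ‖z n‖ ≤ ‖w n‖)
    (hz1 : ∀ᶠ n : ℕ in atTop, ‖z (n + 1) - l * z n‖ ≤ C * ((n : ℝ) + 1)⁻¹ * ‖w n‖)
    (hw1 : ∀ᶠ n : ℕ in atTop, ‖w (n + 1) - m * w n‖ ≤ C * ((n : ℝ) + 1)⁻¹ * ‖w n‖) :
    z / w ∈ Decay 1 := by
  rw [mem_decay_iff]
  -- The midpoint leaves room on both sides: the perturbed growth factor of `w` stays on its side of
  -- `k`, and `‖l‖` lies strictly on the other.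
  set k := (‖l‖ + ‖m‖) / 2 with hk
  rcases lt_or_gt_of_ne hlm with hlt | hlt
  · have hk0 : 0 < k := by have := norm_nonneg l; linarith
    refine decay_forward (u := fun n => ‖(z / w) n‖) (q := ‖l‖ / k) (C := C / k) 1 (by positivity)
      ((div_lt_one hk0).2 (by linarith)) ?_
    filter_upwards [hw, (tendsto_add_atTop_nat 1).eventually hw, hz1, hw1,
      eventually_div_succ_le C (show 0 < ‖m‖ - k by linarith)] with n h1 h2 h3 h4 h5
    have h6 := norm_le_of_perturbed h3
    have h7 := le_norm_of_perturbed h4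
    have hp : 0 < ‖w n‖ := norm_pos_iff.2 h1
    have hp' : 0 < ‖w (n + 1)‖ := norm_pos_iff.2 h2
    have h8 : k * ‖w n‖ ≤ ‖w (n + 1)‖ := by
      have := mul_le_mul_of_nonneg_right h5 hp.le
      linarith
    simp only [Pi.div_apply, norm_div, pow_one]
    calc ‖z (n + 1)‖ / ‖w (n + 1)‖
        ≤ (‖l‖ * ‖z n‖ + C * ((n : ℝ) + 1)⁻¹ * ‖w n‖) / (k * ‖w n‖) := by gcongr
      _ = _ := by field_simp
  · have hl0 : 0 < ‖l‖ := (norm_nonneg m).trans_lt hlt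
    have hk0 : 0 < k := by have := norm_nonneg m; linarith
    refine decay_backward (u := fun n => ‖(z / w) n‖) (q := k / ‖l‖) (C := C / ‖l‖) (B := 1) 1
      (by positivity) ((div_lt_one hl0).2 (by linarith)) (by positivity) ?_ ?_
    · filter_upwards [hw, hzw] with n h1 h2
      rw [Pi.div_apply, norm_div]
      exact (div_le_one (norm_pos_iff.2 h1)).2 h2
    filter_upwards [hw, (tendsto_add_atTop_nat 1).eventually hw, hz1, hw1,
      eventually_div_succ_le C (show 0 < k - ‖m‖ by linarith)] with n h1 h2 h3 h4 h5
    have h6 := le_norm_of_perturbed h3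
    have h7 := norm_le_of_perturbed h4
    have hp : 0 < ‖w n‖ := norm_pos_iff.2 h1
    have hp' : 0 < ‖w (n + 1)‖ := norm_pos_iff.2 h2
    have h8 : ‖w (n + 1)‖ ≤ k * ‖w n‖ := by
      have := mul_le_mul_of_nonneg_right h5 hp.le
      linarith
    simp only [Pi.div_apply, norm_div, pow_one]
    have h9 : ‖z (n + 1)‖ ≤ k * ‖w n‖ * (‖z (n + 1)‖ / ‖w (n + 1)‖) := by
      rw [mul_div_assoc', le_div_iff₀ hp', mul_comm]
      gcongr
    calc ‖z n‖ / ‖w n‖ = ‖l‖ * ‖z n‖ / (‖l‖ * ‖w n‖) := by field_simp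
      _ ≤ (k * ‖w n‖ * (‖z (n + 1)‖ / ‖w (n + 1)‖) + C * ((n : ℝ) + 1)⁻¹ * ‖w n‖) /
          (‖l‖ * ‖w n‖) := by gcongr; linarith
      _ = _ := by field_simp

/-- The index of a largest component eventually cannot increase, since a component with a root of
smaller modulus never overtakes the leading one. A nonincreasing sequence in a finite set becomes
constant, and its final value is the dominant index. -/
lemma exists_dominant {r : ℕ} {Z : Fin r → ℕ → ℂ} {l : Fin r → ℂ} {C : ℝ}
    (hl : StrictAnti fun i => ‖l i‖) (hC : 0 ≤ C)
    (h : ∀ᶠ n : ℕ in atTop, ∀ i,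
      ‖Z i (n + 1) - l i * Z i n‖ ≤ C * ((n : ℝ) + 1)⁻¹ * ∑ j, ‖Z j n‖)
    (h0 : ∀ᶠ n in atTop, ∃ i, Z i n ≠ 0) :
    ∃ i, (∀ᶠ n in atTop, Z i n ≠ 0) ∧ (∀ j, j ≠ i → Z j / Z i ∈ Decay 1) ∧
      (fun n => Z i (n + 1) / Z i n - l i) ∈ Decay 1 := by
  have hne : Nonempty (Fin r) := by
    obtain ⟨n, i, _⟩ := h0.exists
    exact ⟨i⟩
  choose idx hidx using fun n : ℕ => Finite.exists_max fun i => ‖Z i n‖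
  have h1 : ∀ᶠ n : ℕ in atTop, ∀ i,
      ‖Z i (n + 1) - l i * Z i n‖ ≤ C * r * ((n : ℝ) + 1)⁻¹ * ‖Z (idx n) n‖ := by
    filter_upwards [h] with n hn i
    refine (hn i).trans ?_
    have : ∑ j, ‖Z j n‖ ≤ r * ‖Z (idx n) n‖ := by
      refine (Finset.sum_le_card_nsmul _ _ _ fun j _ => hidx n j).trans ?_
      simp
    calc _ ≤ C * ((n : ℝ) + 1)⁻¹ * (r * ‖Z (idx n) n‖) := by gcongr
      _ = _ := by ring
  have h2 : ∀ᶠ n in atTop, Z (idx n) n ≠ 0 := by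
    filter_upwards [h0] with n ⟨i, hi⟩ hz
    have := hidx n i
    rw [hz, norm_zero] at this
    exact hi (norm_le_zero_iff.1 this)
  -- An overtaking would involve two perturbation errors, each at most a third of the gap between
  -- the moduli; together they do not bridge it.
  have h3 : ∀ᶠ n : ℕ in atTop, ∀ i j, i < j → C * r * ((n : ℝ) + 1)⁻¹ ≤ (‖l i‖ - ‖l j‖) / 3 := by
    rw [eventually_all]
    intro i
    rw [eventually_all]
    intro j
    by_cases hij : i < j
    · filter_upwards [eventually_div_succ_le (C * r)
        (show 0 < (‖l i‖ - ‖l j‖) / 3 by have := hl hij; simp only at this; linarith)] with n hn _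
      exact hn
    · exact Eventually.of_forall fun n hij' => absurd hij' hij
  obtain ⟨N0, hN0⟩ := eventually_atTop.1 ((h1.and h2).and h3)
  have hmono : ∀ n, N0 ≤ n → idx (n + 1) ≤ idx n := by
    intro n hn
    obtain ⟨⟨h4, h5⟩, h6⟩ := hN0 n hn
    by_contra! hlt
    have h7 := h6 _ _ hlt
    have h8 := norm_le_of_perturbed (h4 (idx (n + 1)))
    have h9 := le_norm_of_perturbed (h4 (idx n))
    have h10 := hidx (n + 1) (idx n)
    have hp : 0 < ‖Z (idx n) n‖ := norm_pos_iff.2 h5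
    have h11 : ‖l (idx (n + 1))‖ * ‖Z (idx (n + 1)) n‖ ≤ ‖l (idx (n + 1))‖ * ‖Z (idx n) n‖ := by
      gcongr
      exact hidx n _
    have h12 := mul_le_mul_of_nonneg_right h7 hp.le
    have h13 : 0 < (‖l (idx n)‖ - ‖l (idx (n + 1))‖) * ‖Z (idx n) n‖ :=
      mul_pos (sub_pos.2 (hl hlt)) hp
    linarith
  have hanti : Antitone fun m => idx (N0 + m) :=
    antitone_nat_of_succ_le fun m => hmono (N0 + m) (by omega)
  obtain ⟨_, ⟨m0, rfl⟩, hm0⟩ := WellFounded.has_min (wellFounded_lt (α := Fin r))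
    (Set.range fun m => idx (N0 + m)) ⟨_, 0, rfl⟩
  set i := idx (N0 + m0) with hi
  have hconst : ∀ᶠ n in atTop, idx n = i := by
    refine eventually_atTop.2 ⟨N0 + m0, fun n hn => ?_⟩
    obtain ⟨m, rfl⟩ := Nat.exists_eq_add_of_le (show N0 ≤ n by omega)
    exact le_antisymm (hanti (show m0 ≤ m by omega)) (not_lt.1 (hm0 _ ⟨m, rfl⟩))
  have h4 : ∀ᶠ n in atTop, Z i n ≠ 0 := by
    filter_upwards [h2, hconst] with n h5 h6
    rwa [h6] at h5
  have h5 : ∀ j, ∀ᶠ n : ℕ in atTop,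
      ‖Z j (n + 1) - l j * Z j n‖ ≤ C * r * ((n : ℝ) + 1)⁻¹ * ‖Z i n‖ := by
    intro j
    filter_upwards [h1, hconst] with n h5 h6
    rw [← h6]
    exact h5 j
  refine ⟨i, h4, fun j hj => ?_, ?_⟩
  · refine decay_of_dominated (hl.injective.ne hj) (by positivity : 0 ≤ C * r) h4 ?_ (h5 j) (h5 i)
    filter_upwards [hconst] with n hn
    rw [← hn]
    exact hidx n j
  · rw [mem_decay_iff]
    refine ⟨C * r, ?_⟩
    filter_upwards [h4, h5 i] with n h6 h7
    rw [pow_one, show Z i (n + 1) / Z i n - l i = (Z i (n + 1) - l i * Z i n) / Z i n by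
      field_simp, norm_div, div_le_iff₀ (norm_pos_iff.2 h6)]
    exact h7

/-- A linear recurrence whose coefficients have asymptotic expansions in powers of `1 / n` and
whose limiting characteristic polynomial has roots of distinct moduli. -/
structure PerronRecurrence (r : ℕ) where
  coeff : Fin r → ℕ → ℂ
  lim : Fin r → ℂ
  root : Fin r → ℂ
  coeff_mem : ∀ i, coeff i ∈ Expandable
  coeff_sub : ∀ i, (coeff i - fun _ => lim i) ∈ Decay 1
  charpoly : Polynomial.X ^ r + ∑ i : Fin r, Polynomial.C (lim i) * Polynomial.X ^ (i : ℕ) =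
    ∏ i : Fin r, (Polynomial.X - Polynomial.C (root i))
  strictAnti : StrictAnti fun i => ‖root i‖

/-! ### Components of a solution along the characteristic roots -/

namespace PerronRecurrence

variable {r : ℕ} (R : PerronRecurrence r)

/-- `y` satisfies the recurrence for all large `n`. -/
def Solves (y : ℕ → ℂ) : Prop :=
  ∀ᶠ n in atTop, y (n + r) + ∑ i : Fin r, R.coeff i n * y (n + i) = 0

lemma root_injective : Function.Injective R.root := fun i j h =>
  R.strictAnti.injective (by simp [h])

/-- The component of a sequence along the `i`-th root. -/
def component (y : ℕ → ℂ) (i : Fin r) : ℕ → ℂ :=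
  Polynomial.aeval seqShift (Lagrange.basis Finset.univ R.root i) y

/-- Lagrange interpolation of `Xᵏ` at the roots is exact for `k < r`; the shift is then substituted
for `X`. -/
lemma shift_eq_sum_component (y : ℕ → ℂ) (k n : ℕ) (hk : k < r) :
    y (n + k) = ∑ i, R.root i ^ k * R.component y i n := by
  have h := Lagrange.eq_interpolate (s := Finset.univ) (v := R.root) (f := Polynomial.X ^ k)
    R.root_injective.injOn (by simpa using hk)
  rw [Lagrange.interpolate_apply] at h
  have h2 := congrArg (fun P => Polynomial.aeval seqShift P y n) h
  have h3 : Polynomial.aeval seqShift (Polynomial.X ^ k : Polynomial ℂ) y n = y (n + k) := by simp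
  rw [← h3]
  simpa [component, Module.algebraMap_end_apply, LinearMap.sum_apply, Finset.sum_apply,
    -map_pow] using h2

/-- The product of `X - root i` and the `i`-th Lagrange basis polynomial is a constant multiple of
the characteristic polynomial. Each component thus satisfies a first order equation driven by the
limit operator applied to `y`. -/
lemma component_shift (y : ℕ → ℂ) (i : Fin r) (n : ℕ) :
    R.component y i (n + 1) - R.root i * R.component y i n =
      Lagrange.nodalWeight Finset.univ R.root i *
        (y (n + r) + ∑ k : Fin r, R.lim k * y (n + k)) := by
  have h1 : (Polynomial.X - Polynomial.C (R.root i)) * Lagrange.basis Finset.univ R.root i =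
      Polynomial.C (Lagrange.nodalWeight Finset.univ R.root i) *
      (Polynomial.X ^ r + ∑ i : Fin r, Polynomial.C (R.lim i) * Polynomial.X ^ (i : ℕ)) := by
    rw [R.charpoly, ← Lagrange.nodal_eq,
      Lagrange.basis_eq_prod_sub_inv_mul_nodal_div (Finset.mem_univ i),
      ← Lagrange.nodal_erase_eq_nodal_div (Finset.mem_univ i),
      Lagrange.nodal_eq_mul_nodal_erase (Finset.mem_univ i)]
    ring
  have h2 := congrArg (fun P => Polynomial.aeval seqShift P y n) h1
  simpa [component, Module.algebraMap_end_apply, LinearMap.sum_apply, Finset.sum_apply] using h2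

variable {R}

lemma exists_shift_norm_le (y : ℕ → ℂ) : ∃ B : ℝ, 0 ≤ B ∧ ∀ (k : Fin r) (n : ℕ),
    ‖y (n + k)‖ ≤ B * ∑ j, ‖R.component y j n‖ := by
  refine ⟨∑ k : Fin r, ∑ j, ‖R.root j‖ ^ (k : ℕ), by positivity, fun k n => ?_⟩
  rw [R.shift_eq_sum_component y k n k.2, Finset.mul_sum]
  refine (norm_sum_le _ _).trans (Finset.sum_le_sum fun j _ => ?_)
  rw [norm_mul, norm_pow]
  gcongr
  calc ‖R.root j‖ ^ (k : ℕ) ≤ ∑ j, ‖R.root j‖ ^ (k : ℕ) :=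
        Finset.single_le_sum (f := fun j => ‖R.root j‖ ^ (k : ℕ))
          (fun j _ => by positivity) (Finset.mem_univ j)
    _ ≤ _ := Finset.single_le_sum (f := fun k : Fin r => ∑ j, ‖R.root j‖ ^ (k : ℕ))
          (fun j _ => by positivity) (Finset.mem_univ k)

lemma exists_coeff_sub_norm_le : ∃ K : ℝ, 0 ≤ K ∧ ∀ᶠ n : ℕ in atTop, ∀ k,
    ‖R.coeff k n - R.lim k‖ ≤ K * ((n : ℝ) + 1)⁻¹ := by
  choose K hK using fun k => mem_decay_iff.1 (R.coeff_sub k)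
  refine ⟨∑ k, |K k|, by positivity, ?_⟩
  filter_upwards [eventually_all.2 hK] with n hn k
  refine (hn k).trans ?_
  rw [pow_one]
  gcongr
  exact (le_abs_self _).trans (Finset.single_le_sum (f := fun k => |K k|)
    (fun j _ => abs_nonneg _) (Finset.mem_univ k))

/-- If all components vanish at one large index, then `r` consecutive values of `y` vanish, and the
recurrence propagates zero forwards. -/
lemma Solves.exists_component_ne_zero {y : ℕ → ℂ} (hy : R.Solves y)
    (h0 : ¬ ∀ᶠ n in atTop, y n = 0) : ∀ᶠ n in atTop, ∃ i, R.component y i n ≠ 0 := by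
  obtain ⟨N, hN⟩ := eventually_atTop.1 hy
  refine eventually_atTop.2 ⟨N, fun n hn => ?_⟩
  by_contra! hz
  refine h0 (eventually_atTop.2 ⟨n, fun m hm => ?_⟩)
  obtain ⟨m, rfl⟩ := Nat.exists_eq_add_of_le hm
  clear hm
  induction m using Nat.strong_induction_on with
  | _ m ih =>
    by_cases hm : m < r
    · rw [R.shift_eq_sum_component y m n hm]
      simp [hz]
    · have h1 := hN (n + (m - r)) (by omega)
      rw [show n + (m - r) + r = n + m by omega] at h1
      rw [Finset.sum_eq_zero, add_zero] at h1
      · exact h1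
      · intro i _
        rw [add_assoc, ih _ (by omega), mul_zero]

lemma Solves.exists_root {y : ℕ → ℂ} (hy : R.Solves y) (h0 : ¬ ∀ᶠ n in atTop, y n = 0) :
    ∃ i, (∀ᶠ n in atTop, y n ≠ 0) ∧ (fun n => y (n + 1) / y n - R.root i) ∈ Decay 1 := by
  obtain ⟨B, hB0, hB⟩ := exists_shift_norm_le (R := R) y
  obtain ⟨K, hK0, hK⟩ := exists_coeff_sub_norm_le (R := R)
  set W := ∑ i, ‖Lagrange.nodalWeight Finset.univ R.root i‖
  have hW0 : 0 ≤ W := by positivity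
  have h1 : ∀ᶠ n : ℕ in atTop, ∀ i, ‖R.component y i (n + 1) - R.root i * R.component y i n‖ ≤
      (W * (r * (K * B))) * ((n : ℝ) + 1)⁻¹ * ∑ j, ‖R.component y j n‖ := by
    filter_upwards [hy, hK] with n h2 h3 i
    -- On a solution the limit operator leaves only the deviations of the coefficients from their
    -- limits, which are `O(1/n)`.
    have h4 : y (n + r) + ∑ k : Fin r, R.lim k * y (n + k) =
        ∑ k : Fin r, -((R.coeff k n - R.lim k) * y (n + k)) := by
      rw [eq_neg_of_add_eq_zero_left h2, ← Finset.sum_neg_distrib, ← Finset.sum_add_distrib]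
      exact Finset.sum_congr rfl fun k _ => by ring
    rw [R.component_shift, h4, norm_mul]
    have h5 : ‖∑ k : Fin r, -((R.coeff k n - R.lim k) * y (n + k))‖ ≤
        r * ((K * ((n : ℝ) + 1)⁻¹) * (B * ∑ j, ‖R.component y j n‖)) := by
      refine (norm_sum_le _ _).trans ?_
      refine (Finset.sum_le_card_nsmul _ _
        ((K * ((n : ℝ) + 1)⁻¹) * (B * ∑ j, ‖R.component y j n‖)) fun k _ => ?_).trans ?_
      · rw [norm_neg, norm_mul]
        exact mul_le_mul (h3 k) (hB k n) (norm_nonneg _) (by positivity)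
      · simp
    calc _ ≤ W * (r * ((K * ((n : ℝ) + 1)⁻¹) * (B * ∑ j, ‖R.component y j n‖))) := by
          refine mul_le_mul ?_ h5 (norm_nonneg _) hW0
          exact Finset.single_le_sum
            (f := fun i => ‖Lagrange.nodalWeight Finset.univ R.root i‖)
            (fun j _ => norm_nonneg _) (Finset.mem_univ i)
      _ = _ := by ring
  obtain ⟨i, h2, h3, h4⟩ := exists_dominant R.strictAnti (by positivity) h1
    (hy.exists_component_ne_zero h0)
  set ζ := R.component y i with hζ
  have hr : 0 < r := i.pos
  set f : ℕ → ℂ := y / ζ with hf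
  have hf1 : (f - fun _ => 1) ∈ Decay 1 := by
    -- The components sum to `y`, so `y/ζ` is `1` plus the quotients of the other components by the
    -- dominant one.
    have h5 : ∑ j ∈ Finset.univ.erase i, R.component y j / ζ ∈ Decay 1 :=
      Submodule.sum_mem _ fun j hj => h3 j (Finset.ne_of_mem_erase hj)
    refine decay_congr h5 ?_
    filter_upwards [h2] with n hn
    have h6 := R.shift_eq_sum_component y 0 n hr
    simp only [add_zero, pow_zero, one_mul] at h6
    rw [hf, Pi.sub_apply, Pi.div_apply, h6, ← Finset.add_sum_erase _ _ (Finset.mem_univ i),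
      add_div, div_self hn, Finset.sum_apply, Finset.sum_div]
    simp
  have hflim := tendsto_of_sub_decay hf1
  have hf0 := hflim.eventually_ne one_ne_zero
  have hy0 : ∀ᶠ n in atTop, y n ≠ 0 := by
    filter_upwards [hf0] with n hn hyn
    exact hn (by rw [hf, Pi.div_apply, hyn, zero_div])
  refine ⟨i, hy0, ?_⟩
  have hq0 : (fun n => ζ (n + 1) / ζ n) ∈ Decay 0 := by
    have := tendsto_of_sub_decay (f := fun n => ζ (n + 1) / ζ n) (c := R.root i) h4
    exact decay_zero_of_tendsto this
  have hff : seqShift f - f ∈ Decay 1 := by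
    have := Submodule.sub_mem _ (seqShift_mem_decay hf1) hf1
    convert this using 1
    funext n
    simp
  -- This is `y(n+1)/y(n) - l = (f(n+1) - f(n)) · (ζ(n+1)/ζ(n)) / f(n) + (ζ(n+1)/ζ(n) - l)` with `f
  -- = y/ζ` and `l` the root. No division by `l` occurs, so a zero root is allowed.
  have h7 := Submodule.add_mem _
    (decay_mul_zero (decay_mul_zero hff hq0) (inv_mem_decay_zero one_ne_zero hflim)) h4
  refine decay_congr h7 ?_
  filter_upwards [h2, (tendsto_add_atTop_nat 1).eventually h2, hy0] with n h8 h9 h10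
  simp only [hf, Pi.add_apply, Pi.mul_apply, Pi.sub_apply, Pi.inv_apply, Pi.div_apply,
    seqShift_apply]
  field_simp
  ring

end PerronRecurrence

/-! ### Asymptotic expansions of quotients of solutions -/

/-- The product `ρ(n) ρ(n+1) ⋯ ρ(n+k-1)`. -/
def shiftProd (ρ : ℕ → ℂ) (k : ℕ) : ℕ → ℂ := ∏ j ∈ Finset.range k, (seqShift ^ j) ρ

lemma shiftProd_zero (ρ : ℕ → ℂ) : shiftProd ρ 0 = 1 := rfl

lemma shiftProd_succ (ρ : ℕ → ℂ) (k : ℕ) :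
    shiftProd ρ (k + 1) = shiftProd ρ k * (seqShift ^ k) ρ := Finset.prod_range_succ _ _

lemma shiftProd_mem_expandable {ρ : ℕ → ℂ} (h : ρ ∈ Expandable) (k : ℕ) :
    shiftProd ρ k ∈ Expandable := prod_mem fun j _ => seqShift_pow_mem_expandable h j

lemma seqShift_pow_sub_const_mem_decay {ρ : ℕ → ℂ} {l : ℂ} (h : (ρ - fun _ => l) ∈ Decay 1)
    (k : ℕ) : ((seqShift ^ k) ρ - fun _ => l) ∈ Decay 1 := by
  have := seqShift_pow_mem_decay h k
  rw [map_sub] at this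
  convert this using 2
  funext n
  simp

lemma decay_zero_of_sub_const {ρ : ℕ → ℂ} {l : ℂ} (h : (ρ - fun _ => l) ∈ Decay 1) :
    ρ ∈ Decay 0 := decay_zero_of_tendsto (tendsto_of_sub_decay h)

lemma shiftProd_sub_const_mem_decay {ρ : ℕ → ℂ} {l : ℂ} (h : (ρ - fun _ => l) ∈ Decay 1)
    (k : ℕ) : (shiftProd ρ k - fun _ => l ^ k) ∈ Decay 1 := by
  induction k with
  | zero =>
    convert Submodule.zero_mem (Decay 1) using 1
    funext n
    simp [shiftProd_zero]
  | succ k ih =>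
    have h1 := seqShift_pow_sub_const_mem_decay h k
    have := Submodule.add_mem _ (decay_mul_zero ih (decay_zero_of_sub_const h1))
      (decay_zero_mul (const_mem_decay (l ^ k)) h1)
    convert this using 1
    funext n
    simp only [shiftProd_succ, Pi.sub_apply, Pi.mul_apply, Pi.add_apply]
    ring

lemma shiftProd_mem_decay_zero {ρ : ℕ → ℂ} {l : ℂ} (h : (ρ - fun _ => l) ∈ Decay 1) (k : ℕ) :
    shiftProd ρ k ∈ Decay 0 := decay_zero_of_sub_const (shiftProd_sub_const_mem_decay h k)

lemma shiftProd_ratio_mul {y : ℕ → ℂ} (hy : ∀ᶠ n in atTop, y n ≠ 0) :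
    ∀ᶠ n in atTop, ∀ k, shiftProd (fun m => y (m + 1) / y m) k n * y n = y (n + k) := by
  obtain ⟨N, hN⟩ := eventually_atTop.1 hy
  refine eventually_atTop.2 ⟨N, fun n hn k => ?_⟩
  induction k with
  | zero => simp [shiftProd_zero]
  | succ k ih =>
    rw [shiftProd_succ, Pi.mul_apply, mul_right_comm, ih, seqShift_pow_apply,
      mul_div_cancel₀ _ (hN (n + k) (by omega))]
    rfl

/-- The divided difference `(X ^ k - l ^ k) / (X - l)`. -/
def powQuot (l : ℂ) (k : ℕ) : Polynomial ℂ :=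
  ∑ j ∈ Finset.range k, Polynomial.X ^ j * Polynomial.C l ^ (k - 1 - j)

lemma powQuot_succ (l : ℂ) (k : ℕ) :
    powQuot l (k + 1) = Polynomial.X ^ k + Polynomial.C l * powQuot l k :=
  (Commute.all _ _).geom_sum₂_succ_eq

lemma sub_mul_powQuot (l : ℂ) (k : ℕ) :
    (Polynomial.X - Polynomial.C l) * powQuot l k = Polynomial.X ^ k - Polynomial.C l ^ k := by
  rw [mul_comm]
  exact (Commute.all _ _).geom_sum₂_mul k

/-- The linearization of `shiftProd · k` at the constant sequence `l`, as a polynomial in the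
shift. -/
def linPoly (l : ℂ) (k : ℕ) : Polynomial ℂ :=
  (powQuot l k).comp (Polynomial.C l * Polynomial.X)

lemma linPoly_succ (l : ℂ) (k : ℕ) : linPoly l (k + 1) =
    Polynomial.C (l ^ k) * Polynomial.X ^ k + Polynomial.C l * linPoly l k := by
  simp [linPoly, powQuot_succ, mul_pow]

/-- Product rule: replacing any remaining factor by its limit `l` costs one order, because it
multiplies a difference of order `n⁻ᴹ` by a deviation of order `1/n`. -/
lemma shiftProd_linearization {ρ σ : ℕ → ℂ} {l : ℂ} {M : ℕ} (hρ : (ρ - fun _ => l) ∈ Decay 1)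
    (hσ : (σ - fun _ => l) ∈ Decay 1) (h : ρ - σ ∈ Decay M) (k : ℕ) :
    shiftProd ρ k - shiftProd σ k - Polynomial.aeval seqShift (linPoly l k) (ρ - σ) ∈
      Decay (M + 1) := by
  induction k with
  | zero => simp [shiftProd_zero, linPoly, powQuot]
  | succ k ih =>
    have h1 := decay_mul (seqShift_pow_mem_decay h k) (shiftProd_sub_const_mem_decay hρ k)
    have h2 := decay_mul_zero ih (decay_zero_of_sub_const (seqShift_pow_sub_const_mem_decay hσ k))
    have h3 := decay_mul (aeval_seqShift_mem_decay h (linPoly l k))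
      (seqShift_pow_sub_const_mem_decay hσ k)
    convert Submodule.add_mem _ (Submodule.add_mem _ h1 h2) h3 using 1
    rw [linPoly_succ]
    funext n
    simp only [shiftProd_succ, map_add, map_mul, Polynomial.aeval_C, map_pow, Polynomial.aeval_X,
      Pi.add_apply, Pi.mul_apply, Pi.sub_apply, LinearMap.add_apply, Module.End.mul_apply,
      map_sub]
    rw [← map_pow]
    simp only [Module.algebraMap_end_apply, Pi.smul_apply, smul_eq_mul]
    ring

lemma exists_coeff_of_decay {f : ℕ → ℂ} {M : ℕ} (hf : f ∈ Expandable) (h : f ∈ Decay M) :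
    ∃ c : ℂ, f - c • invSucc ^ M ∈ Decay (M + 1) := by
  set g : ℕ → ℂ := fun n => f n * (invSucc n ^ M)⁻¹ with hg
  have hgf : g * invSucc ^ M = f := by
    funext n
    have := pow_ne_zero M (invSucc_ne_zero n)
    simp only [hg, Pi.mul_apply, Pi.pow_apply]
    field_simp
  have hg0 : g ∈ Decay 0 := by
    have := Asymptotics.IsBigO.mul h
      (Asymptotics.isBigO_refl (fun n => (invSucc n ^ M)⁻¹) atTop)
    refine this.congr_right fun n => ?_
    have := invSucc_ne_zero n
    field_simp
  obtain ⟨c, hc⟩ := exists_limit_of_expandable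
    (expandable_of_mul_invSucc_pow hg0 M (by rwa [hgf]))
  refine ⟨c, ?_⟩
  have h1 := decay_mul (invSucc_pow_mem_decay M) hc
  convert h1 using 1
  rw [← hgf]
  funext n
  simp only [Pi.sub_apply, Pi.mul_apply, Pi.smul_apply, smul_eq_mul]
  ring

lemma seqShift_pow_invSucc_pow_sub (M k : ℕ) :
    (seqShift ^ k) (invSucc ^ M) - invSucc ^ M ∈ Decay (M + 1) := by
  have h1 : seqShift (invSucc ^ M) - invSucc ^ M ∈ Decay (M + 1) := by
    have h2 : ((1 + invSucc)⁻¹ ^ M - fun _ => (1 : ℂ)) ∈ Decay 1 := by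
      refine sub_limit_mem_decay (pow_mem inv_one_add_invSucc_mem_expandable M) ?_
      have := ((tendsto_of_sub_decay one_add_invSucc_sub_mem_decay).inv₀ one_ne_zero).pow M
      rw [inv_one, one_pow] at this
      exact this
    have h3 := decay_mul (invSucc_pow_mem_decay M) h2
    convert h3 using 1
    have h4 : seqShift (invSucc ^ M) = (seqShift invSucc) ^ M := rfl
    rw [h4, seqShift_invSucc, mul_pow]
    funext n
    simp only [Pi.sub_apply, Pi.mul_apply]
    ring
  induction k with
  | zero => simp
  | succ k ih =>
    have := Submodule.add_mem _ (seqShift_mem_decay ih) h1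
    convert this using 1
    rw [pow_succ', Module.End.mul_apply, map_sub]
    ring

/-- To leading order the shift fixes `(n+1)⁻ᴹ`, so a polynomial in the shift acts as its value at
`1`. -/
lemma aeval_seqShift_invSucc_pow_sub (P : Polynomial ℂ) (M : ℕ) :
    Polynomial.aeval seqShift P (invSucc ^ M) - P.eval 1 • invSucc ^ M ∈ Decay (M + 1) := by
  induction P using Polynomial.induction_on' with
  | add p q hp hq =>
    convert Submodule.add_mem _ hp hq using 1
    rw [map_add, LinearMap.add_apply, Polynomial.eval_add, add_smul]
    ring
  | monomial k c =>
    convert Submodule.smul_mem _ c (seqShift_pow_invSucc_pow_sub M k) using 1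
    funext n
    simp [Polynomial.aeval_monomial, Module.algebraMap_end_apply, mul_sub]

/-! ### The Riccati equation of the quotients -/

namespace PerronRecurrence

variable {r : ℕ} (R : PerronRecurrence r)

/-- The Riccati operator of the recurrence: it vanishes on the quotients `y(n+1)/y(n)` of
solutions. -/
def riccati (ρ : ℕ → ℂ) : ℕ → ℂ := shiftProd ρ r + ∑ i : Fin r, R.coeff i * shiftProd ρ i

lemma Solves.riccati_eq_zero {R : PerronRecurrence r} {y : ℕ → ℂ} (hy : R.Solves y)
    (h0 : ∀ᶠ n in atTop, y n ≠ 0) :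
    R.riccati (fun n => y (n + 1) / y n) =ᶠ[atTop] 0 := by
  filter_upwards [hy, h0, shiftProd_ratio_mul h0] with n h1 h2 h3
  refine (mul_eq_zero.1 ?_).resolve_right h2
  rw [← h1, riccati, Pi.add_apply, add_mul, h3, Finset.sum_apply, Finset.sum_mul]
  congr 1
  refine Finset.sum_congr rfl fun i _ => ?_
  rw [Pi.mul_apply, mul_assoc, h3]

lemma riccati_mem_expandable {ρ : ℕ → ℂ} (h : ρ ∈ Expandable) : R.riccati ρ ∈ Expandable :=
  add_mem (shiftProd_mem_expandable h r)
    (sum_mem fun i _ => mul_mem (R.coeff_mem i) (shiftProd_mem_expandable h i))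

/-- The linearization of the Riccati operator at the constant sequence `root i`. -/
def riccatiLin (i : Fin r) : Polynomial ℂ :=
  ∏ j ∈ Finset.univ.erase i,
    (Polynomial.C (R.root i) * Polynomial.X - Polynomial.C (R.root j))

/-- The divided difference of the characteristic polynomial at `root i` is the product over the
other roots. Substituting `root i · X` for `X` turns divided differences of powers into the
linearizations of the shifted products. -/
lemma riccatiLin_eq (i : Fin r) : R.riccatiLin i =
    linPoly (R.root i) r + ∑ k : Fin r, Polynomial.C (R.lim k) * linPoly (R.root i) k := by
  have h1 : powQuot (R.root i) r + ∑ k : Fin r, Polynomial.C (R.lim k) * powQuot (R.root i) k =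
      ∏ j ∈ Finset.univ.erase i, (Polynomial.X - Polynomial.C (R.root j)) := by
    refine mul_left_cancel₀ (Polynomial.X_sub_C_ne_zero (R.root i)) ?_
    rw [Finset.mul_prod_erase Finset.univ
      (fun j => Polynomial.X - Polynomial.C (R.root j)) (Finset.mem_univ i), ← R.charpoly,
      mul_add, Finset.mul_sum, sub_mul_powQuot]
    have h2 : ∀ k : Fin r, (Polynomial.X - Polynomial.C (R.root i)) *
        (Polynomial.C (R.lim k) * powQuot (R.root i) k) =
        Polynomial.C (R.lim k) * Polynomial.X ^ (k : ℕ) -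
        Polynomial.C (R.lim k * R.root i ^ (k : ℕ)) := by
      intro k
      rw [mul_left_comm, sub_mul_powQuot, Polynomial.C_mul, Polynomial.C_pow]
      ring
    rw [Finset.sum_congr rfl fun k _ => h2 k, Finset.sum_sub_distrib]
    have h3 := congrArg (Polynomial.eval (R.root i)) R.charpoly
    rw [Polynomial.eval_prod, Finset.prod_eq_zero (Finset.mem_univ i) (by simp)] at h3
    simp only [Polynomial.eval_add, Polynomial.eval_pow, Polynomial.eval_X,
      Polynomial.eval_finsetSum, Polynomial.eval_mul, Polynomial.eval_C] at h3
    have h4 := congrArg Polynomial.C h3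
    rw [Polynomial.C_add, Polynomial.C_pow, map_sum, Polynomial.C_0] at h4
    linear_combination -h4
  have h5 := congrArg (fun P => Polynomial.comp P (Polynomial.C (R.root i) * Polynomial.X)) h1
  simp only [Polynomial.add_comp, Polynomial.sum_comp, Polynomial.mul_comp,
    Polynomial.C_comp, Polynomial.prod_comp, Polynomial.sub_comp, Polynomial.X_comp] at h5
  exact h5.symm

variable {R} {i : Fin r}

lemma riccati_linearization {ρ σ : ℕ → ℂ} {M : ℕ} (hρ : (ρ - fun _ => R.root i) ∈ Decay 1)
    (hσ : (σ - fun _ => R.root i) ∈ Decay 1) (h : ρ - σ ∈ Decay M) :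
    R.riccati ρ - R.riccati σ - Polynomial.aeval seqShift (R.riccatiLin i) (ρ - σ) ∈
      Decay (M + 1) := by
  have h1 : ∀ k : Fin r, R.coeff k * (shiftProd ρ k - shiftProd σ k) -
      R.lim k • Polynomial.aeval seqShift (linPoly (R.root i) k) (ρ - σ) ∈ Decay (M + 1) := by
    intro k
    have h2 := decay_zero_mul (decay_zero_of_expandable (R.coeff_mem k))
      (shiftProd_linearization hρ hσ h k)
    have h3 := decay_mul (aeval_seqShift_mem_decay h (linPoly (R.root i) k)) (R.coeff_sub k)
    convert Submodule.add_mem _ h2 h3 using 1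
    funext n
    simp only [Pi.add_apply, Pi.mul_apply, Pi.sub_apply, Pi.smul_apply, smul_eq_mul]
    ring
  convert Submodule.add_mem _ (shiftProd_linearization hρ hσ h r)
    (Submodule.sum_mem _ fun k (_ : k ∈ Finset.univ) => h1 k) using 1
  rw [riccatiLin_eq, Finset.sum_sub_distrib, riccati, riccati]
  simp only [mul_sub, Finset.sum_sub_distrib, map_add, map_sum, map_mul, Polynomial.aeval_C,
    LinearMap.add_apply, LinearMap.sum_apply, Module.End.mul_apply, Module.algebraMap_end_apply]
  ring

/-- The linearization factors into operators `root i · S - root j` with `‖root i‖ ≠ ‖root j‖`, and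
these can be inverted without loss of order. A Riccati defect of higher order therefore improves the
approximation by one order. -/
lemma decay_succ_of_riccati {ρ σ : ℕ → ℂ} {M : ℕ} (hρ : (ρ - fun _ => R.root i) ∈ Decay 1)
    (hσ : (σ - fun _ => R.root i) ∈ Decay 1) (h : ρ - σ ∈ Decay M)
    (hΦ : R.riccati ρ - R.riccati σ ∈ Decay (M + 1)) : ρ - σ ∈ Decay (M + 1) := by
  have h1 := Submodule.sub_mem _ hΦ (riccati_linearization hρ hσ h)
  rw [sub_sub_cancel] at h1
  refine decay_of_aeval_prod (Finset.univ.erase i) (fun j hj => ?_)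
    (decay_mono (Nat.zero_le M) h) h1
  exact R.strictAnti.injective.ne (Finset.ne_of_mem_erase hj).symm

/-- Two solutions with the same limiting quotient have the same asymptotic expansion of the
quotients. -/
lemma sub_mem_decay_of_riccati {ρ σ : ℕ → ℂ} (hρ : (ρ - fun _ => R.root i) ∈ Decay 1)
    (hσ : (σ - fun _ => R.root i) ∈ Decay 1) (hρ0 : R.riccati ρ =ᶠ[atTop] 0)
    (hσ0 : R.riccati σ =ᶠ[atTop] 0) (N : ℕ) : ρ - σ ∈ Decay N := by
  induction N with
  | zero => exact Submodule.sub_mem _ (decay_zero_of_sub_const hρ) (decay_zero_of_sub_const hσ)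
  | succ N ih =>
    refine decay_succ_of_riccati hρ hσ ih (decay_congr (Submodule.zero_mem _) ?_)
    filter_upwards [hρ0, hσ0] with n h1 h2
    simp [h1, h2]

lemma eval_one_riccatiLin_ne_zero : (R.riccatiLin i).eval 1 ≠ 0 := by
  rw [riccatiLin, Polynomial.eval_prod]
  refine Finset.prod_ne_zero_iff.2 fun j hj => ?_
  simpa [sub_eq_zero] using R.root_injective.ne (Finset.ne_of_mem_erase hj).symm

/-- The coefficients of the formal solution are found one by one, as in a Newton iteration; each
correction cancels the leading term of the Riccati defect. -/
lemma expandable_of_riccati {ρ : ℕ → ℂ} (hρ : (ρ - fun _ => R.root i) ∈ Decay 1)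
    (hρ0 : R.riccati ρ =ᶠ[atTop] 0) : ρ ∈ Expandable := by
  have key : ∀ N, ∃ P : Polynomial ℂ, ρ - Polynomial.aeval invSucc P ∈ Decay (N + 1) := by
    intro N
    induction N with
    | zero => exact ⟨Polynomial.C (R.root i), by rw [Polynomial.aeval_C]; exact hρ⟩
    | succ N ih =>
      obtain ⟨P, hP⟩ := ih
      have hσ : ∀ Q : Polynomial ℂ, ρ - Polynomial.aeval invSucc Q ∈ Decay (N + 1) →
          (Polynomial.aeval invSucc Q - fun _ => R.root i) ∈ Decay 1 := by
        intro Q hQ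
        have := Submodule.sub_mem _ hρ (decay_mono (show 1 ≤ N + 1 by omega) hQ)
        convert this using 1
        ring
      set σ := Polynomial.aeval invSucc P with hσdef
      have hρσ : ∀ M τ, R.riccati ρ - τ ∈ Decay M ↔ τ ∈ Decay M := by
        intro M τ
        have h1 : R.riccati ρ ∈ Decay M := decay_congr (Submodule.zero_mem _) hρ0.symm
        exact Submodule.sub_mem_iff_right _ h1
      have h2 : R.riccati σ ∈ Decay (N + 1) := by
        rw [← hρσ]
        have := Submodule.add_mem _ (decay_mono (Nat.le_succ _)
          (riccati_linearization hρ (hσ P hP) hP))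
          (aeval_seqShift_mem_decay hP (R.riccatiLin i))
        rwa [sub_add_cancel] at this
      obtain ⟨c, hc⟩ := exists_coeff_of_decay
        (R.riccati_mem_expandable (aeval_invSucc_mem_expandable P)) h2
      -- Adding `κ (n+1)^{-(N+1)}` changes the defect by `κ` times the value of the linearization at
      -- `1`, which is nonzero since the roots are distinct. This `κ` cancels the term `c`.
      set κ := -c / (R.riccatiLin i).eval 1 with hκ
      have hκc : κ * (R.riccatiLin i).eval 1 = -c :=
        div_mul_cancel₀ _ eval_one_riccatiLin_ne_zero
      refine ⟨P + Polynomial.C κ * Polynomial.X ^ (N + 1), ?_⟩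
      set Q := P + Polynomial.C κ * Polynomial.X ^ (N + 1) with hQdef
      have hQ : Polynomial.aeval invSucc Q = σ + κ • invSucc ^ (N + 1) := by
        rw [hQdef, map_add, map_mul, Polynomial.aeval_C, map_pow, Polynomial.aeval_X,
          Algebra.smul_def]
      have hm : κ • invSucc ^ (N + 1) ∈ Decay (N + 1) :=
        Submodule.smul_mem _ _ (invSucc_pow_mem_decay _)
      have h3 : ρ - Polynomial.aeval invSucc Q ∈ Decay (N + 1) := by
        rw [hQ, ← sub_sub]
        exact Submodule.sub_mem _ hP hm
      refine decay_succ_of_riccati hρ (hσ Q h3) h3 ((hρσ _ _).2 ?_)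
      have h4 : Polynomial.aeval invSucc Q - σ = κ • invSucc ^ (N + 1) := by rw [hQ]; ring
      have h5 := riccati_linearization (hσ Q h3) (hσ P hP) (by rw [h4]; exact hm)
      rw [h4, map_smul] at h5
      have h6 := Submodule.smul_mem _ κ
        (aeval_seqShift_invSucc_pow_sub (R.riccatiLin i) (N + 1))
      convert Submodule.add_mem _ (Submodule.add_mem _ h5 h6) hc using 1
      rw [smul_sub, smul_smul, hκc, neg_smul]
      ring
  intro N
  obtain ⟨P, hP⟩ := key N
  exact ⟨P, decay_mono (Nat.le_succ N) hP⟩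

end PerronRecurrence

/-! ### Values of rational functions in one variable -/

/-- The value of a rational function at a rational number. -/
def ratEval (t : ℚ) (f : RatFunc ℚ) : ℚ := RatFunc.eval (RingHom.id ℚ) t f

lemma atNat_eq_ratEval (f : RatFunc ℚ) (n : ℕ) : RatFunc.atNat f n = ratEval n f := rfl

lemma ratEval_eq (t : ℚ) (f : RatFunc ℚ) : ratEval t f = f.num.eval t / f.denom.eval t := by
  simp [ratEval, RatFunc.eval]

@[simp] lemma ratEval_zero (t : ℚ) : ratEval t 0 = 0 := by simp [ratEval]

@[simp] lemma ratEval_one (t : ℚ) : ratEval t 1 = 1 := by simp [ratEval]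

lemma eventually_polynomial_eval_ne_zero {p : Polynomial ℚ} (hp : p ≠ 0) :
    ∀ᶠ t in cofinite, p.eval t ≠ 0 := by
  rw [eventually_cofinite]
  simpa using Polynomial.finite_setOfPred_isRoot hp

lemma denom_div_eval_ne_zero {p q : Polynomial ℚ} {t : ℚ} (ht : q.eval t ≠ 0) :
    (algebraMap (Polynomial ℚ) (RatFunc ℚ) p / algebraMap (Polynomial ℚ) (RatFunc ℚ) q).denom.eval t
      ≠ 0 := fun h => ht (by
  obtain ⟨c, hc⟩ := RatFunc.denom_div_dvd p q
  rw [hc, Polynomial.eval_mul, h, zero_mul])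

lemma ratEval_div {p q : Polynomial ℚ} {t : ℚ} (ht : q.eval t ≠ 0) :
    ratEval t (algebraMap (Polynomial ℚ) (RatFunc ℚ) p / algebraMap (Polynomial ℚ) (RatFunc ℚ) q) =
      p.eval t / q.eval t := by
  have hq : q ≠ 0 := by rintro rfl; simp at ht
  set f := algebraMap (Polynomial ℚ) (RatFunc ℚ) p / algebraMap (Polynomial ℚ) (RatFunc ℚ) q with hf
  have h1 : f.num * q = p * f.denom := by
    refine RatFunc.algebraMap_injective ℚ ?_
    have h4 : algebraMap (Polynomial ℚ) (RatFunc ℚ) q ≠ 0 := RatFunc.algebraMap_ne_zero hq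
    have h5 : algebraMap (Polynomial ℚ) (RatFunc ℚ) f.denom ≠ 0 :=
      RatFunc.algebraMap_ne_zero f.denom_ne_zero
    rw [map_mul, map_mul, ← div_eq_div_iff h5 h4, RatFunc.num_div_denom]
  have h3 : f.denom.eval t ≠ 0 := denom_div_eval_ne_zero ht
  rw [ratEval_eq, div_eq_div_iff h3 ht]
  simpa using congrArg (Polynomial.eval t) h1

lemma eventually_denom_ne_zero (f : RatFunc ℚ) : ∀ᶠ t in cofinite, f.denom.eval t ≠ 0 :=
  eventually_polynomial_eval_ne_zero f.denom_ne_zero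

lemma eventually_ratEval_ne_zero {f : RatFunc ℚ} (hf : f ≠ 0) :
    ∀ᶠ t in cofinite, ratEval t f ≠ 0 := by
  filter_upwards [eventually_denom_ne_zero f,
    eventually_polynomial_eval_ne_zero (RatFunc.num_ne_zero hf)] with t h1 h2
  rw [ratEval_eq]
  exact div_ne_zero h2 h1

/-- Evaluation of reduced fractions respects the field operations only away from poles. Identities
in `ℚ(n)` are therefore transferred along the cofinite filter on `ℚ`, which also covers all large
natural numbers. -/
lemma eventually_ratEval_add (f g : RatFunc ℚ) :
    ∀ᶠ t in cofinite, ratEval t (f + g) = ratEval t f + ratEval t g := by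
  filter_upwards [eventually_denom_ne_zero f, eventually_denom_ne_zero g] with t h1 h2
  exact RatFunc.eval_add (RingHom.id ℚ) t (by simpa using h1) (by simpa using h2)

lemma eventually_ratEval_mul (f g : RatFunc ℚ) :
    ∀ᶠ t in cofinite, ratEval t (f * g) = ratEval t f * ratEval t g := by
  filter_upwards [eventually_denom_ne_zero f, eventually_denom_ne_zero g] with t h1 h2
  exact RatFunc.eval_mul (RingHom.id ℚ) t (by simpa using h1) (by simpa using h2)

lemma eventually_ratEval_neg (f : RatFunc ℚ) :
    ∀ᶠ t in cofinite, ratEval t (-f) = -ratEval t f := by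
  filter_upwards [eventually_ratEval_add f (-f)] with t h
  rw [add_neg_cancel, ratEval_zero] at h
  linarith

lemma eventually_ratEval_sum {ι : Type*} (s : Finset ι) (f : ι → RatFunc ℚ) :
    ∀ᶠ t in cofinite, ratEval t (∑ i ∈ s, f i) = ∑ i ∈ s, ratEval t (f i) := by
  classical
  induction s using Finset.induction_on with
  | empty => simp
  | insert i s hi ih =>
    filter_upwards [ih, eventually_ratEval_add (f i) (∑ i ∈ s, f i)] with t h1 h2
    rw [Finset.sum_insert hi, Finset.sum_insert hi, h2, h1]

lemma eventually_ratEval_sum_mul {ι : Type*} [Fintype ι] (f g : ι → RatFunc ℚ) :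
    ∀ᶠ t in cofinite, ratEval t (∑ i, f i * g i) = ∑ i, ratEval t (f i) * ratEval t (g i) := by
  filter_upwards [eventually_ratEval_sum Finset.univ fun i => f i * g i,
    eventually_all.2 fun i => eventually_ratEval_mul (f i) (g i)] with t h1 h2
  rw [h1]
  exact Finset.sum_congr rfl fun i _ => h2 i

lemma eventually_ratEval_matrix_mul {m : ℕ} (A B : Matrix (Fin m) (Fin m) (RatFunc ℚ)) :
    ∀ᶠ t in cofinite, (A * B).map (ratEval t) = A.map (ratEval t) * B.map (ratEval t) := by
  have h : ∀ i j, ∀ᶠ t in cofinite,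
      ratEval t ((A * B) i j) = ∑ k, ratEval t (A i k) * ratEval t (B k j) := fun i j =>
    eventually_ratEval_sum_mul (fun k => A i k) (fun k => B k j)
  filter_upwards [eventually_all.2 fun i => eventually_all.2 (h i)] with t ht
  ext i j
  exact ht i j

/-- The substitution `f(X) ↦ f(X + c)`. -/
def ratShift (c : ℚ) (f : RatFunc ℚ) : RatFunc ℚ :=
  algebraMap (Polynomial ℚ) (RatFunc ℚ) (f.num.comp (Polynomial.X + Polynomial.C c)) /
    algebraMap (Polynomial ℚ) (RatFunc ℚ) (f.denom.comp (Polynomial.X + Polynomial.C c))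

lemma tendsto_add_const_cofinite (c : ℚ) : Tendsto (fun t : ℚ => t + c) cofinite cofinite :=
  (add_left_injective c).tendsto_cofinite

lemma eventually_ratEval_ratShift (c : ℚ) (f : RatFunc ℚ) :
    ∀ᶠ t in cofinite, ratEval t (ratShift c f) = ratEval (t + c) f := by
  filter_upwards [(tendsto_add_const_cofinite c).eventually (eventually_denom_ne_zero f)] with t ht
  rw [ratShift, ratEval_div (by simpa using ht), ratEval_eq]
  simp

lemma tendsto_natCast_cofinite : Tendsto (fun n : ℕ => (n : ℚ)) atTop cofinite := by
  rw [← Nat.cofinite_eq_atTop]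
  exact Nat.cast_injective.tendsto_cofinite

/-! ### Companion matrices and operators of lower order -/

section Companion

variable {r : ℕ} [NeZero r] (a : Fin r → RatFunc ℚ)

/-- The value of the companion matrix at a rational number. -/
def companionAt (t : ℚ) : Matrix (Fin r) (Fin r) ℚ :=
  Matrix.of fun i j =>
    if j = CMF.lastIdx r then -ratEval t (a i) else if i.val = j.val + 1 then 1 else 0

lemma eventually_companion_map :
    ∀ᶠ t in cofinite, (companion a).map (ratEval t) = companionAt a t := by
  filter_upwards [eventually_all.2 fun i => eventually_ratEval_neg (a i)] with t ht
  ext i j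
  simp only [companion, companionAt, Matrix.map_apply, Matrix.of_apply]
  split_ifs
  · exact ht i
  · simp
  · simp

variable {K : Type*} [Field K]

/-- The recurrence holds for `y` at the index `n`. -/
def RecurrenceAt (y : ℕ → K) (n : ℕ) : Prop :=
  y (n + r) + ∑ i : Fin r, ((RatFunc.atNat (a i) n : ℚ) : K) * y (n + i) = 0

/-- The sequence obtained by applying the operator with coefficients `b` to `y`. -/
def applyOp (b : Fin r → RatFunc ℚ) (y : ℕ → K) (n : ℕ) : K :=
  ∑ i : Fin r, ((RatFunc.atNat (b i) n : ℚ) : K) * y (n + i)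

variable {a}

/-- Right multiplication by the companion matrix moves the row `(y(n), …, y(n+r-1))` by one step:
the ones shift the entries, and the last column applies the recurrence. -/
lemma RecurrenceAt.window {y : ℕ → K} {n : ℕ} (h : RecurrenceAt a y n) (j : Fin r) :
    ∑ i : Fin r, y (n + i) * ((companionAt a n i j : ℚ) : K) = y (n + 1 + j) := by
  simp only [companionAt, Matrix.of_apply]
  by_cases hj : j = CMF.lastIdx r
  · have hr : (j : ℕ) = r - 1 := by rw [hj]; rfl
    have hr' := NeZero.pos r
    simp only [hj, if_true]
    rw [show n + 1 + ((CMF.lastIdx r : Fin r) : ℕ) = n + r by rw [← hj, hr]; omega,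
      eq_neg_of_add_eq_zero_left h, ← Finset.sum_neg_distrib]
    refine Finset.sum_congr rfl fun i _ => ?_
    rw [← atNat_eq_ratEval]
    push_cast
    ring
  · have hj' : (j : ℕ) + 1 < r := by
      have h1 := j.2
      have h2 : (j : ℕ) ≠ r - 1 := fun h => hj (Fin.ext h)
      omega
    simp only [hj, if_false]
    rw [Finset.sum_eq_single ⟨j + 1, hj'⟩]
    · simp only [if_true, Rat.cast_one, mul_one]
      congr 1
      ring
    · intro i _ hi
      rw [if_neg fun h => hi (Fin.ext h)]
      simp
    · simp

variable [CharZero K]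

variable (a) in
/-- The coefficients of the composition of the operator `b` with the shift, reduced to order
less than `r` by means of the recurrence. -/
def stepOp (b : Fin r → RatFunc ℚ) : Fin r → RatFunc ℚ :=
  fun i => ∑ j, companion a i j * ratShift 1 (b j)

variable (a K) in
lemma eventually_applyOp_stepOp (b : Fin r → RatFunc ℚ) :
    ∀ᶠ n in atTop, ∀ y : ℕ → K, RecurrenceAt a y n →
      applyOp (stepOp a b) y n = applyOp b y (n + 1) := by
  have h1 : ∀ i, ∀ᶠ t in cofinite, ratEval t (stepOp a b i) =
      ∑ j, ratEval t (companion a i j) * ratEval t (ratShift 1 (b j)) := fun i =>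
    eventually_ratEval_sum_mul _ _
  have h2 := eventually_all.2 fun j => eventually_ratEval_ratShift 1 (b j)
  filter_upwards [tendsto_natCast_cofinite.eventually (eventually_all.2 h1),
    tendsto_natCast_cofinite.eventually h2,
    tendsto_natCast_cofinite.eventually (eventually_companion_map a)] with n h1 h2 h3 y hy
  have h4 : ∀ i, ((RatFunc.atNat (stepOp a b i) n : ℚ) : K) =
      ∑ j, ((companionAt a n i j : ℚ) : K) * ((RatFunc.atNat (b j) (n + 1) : ℚ) : K) := by
    intro i
    rw [atNat_eq_ratEval, h1 i, Rat.cast_sum]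
    refine Finset.sum_congr rfl fun j _ => ?_
    rw [h2 j, ← h3, Matrix.map_apply, Rat.cast_mul, atNat_eq_ratEval, Nat.cast_add, Nat.cast_one]
  simp only [applyOp, h4, Finset.sum_mul]
  rw [Finset.sum_comm]
  refine Finset.sum_congr rfl fun j _ => ?_
  rw [← hy.window j, Finset.mul_sum]
  exact Finset.sum_congr rfl fun i _ => by ring

variable (a K) in
lemma eventually_applyOp_iterate (b : Fin r → RatFunc ℚ) (j : ℕ) :
    ∀ᶠ n in atTop, ∀ y : ℕ → K, (∀ m, n ≤ m → RecurrenceAt a y m) →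
      applyOp ((stepOp a)^[j] b) y n = applyOp b y (n + j) := by
  induction j with
  | zero => simp
  | succ j ih =>
    filter_upwards [eventually_applyOp_stepOp a K ((stepOp a)^[j] b),
      (tendsto_add_atTop_nat 1).eventually ih] with n h1 h2 y hy
    rw [Function.iterate_succ_apply', h1 y (hy n le_rfl), h2 y fun m hm => hy m (by omega),
      add_assoc, add_comm 1 j]

variable (a) in
/-- The matrix of the operators `b, S b, …, S^(r-1) b` reduced by the recurrence. -/
def opMatrix (b : Fin r → RatFunc ℚ) : Matrix (Fin r) (Fin r) (RatFunc ℚ) :=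
  Matrix.of fun j => (stepOp a)^[j] b

variable (a K) in
-- A row vector times `opMatrix` is the composition of the operator `v` with `b`, reduced modulo the
-- recurrence. Linear algebra over `ℚ(n)` thereby becomes arithmetic of operators.
lemma eventually_sum_mul_applyOp (b v : Fin r → RatFunc ℚ) :
    ∀ᶠ n in atTop, ∀ y : ℕ → K, (∀ m, n ≤ m → RecurrenceAt a y m) →
      ∑ j : Fin r, ((RatFunc.atNat (v j) n : ℚ) : K) * applyOp b y (n + j) =
      applyOp (Matrix.vecMul v (opMatrix a b)) y n := by
  have h1 : ∀ i, ∀ᶠ t in cofinite, ratEval t (Matrix.vecMul v (opMatrix a b) i) =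
      ∑ j, ratEval t (v j) * ratEval t (opMatrix a b j i) := fun i =>
    eventually_ratEval_sum_mul v fun j => opMatrix a b j i
  filter_upwards [tendsto_natCast_cofinite.eventually (eventually_all.2 h1),
    eventually_all.2 fun j : Fin r => eventually_applyOp_iterate a K b j] with n h2 h3 y hy
  rw [Finset.sum_congr rfl fun j _ => congrArg _ (h3 j y hy).symm]
  simp only [applyOp, Finset.mul_sum]
  rw [Finset.sum_comm]
  refine Finset.sum_congr rfl fun i _ => ?_
  rw [atNat_eq_ratEval, h2 i, Rat.cast_sum, Finset.sum_mul]
  refine Finset.sum_congr rfl fun j _ => ?_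
  rw [Rat.cast_mul, mul_assoc]
  rfl

/-- The solution of a linear recurrence with prescribed initial values. -/
def recExtend {K : Type*} [Field K] {r : ℕ} (c : ℕ → Fin r → K) (Y : ℕ → K) (n : ℕ) : K :=
  if n < r then Y n else -∑ i : Fin r, c (n - r) i * recExtend c Y (n - r + i)
termination_by n
decreasing_by have := i.2; omega

lemma exists_solution_from {K : Type*} [Field K] {r : ℕ} {a : Fin r → RatFunc ℚ} (N : ℕ)
    (Y : Fin r → K) : ∃ y : ℕ → K, (∀ m, N ≤ m → RecurrenceAt a y m) ∧ ∀ i : Fin r, y (N + i) = Y i := by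
  set z := recExtend (fun m i => ((RatFunc.atNat (a i) (N + m) : ℚ) : K))
    (fun n => if h : n < r then Y ⟨n, h⟩ else 0) with hz
  -- Truncated subtraction assigns `z 0` to all indices below `N`; only the indices from `N` on
  -- matter.
  refine ⟨fun n => z (n - N), fun m hm => ?_, fun i => ?_⟩
  · obtain ⟨k, rfl⟩ := Nat.exists_eq_add_of_le hm
    rw [RecurrenceAt, show N + k + r - N = k + r by omega, hz, recExtend]
    rw [if_neg (by omega), show k + r - r = k by omega, neg_add_eq_zero]
    refine Finset.sum_congr rfl fun i _ => ?_
    rw [show N + k + (i : ℕ) - N = k + i by omega]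
  · simp only [add_tsub_cancel_left]
    rw [hz, recExtend, if_pos i.2, dif_pos i.2]

/-- A nonvanishing trailing coefficient allows the recurrence to be run backwards. -/
lemma eq_zero_of_eventually_eq_zero {y : ℕ → ℝ} {N : ℕ} (hy : ∀ m, N ≤ m → RecurrenceAt a y m)
    (ha : ∀ n, N ≤ n → RatFunc.atNat (a 0) n ≠ 0) (h : ∀ᶠ n in atTop, y n = 0) :
    ∀ n, N ≤ n → y n = 0 := by
  obtain ⟨M, hM⟩ := eventually_atTop.1 h
  suffices H : ∀ d n, N ≤ n → M ≤ n + d → y n = 0 from fun n hn => H M n hn (by omega)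
  intro d
  induction d with
  | zero => exact fun n _ h => hM n h
  | succ d ih =>
    intro n hn hd
    have h1 := hy n hn
    have hr := NeZero.pos r
    rw [RecurrenceAt, ih (n + r) (by omega) (by omega), zero_add, Finset.sum_eq_single 0] at h1
    · refine (mul_eq_zero.1 h1).resolve_left ?_
      exact_mod_cast ha n hn
    · intro i _ hi
      have : (i : ℕ) ≠ 0 := fun h => hi (Fin.ext h)
      rw [ih (n + i) (by omega) (by omega), mul_zero]
    · simp

open Classical in
-- A left kernel vector would give a recurrence of some order `k < r` for `By`, valid for every
-- solution `y`. A nonzero `y` for which the first `k` values of `By` vanish then has `By = 0`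
-- throughout, against irreducibility.
lemma det_opMatrix_ne_zero (hirr : IsIrreducibleRecurrence a) (ha : a 0 ≠ 0)
    {b : Fin r → RatFunc ℚ} (hb : b ≠ 0) : (opMatrix a b).det ≠ 0 := by
  intro hdet
  obtain ⟨v, hv0, hv⟩ := Matrix.exists_vecMul_eq_zero_iff.2 hdet
  obtain ⟨k, hk, hmax⟩ : ∃ k, v k ≠ 0 ∧ ∀ j, k < j → v j = 0 := by
    obtain ⟨i, hi⟩ := Function.ne_iff.1 hv0
    obtain ⟨k, hk, hmax⟩ := Finset.exists_max_image (Finset.univ.filter fun i => v i ≠ 0) id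
      ⟨i, by simpa using hi⟩
    refine ⟨k, by simpa using hk, fun j hj => ?_⟩
    by_contra h
    exact absurd (hmax j (by simpa using h)) (not_le.2 hj)
  obtain ⟨N, hN⟩ := eventually_atTop.1 ((((eventually_sum_mul_applyOp a ℝ b v).and
    (tendsto_natCast_cofinite.eventually (eventually_ratEval_ne_zero hk))).and
    (tendsto_natCast_cofinite.eventually (eventually_ratEval_ne_zero ha))).and
    (eventually_all.2 fun j : Fin r => eventually_applyOp_iterate a ℝ b j))
  -- These are `k < r` homogeneous conditions on `r` initial values. Padded with zero rows they form
  -- a singular square matrix.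
  obtain ⟨Y, hY0, hY⟩ : ∃ Y : Fin r → ℝ, Y ≠ 0 ∧ ∀ j, j < k →
      ∑ i, ((RatFunc.atNat ((stepOp a)^[j] b i) N : ℚ) : ℝ) * Y i = 0 := by
    obtain ⟨Y, hY0, hY⟩ := Matrix.exists_mulVec_eq_zero_iff.2
      (Matrix.det_eq_zero_of_row_eq_zero (A := Matrix.of fun j i : Fin r =>
        if j < k then ((RatFunc.atNat ((stepOp a)^[j] b i) N : ℚ) : ℝ) else 0) k (by simp))
    refine ⟨Y, hY0, fun j hj => ?_⟩
    have := congrFun hY j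
    simpa [Matrix.mulVec, dotProduct, hj] using this
  obtain ⟨y, hy, hyY⟩ := exists_solution_from (a := a) N Y
  have hQ : ∀ m, applyOp b y (N + m) = 0 := by
    intro m
    induction m using Nat.strong_induction_on with
    | _ m ih =>
      by_cases hm : m < k
      · have h1 := (hN N le_rfl).2 ⟨m, hm.trans k.2⟩ y hy
        rw [← h1, applyOp, ← hY ⟨m, hm.trans k.2⟩ hm]
        simp only [hyY]
      · have h1 := (hN (N + (m - k)) (by omega)).1.1.1 y fun m' hm' => hy m' (by omega)
        rw [hv, Finset.sum_eq_single k] at h1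
        · have h2 : applyOp (0 : Fin r → RatFunc ℚ) y (N + (m - k)) = 0 := by simp [applyOp, atNat_eq_ratEval]
          rw [show N + (m - k) + k = N + m by omega, h2] at h1
          refine (mul_eq_zero.1 h1).resolve_left ?_
          exact_mod_cast (hN (N + (m - k)) (by omega)).1.1.2
        · intro j _ hj
          rcases lt_or_gt_of_ne hj with h2 | h2
          · have h3 : (j : ℕ) < k := h2
            rw [add_assoc, ih _ (by omega), mul_zero]
          · rw [hmax j h2, atNat_eq_ratEval, ratEval_zero, Rat.cast_zero, zero_mul]
        · simp
  refine hb (hirr y (eventually_atTop.2 ⟨N, hy⟩) (fun h => hY0 ?_) b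
    (eventually_atTop.2 ⟨N, fun n hn => ?_⟩))
  · funext i
    rw [← hyY i]
    exact eq_zero_of_eventually_eq_zero hy (fun n hn => (hN n hn).1.2) h _ (by omega)
  · obtain ⟨m, rfl⟩ := Nat.exists_eq_add_of_le hn
    exact hQ m

variable (K) in
-- The first row of the inverse matrix is an operator whose composition with `b` is the identity
-- modulo the recurrence.
lemma exists_inverse_op (hirr : IsIrreducibleRecurrence a) (ha : a 0 ≠ 0)
    {b : Fin r → RatFunc ℚ} (hb : b ≠ 0) :
    ∃ v : Fin r → RatFunc ℚ, ∀ᶠ n in atTop, ∀ y : ℕ → K, (∀ m, n ≤ m → RecurrenceAt a y m) →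
      ∑ j : Fin r, ((RatFunc.atNat (v j) n : ℚ) : K) * applyOp b y (n + j) = y n := by
  have hdet : IsUnit (opMatrix a b).det := (det_opMatrix_ne_zero hirr ha hb).isUnit
  refine ⟨Matrix.vecMul (Pi.single 0 1) (opMatrix a b)⁻¹, ?_⟩
  filter_upwards [eventually_sum_mul_applyOp a K b
    (Matrix.vecMul (Pi.single 0 1) (opMatrix a b)⁻¹)] with n hn y hy
  rw [hn y hy, Matrix.vecMul_vecMul, Matrix.nonsing_inv_mul _ hdet, Matrix.vecMul_one, applyOp,
    Finset.sum_eq_single 0]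
  · simp [atNat_eq_ratEval]
  · intro i _ hi
    rw [Pi.single_eq_of_ne hi, atNat_eq_ratEval, ratEval_zero, Rat.cast_zero, zero_mul]
  · simp

/-- If `a 0 = 0`, the recurrence shifted back by one index has order `r - 1` and is still monic, so
the given nontrivial solution would satisfy a nonzero recurrence of smaller order. -/
lemma trailing_coeff_ne_zero (hirr : IsIrreducibleRecurrence a) {y : ℕ → ℝ}
    (hy : ∀ᶠ n in atTop, RecurrenceAt a y n) (h0 : ¬ ∀ᶠ n in atTop, y n = 0) : a 0 ≠ 0 := by
  intro ha
  obtain ⟨s, rfl⟩ : ∃ s, r = s + 1 := Nat.exists_eq_succ_of_ne_zero (NeZero.ne r)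
  set b : Fin (s + 1) → RatFunc ℚ := Fin.snoc (fun i : Fin s => ratShift (-1) (a i.succ)) 1 with hb
  have h1 : ∀ᶠ n in atTop, ∀ i : Fin s,
      RatFunc.atNat (ratShift (-1) (a i.succ)) (n + 1) = RatFunc.atNat (a i.succ) n := by
    have h2 := tendsto_natCast_cofinite.eventually
      (eventually_all.2 fun i : Fin s => eventually_ratEval_ratShift (-1) (a i.succ))
    filter_upwards [(tendsto_add_atTop_nat 1).eventually h2] with n hn i
    rw [atNat_eq_ratEval, hn i, atNat_eq_ratEval]
    congr 1
    push_cast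
    ring
  have h2 := hirr y hy h0 b ?_
  · have := congrFun h2 (Fin.last s)
    rw [hb, Fin.snoc_last] at this
    exact one_ne_zero this
  · obtain ⟨N, hN⟩ := eventually_atTop.1 (hy.and h1)
    refine eventually_atTop.2 ⟨N + 1, fun n hn => ?_⟩
    obtain ⟨m, rfl⟩ := Nat.exists_eq_add_of_le' (show 1 ≤ n by omega)
    obtain ⟨h2, h3⟩ := hN m (by omega)
    rw [RecurrenceAt, Fin.sum_univ_succ, ha, atNat_eq_ratEval, ratEval_zero, Rat.cast_zero,
      zero_mul, zero_add] at h2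
    rw [Fin.sum_univ_castSucc, ← h2, add_comm]
    simp only [hb, Fin.snoc_castSucc, Fin.snoc_last, h3, Fin.val_last, Fin.val_castSucc,
      Fin.val_succ]
    rw [atNat_eq_ratEval, ratEval_one, Rat.cast_one, one_mul]
    congr 1
    · congr 1
      ring
    · refine Finset.sum_congr rfl fun i _ => ?_
      congr 2
      ring

end Companion

/-! ### Convergence rates -/

lemma log_div_eq {x : ℝ} (hx : x ≠ 0) (n : ℕ) :
    ENNReal.log (ENNReal.ofReal |x|) / (n : EReal) = ((Real.log |x| / n : ℝ) : EReal) := by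
  rw [ENNReal.log_ofReal_of_pos (abs_pos.2 hx), EReal.coe_div, EReal.coe_natCast]

/-- `log |e n|` is a telescoping sum of logarithms of successive quotients, so its average is a
Cesàro mean. -/
lemma tendsto_log_div_of_ratio {e : ℕ → ℝ} {μ : ℝ} (h0 : ∀ᶠ n in atTop, e n ≠ 0)
    (h : Tendsto (fun n => |e (n + 1)| / |e n|) atTop (𝓝 μ)) :
    Tendsto (fun n : ℕ => ENNReal.log (ENNReal.ofReal |e n|) / (n : EReal)) atTop
      (𝓝 (ENNReal.log (ENNReal.ofReal μ))) := by
  have hsum : ∀ n : ℕ, ∑ i ∈ Finset.range n, (Real.log |e (i + 1)| - Real.log |e i|) =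
      Real.log |e n| - Real.log |e 0| := fun n =>
    Finset.sum_range_sub (fun i => Real.log |e i|) n
  have hlog : ∀ᶠ n in atTop, Real.log (|e (n + 1)| / |e n|) =
      Real.log |e (n + 1)| - Real.log |e n| := by
    filter_upwards [h0, (tendsto_add_atTop_nat 1).eventually h0] with n h1 h2
    exact Real.log_div (abs_ne_zero.2 h2) (abs_ne_zero.2 h1)
  have hc : Tendsto (fun n : ℕ => (n : ℝ)⁻¹ * Real.log |e 0|) atTop (𝓝 0) := by
    simpa using tendsto_inv_atTop_nhds_zero_nat (𝕜 := ℝ) |>.mul_const (Real.log |e 0|)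
  have hμ : 0 ≤ μ := ge_of_tendsto' h fun n => by positivity
  rcases hμ.eq_or_lt with rfl | hμ
  · rw [ENNReal.ofReal_zero, ENNReal.log_zero, EReal.tendsto_nhds_bot_iff_real]
    intro M
    have h1 : ∀ᶠ n in atTop, Real.log |e (n + 1)| - Real.log |e n| ≤ M - 1 := by
      filter_upwards [hlog, h.eventually (gt_mem_nhds (Real.exp_pos (M - 1))), h0,
        (tendsto_add_atTop_nat 1).eventually h0] with n h2 h3 h4 h5
      rw [← h2]
      exact (Real.log_le_iff_le_exp (div_pos (abs_pos.2 h5) (abs_pos.2 h4))).2 h3.le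
    -- For `μ = 0` the logarithms tend to `-∞`. Cutting them off below at `M - 1` gives a convergent
    -- sequence that still bounds them from above.
    have h2 : Tendsto (fun n => max (Real.log |e (n + 1)| - Real.log |e n|) (M - 1)) atTop
        (𝓝 (M - 1)) :=
      tendsto_const_nhds.congr' (by
        filter_upwards [h1] with n hn
        rw [max_eq_right hn])
    have h3 := h2.cesaro.add hc
    rw [add_zero] at h3
    filter_upwards [h3.eventually (gt_mem_nhds (sub_one_lt M)), h0, eventually_gt_atTop 0]
      with n h4 h5 h6
    rw [log_div_eq h5, EReal.coe_lt_coe_iff]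
    refine lt_of_le_of_lt ?_ h4
    have h7 : Real.log |e n| - Real.log |e 0| ≤
        ∑ i ∈ Finset.range n, max (Real.log |e (i + 1)| - Real.log |e i|) (M - 1) := by
      rw [← hsum]
      exact Finset.sum_le_sum fun i _ => le_max_left _ _
    rw [← mul_add, div_eq_inv_mul]
    gcongr
    linarith
  · rw [ENNReal.log_ofReal_of_pos hμ]
    have h1 : Tendsto (fun n => Real.log |e (n + 1)| - Real.log |e n|) atTop (𝓝 (Real.log μ)) :=
      (h.log hμ.ne').congr' hlog
    have h2 := h1.cesaro.add hc
    rw [add_zero] at h2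
    refine ((continuous_coe_real_ereal.tendsto _).comp h2).congr' ?_
    filter_upwards [h0] with n hn
    rw [log_div_eq hn, Function.comp_apply, hsum]
    congr 1
    ring

lemma tendsto_log_div_of_eventually_zero {e : ℕ → ℝ} (h0 : ∀ᶠ n in atTop, e n = 0) :
    Tendsto (fun n : ℕ => ENNReal.log (ENNReal.ofReal |e n|) / (n : EReal)) atTop (𝓝 ⊥) := by
  refine tendsto_const_nhds.congr' ?_
  filter_upwards [h0, eventually_gt_atTop 0] with n h1 h2
  rw [h1, abs_zero, ENNReal.ofReal_zero, ENNReal.log_zero, EReal.bot_div_of_pos_ne_top]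
  · exact_mod_cast h2
  · exact EReal.natCast_ne_top n

lemma tendsto_zero_of_ratio {z : ℕ → ℂ} {μ : ℂ} (h0 : ∀ᶠ n in atTop, z n ≠ 0) (hμ : ‖μ‖ < 1)
    (h : Tendsto (fun n => z (n + 1) / z n) atTop (𝓝 μ)) : Tendsto z atTop (𝓝 0) := by
  refine (summable_of_ratio_test_tendsto_lt_one hμ h0 ?_).tendsto_atTop_zero
  exact h.norm.congr fun n => norm_div _ _

/-- The quotient is inverted because its limit may be `0`, when the smallest characteristic root
vanishes; `z (n+1) / z n` would then have no finite limit. The reciprocal sequence tends to zero,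
hence `z` does not. -/
lemma not_tendsto_zero_of_ratio {z : ℕ → ℂ} {μ : ℂ} (h0 : ∀ᶠ n in atTop, z n ≠ 0) (hμ : ‖μ‖ < 1)
    (h : Tendsto (fun n => z n / z (n + 1)) atTop (𝓝 μ)) : ¬ Tendsto z atTop (𝓝 0) := by
  intro hz
  have h1 : Tendsto (fun n => (z n)⁻¹) atTop (𝓝 0) :=
    tendsto_zero_of_ratio (h0.mono fun n hn => inv_ne_zero hn) hμ
      (h.congr fun n => by rw [inv_div_inv])
  have h2 := hz.mul h1
  rw [mul_zero] at h2
  have h3 : Tendsto (fun n => z n * (z n)⁻¹) atTop (𝓝 1) :=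
    tendsto_const_nhds.congr' (h0.mono fun n hn => (mul_inv_cancel₀ hn).symm)
  exact zero_ne_one (tendsto_nhds_unique h2 h3)

/-! ### Operators applied to solutions -/

lemma exists_perronRecurrence_of_roots {r : ℕ} {a : Fin r → RatFunc ℚ} {α : Fin r → ℝ}
    {l : Fin r → ℂ}
    (h1 : ∀ i, Tendsto (fun n : ℕ => (((a i).atNat n : ℚ) : ℝ)) atTop (𝓝 (α i)))
    (h2 : Polynomial.X ^ r + ∑ i : Fin r, Polynomial.C (α i : ℂ) * Polynomial.X ^ (i : ℕ) =
      ∏ i : Fin r, (Polynomial.X - Polynomial.C (l i)))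
    (h3 : StrictAnti fun i => ‖l i‖) :
    ∃ R : PerronRecurrence r, R.coeff = (fun i => ratSeq (a i)) ∧ R.root = l := by
  have h4 : ∀ i, Tendsto (ratSeq (a i)) atTop (𝓝 (α i : ℂ)) := fun i =>
    ((Complex.continuous_ofReal.tendsto _).comp (h1 i)).congr fun n => by simp [ratSeq]
  exact ⟨⟨fun i => ratSeq (a i), fun i => α i, l, fun i => ratSeq_mem_expandable (h4 i),
    fun i => sub_limit_mem_decay (ratSeq_mem_expandable (h4 i)) (h4 i), h2, h3⟩, rfl, rfl⟩

lemma exists_perronRecurrence {r : ℕ} {a : Fin r → RatFunc ℚ} (h : IsPoincarePerron a) :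
    ∃ R : PerronRecurrence r, R.coeff = fun i => ratSeq (a i) := by
  obtain ⟨α, l, h1, h2, h3⟩ := h
  obtain ⟨R, hR, _⟩ := exists_perronRecurrence_of_roots h1 h2 h3
  exact ⟨R, hR⟩

/-- The operator with coefficients `b`, applied to a solution with quotients `ρ` and divided by
that solution. -/
def opQuot {r : ℕ} (b : Fin r → RatFunc ℚ) (ρ : ℕ → ℂ) : ℕ → ℂ :=
  ∑ i : Fin r, ratSeq (b i) * shiftProd ρ i

lemma applyOp_eq_opQuot {r : ℕ} (b : Fin r → RatFunc ℚ) {y : ℕ → ℂ}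
    (h0 : ∀ᶠ n in atTop, y n ≠ 0) :
    ∀ᶠ n in atTop, applyOp b y n = opQuot b (fun m => y (m + 1) / y m) n * y n := by
  filter_upwards [shiftProd_ratio_mul h0] with n hn
  rw [opQuot, Finset.sum_apply, Finset.sum_mul, applyOp]
  refine Finset.sum_congr rfl fun i _ => ?_
  rw [Pi.mul_apply, mul_assoc, hn, ratSeq]

lemma exists_ratSeq_family_mul_mem_expandable {r : ℕ} (b : Fin r → RatFunc ℚ) :
    ∃ K, ∀ i, ratSeq (b i) * invSucc ^ K ∈ Expandable := by
  choose K hK using fun i => exists_ratSeq_mul_mem_expandable (b i)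
  refine ⟨∑ i, K i, fun i => ?_⟩
  have h1 : K i ≤ ∑ i, K i := Finset.single_le_sum (fun j _ => Nat.zero_le _) (Finset.mem_univ i)
  obtain ⟨m, hm⟩ := Nat.exists_eq_add_of_le h1
  rw [hm, pow_add, ← mul_assoc]
  exact mul_mem (hK i) (pow_mem invSucc_mem_expandable m)

lemma opQuot_mul_eq {r : ℕ} (b : Fin r → RatFunc ℚ) (ρ : ℕ → ℂ) (K : ℕ) :
    opQuot b ρ * invSucc ^ K = ∑ i : Fin r, (ratSeq (b i) * invSucc ^ K) * shiftProd ρ i := by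
  rw [opQuot, Finset.sum_mul]
  exact Finset.sum_congr rfl fun i _ => by ring

lemma opQuot_sub_mem_decay {r : ℕ} {b : Fin r → RatFunc ℚ} {K : ℕ}
    (hK : ∀ i, ratSeq (b i) * invSucc ^ K ∈ Expandable) {ρ σ : ℕ → ℂ} {l : ℂ} {N : ℕ}
    (hρ : (ρ - fun _ => l) ∈ Decay 1) (hσ : (σ - fun _ => l) ∈ Decay 1) (h : ρ - σ ∈ Decay N) :
    opQuot b ρ * invSucc ^ K - opQuot b σ * invSucc ^ K ∈ Decay N := by
  rw [opQuot_mul_eq, opQuot_mul_eq, ← Finset.sum_sub_distrib]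
  refine Submodule.sum_mem _ fun i _ => ?_
  rw [← mul_sub]
  refine decay_zero_mul (decay_zero_of_expandable (hK i)) ?_
  have := Submodule.add_mem _ (decay_mono (Nat.le_succ N) (shiftProd_linearization hρ hσ h i))
    (aeval_seqShift_mem_decay h (linPoly l i))
  rwa [sub_add_cancel] at this

lemma decay_of_mul_invSucc_pow {f : ℕ → ℂ} {N : ℕ} (K : ℕ)
    (h : f * invSucc ^ K ∈ Decay (N + K)) : f ∈ Decay N := by
  induction K with
  | zero => simpa using h
  | succ K ih =>
    refine ih (decay_div_invSucc ?_)
    rwa [mul_assoc, ← pow_succ]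

section Core

variable {r : ℕ} {a : Fin r → RatFunc ℚ} {R : PerronRecurrence r}

lemma solves_of_recurrenceAt (hR : R.coeff = fun i => ratSeq (a i)) {y : ℕ → ℂ}
    (hy : ∀ᶠ n in atTop, RecurrenceAt a y n) : R.Solves y := by
  filter_upwards [hy] with n hn
  rw [hR]
  exact hn

variable [NeZero r]

/-- Were `By/y` smaller than every power of `1/n`, then applying the inverse operator, whose
coefficients grow at most polynomially, and dividing by `y` would show that the constant `1` tends
to zero. -/
lemma opQuot_not_decay (hirr : IsIrreducibleRecurrence a) (ha : a 0 ≠ 0)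
    {b : Fin r → RatFunc ℚ} (hb : b ≠ 0) {y : ℕ → ℂ} (hy : ∀ᶠ n in atTop, RecurrenceAt a y n)
    (h0 : ∀ᶠ n in atTop, y n ≠ 0) {l : ℂ} (hl : (fun n => y (n + 1) / y n - l) ∈ Decay 1)
    (K : ℕ) : ∃ N, opQuot b (fun n => y (n + 1) / y n) * invSucc ^ K ∉ Decay N := by
  by_contra! hall
  set ρ : ℕ → ℂ := fun n => y (n + 1) / y n with hρ
  have hdec : ∀ N, opQuot b ρ ∈ Decay N := fun N => decay_of_mul_invSucc_pow K (hall (N + K))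
  obtain ⟨v, hv⟩ := exists_inverse_op ℂ hirr ha hb
  obtain ⟨K', hK'⟩ := exists_ratSeq_family_mul_mem_expandable v
  have h1 : ∑ j : Fin r, (ratSeq (v j) * invSucc ^ K') *
      ((seqShift ^ (j : ℕ)) (opQuot b ρ) * shiftProd ρ j) ∈ Decay (1 + K') := by
    refine Submodule.sum_mem _ fun j _ => ?_
    refine decay_zero_mul (decay_zero_of_expandable (hK' j)) (decay_mul_zero
      (seqShift_pow_mem_decay (hdec (1 + K')) j) (shiftProd_mem_decay_zero (l := l) hl j))
  have h2 : (fun _ => (1 : ℂ)) * invSucc ^ K' ∈ Decay (1 + K') := by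
    refine decay_congr h1 ?_
    obtain ⟨N, hN⟩ := eventually_atTop.1 (((hy.and h0).and (applyOp_eq_opQuot b h0)).and
      (shiftProd_ratio_mul h0))
    filter_upwards [hv, eventually_ge_atTop N] with n h3 h4
    have h5 := h3 y fun m hm => (hN m (by omega)).1.1.1
    refine mul_right_cancel₀ (hN n h4).1.1.2 ?_
    rw [Pi.mul_apply, one_mul]
    conv_rhs => rw [← h5]
    rw [Finset.sum_apply, Finset.sum_mul, Finset.mul_sum]
    refine Finset.sum_congr rfl fun j _ => ?_
    rw [(hN (n + j) (by omega)).1.2, ← (hN n h4).2 j]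
    simp only [Pi.mul_apply, seqShift_pow_apply, Pi.pow_apply, ratSeq, hρ]
    ring
  have h3 := tendsto_zero_of_decay (decay_of_mul_invSucc_pow K' h2)
  exact one_ne_zero (tendsto_nhds_unique tendsto_const_nhds h3)

lemma exists_opQuot_leading (hR : R.coeff = fun i => ratSeq (a i))
    (hirr : IsIrreducibleRecurrence a) (ha : a 0 ≠ 0) {b : Fin r → RatFunc ℚ} (hb : b ≠ 0)
    {K : ℕ} (hK : ∀ i, ratSeq (b i) * invSucc ^ K ∈ Expandable)
    {y : ℕ → ℂ} (hy : ∀ᶠ n in atTop, RecurrenceAt a y n) (h0 : ∀ᶠ n in atTop, y n ≠ 0)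
    {i : Fin r} (hl : (fun n => y (n + 1) / y n - R.root i) ∈ Decay 1) :
    ∃ (k : ℕ) (g : ℕ → ℂ) (c : ℂ), opQuot b (fun n => y (n + 1) / y n) * invSucc ^ K =
      invSucc ^ k * g ∧ c ≠ 0 ∧ Tendsto g atTop (𝓝 c) := by
  obtain ⟨N, hN⟩ := opQuot_not_decay hirr ha hb hy h0 hl K
  refine exists_leading_term ?_ hN
  have hρ := PerronRecurrence.expandable_of_riccati (R := R) (i := i)
    (ρ := fun n => y (n + 1) / y n) hl ((solves_of_recurrenceAt hR hy).riccati_eq_zero h0)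
  rw [opQuot_mul_eq]
  exact sum_mem fun i _ => mul_mem (hK i) (shiftProd_mem_expandable hρ i)

/-- By its leading term `By/y` behaves like a nonzero constant times a power of `n`, and successive
values of such a sequence have quotient tending to `1`. -/
lemma opQuot_ratio (hR : R.coeff = fun i => ratSeq (a i)) (hirr : IsIrreducibleRecurrence a)
    (ha : a 0 ≠ 0) {b : Fin r → RatFunc ℚ} (hb : b ≠ 0)
    {y : ℕ → ℂ} (hy : ∀ᶠ n in atTop, RecurrenceAt a y n) (h0 : ∀ᶠ n in atTop, y n ≠ 0)
    {i : Fin r} (hl : (fun n => y (n + 1) / y n - R.root i) ∈ Decay 1) :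
    (∀ᶠ n in atTop, opQuot b (fun n => y (n + 1) / y n) n ≠ 0) ∧
    Tendsto (fun n => opQuot b (fun n => y (n + 1) / y n) (n + 1) /
      opQuot b (fun n => y (n + 1) / y n) n) atTop (𝓝 1) := by
  obtain ⟨K, hK⟩ := exists_ratSeq_family_mul_mem_expandable b
  obtain ⟨k, g, c, h1, hc, hg⟩ := exists_opQuot_leading hR hirr ha hb hK hy h0 hl
  set f := opQuot b (fun n => y (n + 1) / y n)
  have h2 : ∀ n, f n = invSucc n ^ k * g n * (invSucc n ^ K)⁻¹ := fun n => by
    have h3 := congrFun h1 n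
    simp only [Pi.mul_apply, Pi.pow_apply] at h3
    rw [← h3, mul_assoc, mul_inv_cancel₀ (pow_ne_zero _ (invSucc_ne_zero n)), mul_one]
  have hg0 := hg.eventually_ne hc
  refine ⟨?_, ?_⟩
  · filter_upwards [hg0] with n hn
    rw [h2]
    have := invSucc_ne_zero n
    positivity
  · have hq : Tendsto (fun n => invSucc (n + 1) / invSucc n) atTop (𝓝 1) := by
      have h3 := (tendsto_of_sub_decay one_add_invSucc_sub_mem_decay).inv₀ one_ne_zero
      rw [inv_one] at h3
      refine h3.congr fun n => ?_
      have h4 := congrFun seqShift_invSucc n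
      simp only [seqShift_apply, Pi.mul_apply, Pi.inv_apply] at h4
      rw [h4, mul_div_cancel_left₀ _ (invSucc_ne_zero n)]
    have h5 := ((hq.pow k).mul ((hg.comp (tendsto_add_atTop_nat 1)).div hg hc)).mul
      ((hq.pow K).inv₀ (by simp))
    simp only [one_pow, div_self hc, mul_one, inv_one] at h5
    refine h5.congr' ?_
    filter_upwards [hg0] with n hn
    have h6 := invSucc_ne_zero n
    have h7 := invSucc_ne_zero (n + 1)
    rw [h2, h2]
    simp only [Pi.div_apply, Function.comp_apply, div_pow]
    field_simp

lemma opQuot_ratio_of_same_root (hR : R.coeff = fun i => ratSeq (a i))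
    (hirr : IsIrreducibleRecurrence a) (ha : a 0 ≠ 0) {b : Fin r → RatFunc ℚ} (hb : b ≠ 0)
    {y z : ℕ → ℂ} (hy : ∀ᶠ n in atTop, RecurrenceAt a y n) (hy0 : ∀ᶠ n in atTop, y n ≠ 0)
    (hz : ∀ᶠ n in atTop, RecurrenceAt a z n) (hz0 : ∀ᶠ n in atTop, z n ≠ 0)
    {i : Fin r} (hyl : (fun n => y (n + 1) / y n - R.root i) ∈ Decay 1)
    (hzl : (fun n => z (n + 1) / z n - R.root i) ∈ Decay 1) :
    Tendsto (fun n => opQuot b (fun n => z (n + 1) / z n) n /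
      opQuot b (fun n => y (n + 1) / y n) n) atTop (𝓝 1) := by
  obtain ⟨K, hK⟩ := exists_ratSeq_family_mul_mem_expandable b
  obtain ⟨k, g, c, h1, hc, hg⟩ := exists_opQuot_leading hR hirr ha hb hK hy hy0 hyl
  have h2 := PerronRecurrence.sub_mem_decay_of_riccati (R := R) (i := i)
    (ρ := fun n => z (n + 1) / z n) (σ := fun n => y (n + 1) / y n) hzl hyl
    ((solves_of_recurrenceAt hR hz).riccati_eq_zero hz0)
    ((solves_of_recurrenceAt hR hy).riccati_eq_zero hy0)
  -- Agreement to order `1 + k` is one order beyond the leading term `(n+1)⁻ᵏ`, so the difference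
  -- disappears in the quotient.
  have h3 := opQuot_sub_mem_decay hK (l := R.root i) hzl hyl (h2 (1 + k))
  set f := opQuot b (fun n => y (n + 1) / y n)
  set f' := opQuot b (fun n => z (n + 1) / z n)
  set d : ℕ → ℂ := fun n => (f' * invSucc ^ K - f * invSucc ^ K) n * (invSucc n ^ k)⁻¹ with hd
  have h4 : d ∈ Decay 1 := by
    refine decay_of_mul_invSucc_pow k ?_
    convert h3 using 1
    funext n
    simp only [hd, Pi.mul_apply, Pi.pow_apply]
    rw [mul_assoc, inv_mul_cancel₀ (pow_ne_zero _ (invSucc_ne_zero n)), mul_one]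
  have h5 := ((tendsto_zero_of_decay h4).div hg hc).const_add 1
  rw [zero_div, add_zero] at h5
  refine h5.congr' ?_
  filter_upwards [hg.eventually_ne hc] with n hn
  have h6 := congrFun h1 n
  have h7 := invSucc_ne_zero n
  have hfn : f n ≠ 0 := by
    intro h
    rw [Pi.mul_apply, h, zero_mul] at h6
    exact mul_ne_zero (pow_ne_zero k h7) hn h6.symm
  simp only [Pi.mul_apply, Pi.pow_apply] at h6
  simp only [hd, Pi.div_apply, Pi.sub_apply, Pi.mul_apply, Pi.pow_apply]
  rw [mul_comm (f n)] at h6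
  have h8 : g n = invSucc n ^ K * f n * (invSucc n ^ k)⁻¹ := by
    rw [h6]
    field_simp
  rw [h8]
  field_simp
  ring

/-- Equality of the two limits does not suffice, as the common root may be zero. For `r > 1` the
comparison of operators is applied to the shift; for `r = 1` both quotients are `-a 0`. -/
lemma ratio_of_same_root (hR : R.coeff = fun i => ratSeq (a i)) (hirr : IsIrreducibleRecurrence a)
    (ha : a 0 ≠ 0) {y z : ℕ → ℂ} (hy : ∀ᶠ n in atTop, RecurrenceAt a y n)
    (hy0 : ∀ᶠ n in atTop, y n ≠ 0) (hz : ∀ᶠ n in atTop, RecurrenceAt a z n)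
    (hz0 : ∀ᶠ n in atTop, z n ≠ 0) {i : Fin r}
    (hyl : (fun n => y (n + 1) / y n - R.root i) ∈ Decay 1)
    (hzl : (fun n => z (n + 1) / z n - R.root i) ∈ Decay 1) :
    Tendsto (fun n => (z (n + 1) / z n) / (y (n + 1) / y n)) atTop (𝓝 1) := by
  by_cases hr : 1 < r
  · have hb : (Pi.single ⟨1, hr⟩ 1 : Fin r → RatFunc ℚ) ≠ 0 := by simp
    have h := opQuot_ratio_of_same_root hR hirr ha hb hy hy0 hz hz0 hyl hzl
    have h1 : ∀ ρ : ℕ → ℂ, opQuot (Pi.single ⟨1, hr⟩ 1 : Fin r → RatFunc ℚ) ρ = ρ := by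
      intro ρ
      rw [opQuot, Finset.sum_eq_single ⟨1, hr⟩]
      · funext n
        simp [ratSeq, atNat_eq_ratEval, shiftProd]
      · intro j _ hj
        funext n
        simp [Pi.single_eq_of_ne hj, ratSeq, atNat_eq_ratEval]
      · simp
    simpa only [h1] using h
  · obtain rfl : r = 1 := by have := NeZero.pos r; omega
    have key : ∀ y : ℕ → ℂ, (∀ᶠ n in atTop, RecurrenceAt a y n) → (∀ᶠ n in atTop, y n ≠ 0) →
        ∀ᶠ n in atTop, y (n + 1) / y n = -((RatFunc.atNat (a 0) n : ℚ) : ℂ) := by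
      intro y hy hy0
      filter_upwards [hy, hy0] with n h1 h2
      rw [RecurrenceAt, Fin.sum_univ_one] at h1
      rw [div_eq_iff h2, neg_mul]
      exact eq_neg_of_add_eq_zero_left h1
    refine tendsto_const_nhds.congr' ?_
    filter_upwards [key y hy hy0, key z hz hz0, hy0, (tendsto_add_atTop_nat 1).eventually hy0]
      with n h1 h2 h3 h4
    rw [h2, ← h1, div_self (div_ne_zero h4 h3)]

end Core

/-! ### Comparison of quotients of solutions -/

section Comparison

lemma tendsto_of_decay_sub {f : ℕ → ℂ} {c : ℂ} (h : (fun n => f n - c) ∈ Decay 1) :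
    Tendsto f atTop (𝓝 c) := tendsto_of_sub_decay h

variable {r : ℕ} {a : Fin r → RatFunc ℚ} {R : PerronRecurrence r}

lemma IsSolution.recurrenceAt {u : ℕ → ℚ} (hu : IsSolution a u) (n : ℕ) :
    RecurrenceAt a (fun n => (u n : ℝ)) n := by
  have := congrArg (Rat.cast (K := ℝ)) (hu n)
  simpa [RecurrenceAt] using this

lemma RecurrenceAt.ofReal {y : ℕ → ℝ} {n : ℕ} (h : RecurrenceAt a y n) :
    RecurrenceAt a (fun n => (y n : ℂ)) n := by
  have := congrArg Complex.ofReal h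
  simpa [RecurrenceAt] using this

lemma applyOp_ratCast_real (b : Fin r → RatFunc ℚ) (u : ℕ → ℚ) (n : ℕ) :
    applyOp b (fun n => (u n : ℝ)) n = ((applyOp b u n : ℚ) : ℝ) := by
  simp [applyOp]

lemma applyOp_ofReal (b : Fin r → RatFunc ℚ) (u : ℕ → ℝ) (n : ℕ) :
    applyOp b (fun n => (u n : ℂ)) n = ((applyOp b u n : ℝ) : ℂ) := by
  simp [applyOp]

lemma applyOp_sub_const_mul (b : Fin r → RatFunc ℚ) (u w : ℕ → ℝ) (l : ℝ) (n : ℕ) :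
    applyOp b (fun n => u n - l * w n) n = applyOp b u n - l * applyOp b w n := by
  simp only [applyOp, mul_sub, Finset.sum_sub_distrib, Finset.mul_sum]
  congr 1
  exact Finset.sum_congr rfl fun i _ => by ring

lemma RecurrenceAt.sub_const_mul {u w : ℕ → ℝ} {n : ℕ} (hu : RecurrenceAt a u n)
    (hw : RecurrenceAt a w n) (l : ℝ) : RecurrenceAt a (fun n => u n - l * w n) n := by
  have h := applyOp_sub_const_mul a u w l n
  simp only [RecurrenceAt, applyOp] at *
  rw [h]
  linear_combination hu - l * hw

lemma tendsto_iff_of_sub_eq {s : ℕ → ℝ} {l : ℝ} {z : ℕ → ℂ}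
    (h : ∀ᶠ n in atTop, ((s n - l : ℝ) : ℂ) = z n) :
    Tendsto s atTop (𝓝 l) ↔ Tendsto z atTop (𝓝 0) := by
  refine (tendsto_sub_nhds_zero_iff.symm.trans tendsto_zero_iff_norm_tendsto_zero).trans
    (Iff.trans (tendsto_congr' ?_) tendsto_zero_iff_norm_tendsto_zero.symm)
  filter_upwards [h] with n hn
  rw [← hn, Complex.norm_real]

lemma hasConvergenceRate_of_ratio {s : ℕ → ℚ} {l : ℝ} {z : ℕ → ℂ} {μ : ℂ}
    (h : ∀ᶠ n in atTop, (((s n : ℝ) - l : ℝ) : ℂ) = z n) (h0 : ∀ᶠ n in atTop, z n ≠ 0)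
    (hμ : Tendsto (fun n => z (n + 1) / z n) atTop (𝓝 μ)) :
    HasConvergenceRate s l (ENNReal.log (ENNReal.ofReal ‖μ‖)) := by
  refine tendsto_log_div_of_ratio (e := fun n => (s n : ℝ) - l) ?_ (hμ.norm.congr' ?_)
  · filter_upwards [h, h0] with n h1 h2 h3
    rw [h3] at h1
    exact h2 (by rw [← h1]; simp)
  · filter_upwards [h, (tendsto_add_atTop_nat 1).eventually h] with n h1 h2
    rw [← h1, ← h2, norm_div, Complex.norm_real, Complex.norm_real]
    rfl

variable [NeZero r]

/-- The error `By/Bw` is `y/w` times `(By/y)/(Bw/w)`, and successive values of the last factor have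
quotient tending to `1`. For different roots this decides convergence on both sides; for equal roots
the factor itself tends to `1`. -/
lemma quotient_comparison (hR : R.coeff = fun i => ratSeq (a i))
    (hirr : IsIrreducibleRecurrence a) (ha : a 0 ≠ 0) {b : Fin r → RatFunc ℚ} (hb : b ≠ 0)
    {y w : ℕ → ℂ} (hy : ∀ᶠ n in atTop, RecurrenceAt a y n) (hy0 : ∀ᶠ n in atTop, y n ≠ 0)
    (hw : ∀ᶠ n in atTop, RecurrenceAt a w n) (hw0 : ∀ᶠ n in atTop, w n ≠ 0) {i j : Fin r}
    (hyl : (fun n => y (n + 1) / y n - R.root i) ∈ Decay 1)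
    (hwl : (fun n => w (n + 1) / w n - R.root j) ∈ Decay 1) :
    (Tendsto (fun n => y n / w n) atTop (𝓝 0) ↔
      Tendsto (fun n => applyOp b y n / applyOp b w n) atTop (𝓝 0)) ∧
    (Tendsto (fun n => y n / w n) atTop (𝓝 0) → ∃ μ : ℂ,
      Tendsto (fun n => (y (n + 1) / w (n + 1)) / (y n / w n)) atTop (𝓝 μ) ∧
      Tendsto (fun n => (applyOp b y (n + 1) / applyOp b w (n + 1)) /
        (applyOp b y n / applyOp b w n)) atTop (𝓝 μ)) := by
  obtain ⟨hfy0, hfy⟩ := opQuot_ratio hR hirr ha hb hy hy0 hyl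
  obtain ⟨hfw0, hfw⟩ := opQuot_ratio hR hirr ha hb hw hw0 hwl
  have hey := applyOp_eq_opQuot b hy0
  have hew := applyOp_eq_opQuot b hw0
  set fy := opQuot b (fun n => y (n + 1) / y n)
  set fw := opQuot b (fun n => w (n + 1) / w n)
  set z : ℕ → ℂ := fun n => y n / w n with hz
  set e : ℕ → ℂ := fun n => applyOp b y n / applyOp b w n with he
  have hez : ∀ᶠ n in atTop, e n = z n * (fy n / fw n) := by
    filter_upwards [hey, hew] with n h1 h2
    simp only [he, hz, h1, h2]
    ring
  have hz0 : ∀ᶠ n in atTop, z n ≠ 0 := by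
    filter_upwards [hy0, hw0] with n h1 h2 using div_ne_zero h1 h2
  have he0 : ∀ᶠ n in atTop, e n ≠ 0 := by
    filter_upwards [hez, hz0, hfy0, hfw0] with n h1 h2 h3 h4
    rw [h1]
    exact mul_ne_zero h2 (div_ne_zero h3 h4)
  have hφ : Tendsto (fun n => (fy (n + 1) / fw (n + 1)) / (fy n / fw n)) atTop (𝓝 1) := by
    have := hfy.div hfw one_ne_zero
    rw [div_one] at this
    refine this.congr fun n => ?_
    simp only [Pi.div_apply]
    rw [div_div_div_comm]
  have hratio : ∀ {μ : ℂ}, Tendsto (fun n => z (n + 1) / z n) atTop (𝓝 μ) →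
      Tendsto (fun n => e (n + 1) / e n) atTop (𝓝 μ) := by
    intro μ h
    have h1 := h.mul hφ
    rw [mul_one] at h1
    refine h1.congr' ?_
    filter_upwards [hez, (tendsto_add_atTop_nat 1).eventually hez] with n h2 h3
    rw [h2, h3]
    ring
  have hratio' : ∀ {μ : ℂ}, Tendsto (fun n => z n / z (n + 1)) atTop (𝓝 μ) →
      Tendsto (fun n => e n / e (n + 1)) atTop (𝓝 μ) := by
    intro μ h
    have h1 := h.div hφ one_ne_zero
    rw [div_one] at h1
    refine h1.congr' ?_
    filter_upwards [hez, (tendsto_add_atTop_nat 1).eventually hez] with n h2 h3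
    simp only [Pi.div_apply]
    rw [h2, h3]
    field_simp
  have hρy := tendsto_of_decay_sub hyl
  have hρw := tendsto_of_decay_sub hwl
  rcases lt_trichotomy i j with hij | rfl | hij
  -- Here `y` outgrows `w`, so neither quotient tends to zero. Only `root i` is certain to be
  -- nonzero, hence the inverted quotient.
  · have hlt : ‖R.root j‖ < ‖R.root i‖ := R.strictAnti hij
    have hi : R.root i ≠ 0 := norm_pos_iff.1 ((norm_nonneg _).trans_lt hlt)
    have hμ : ‖R.root j / R.root i‖ < 1 := by
      rw [norm_div]
      exact (div_lt_one (norm_pos_iff.2 hi)).2 hlt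
    have h1 : Tendsto (fun n => z n / z (n + 1)) atTop (𝓝 (R.root j / R.root i)) := by
      refine (hρw.div hρy hi).congr fun n => ?_
      simp only [hz, Pi.div_apply]
      field_simp
    have h2 := not_tendsto_zero_of_ratio hz0 hμ h1
    have h3 := not_tendsto_zero_of_ratio he0 hμ (hratio' h1)
    exact ⟨⟨fun h => absurd h h2, fun h => absurd h h3⟩, fun h => absurd h h2⟩
  · have h1 : Tendsto (fun n => z (n + 1) / z n) atTop (𝓝 1) := by
      refine (ratio_of_same_root hR hirr ha hw hw0 hy hy0 hwl hyl).congr fun n => ?_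
      simp only [hz]
      rw [div_div_div_comm]
    have h2 : Tendsto (fun n => fy n / fw n) atTop (𝓝 1) :=
      opQuot_ratio_of_same_root hR hirr ha hb hw hw0 hy hy0 hwl hyl
    refine ⟨⟨fun h => ?_, fun h => ?_⟩, fun _ => ⟨1, h1, hratio h1⟩⟩
    · have h3 := h.mul h2
      rw [zero_mul] at h3
      exact h3.congr' (hez.mono fun n hn => hn.symm)
    · have h3 := h.div h2 one_ne_zero
      rw [zero_div] at h3
      refine h3.congr' ?_
      filter_upwards [hez, hfy0, hfw0] with n h4 h5 h6
      simp only [Pi.div_apply]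
      rw [h4]
      field_simp
  -- Here `w` outgrows `y`: both quotients tend to zero, with the common ratio limit `root i / root
  -- j`.
  · have hlt : ‖R.root i‖ < ‖R.root j‖ := R.strictAnti hij
    have hj : R.root j ≠ 0 := norm_pos_iff.1 ((norm_nonneg _).trans_lt hlt)
    have hμ : ‖R.root i / R.root j‖ < 1 := by
      rw [norm_div]
      exact (div_lt_one (norm_pos_iff.2 hj)).2 hlt
    have h1 : Tendsto (fun n => z (n + 1) / z n) atTop (𝓝 (R.root i / R.root j)) := by
      refine (hρy.div hρw hj).congr fun n => ?_
      simp only [hz, Pi.div_apply]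
      rw [div_div_div_comm]
    have h2 := tendsto_zero_of_ratio hz0 hμ h1
    have h3 := tendsto_zero_of_ratio he0 hμ (hratio h1)
    exact ⟨iff_of_true h2 h3, fun _ => ⟨_, h1, hratio h1⟩⟩

theorem operator_quotient_comparison (hPP : IsPoincarePerron a) (hirr : IsIrreducibleRecurrence a)
    {b : Fin r → RatFunc ℚ} (hb : b ≠ 0) {u w P Q : ℕ → ℚ} (hu : IsSolution a u)
    (hw : IsSolution a w) (hw0 : ¬ ∀ᶠ n in atTop, w n = 0)
    (hP : ∀ᶠ n in atTop, P n = applyOp b u n) (hQ : ∀ᶠ n in atTop, Q n = applyOp b w n) :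
    (∀ᶠ n in atTop, w n ≠ 0) ∧ (∀ᶠ n in atTop, Q n ≠ 0) ∧ ∀ l : ℝ,
      (Tendsto (fun n => ((P n / Q n : ℚ) : ℝ)) atTop (𝓝 l) ↔
        Tendsto (fun n => ((u n / w n : ℚ) : ℝ)) atTop (𝓝 l)) ∧
      (Tendsto (fun n => ((u n / w n : ℚ) : ℝ)) atTop (𝓝 l) →
        ∃ ρ : EReal, HasConvergenceRate (fun n => P n / Q n) l ρ ∧
          HasConvergenceRate (fun n => u n / w n) l ρ) := by
  obtain ⟨R, hR⟩ := exists_perronRecurrence hPP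
  set wr : ℕ → ℝ := fun n => (w n : ℝ) with hwr
  set ur : ℕ → ℝ := fun n => (u n : ℝ) with hur
  set wc : ℕ → ℂ := fun n => (wr n : ℂ) with hwc
  have hwc0 : ¬ ∀ᶠ n in atTop, wc n = 0 := fun h => hw0 (h.mono fun n hn => by
    simpa [hwc, hwr] using hn)
  have ha : a 0 ≠ 0 := trailing_coeff_ne_zero hirr
    (Eventually.of_forall hw.recurrenceAt) fun h => hw0 (h.mono fun n hn => by simpa using hn)
  have hwrec : ∀ᶠ n in atTop, RecurrenceAt a wc n :=
    Eventually.of_forall fun n => (hw.recurrenceAt n).ofReal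
  obtain ⟨j, hwne, hwl⟩ := (solves_of_recurrenceAt hR hwrec).exists_root hwc0
  have hfw := (opQuot_ratio hR hirr ha hb hwrec hwne hwl).1
  have hw1 : ∀ᶠ n in atTop, w n ≠ 0 := hwne.mono fun n hn h => hn (by simp [hwc, hwr, h])
  have hQc : ∀ n, applyOp b wc n = ((applyOp b w n : ℚ) : ℂ) := fun n => by
    rw [hwc, applyOp_ofReal, hwr, applyOp_ratCast_real]
    simp
  have hQ1 : ∀ᶠ n in atTop, Q n ≠ 0 := by
    filter_upwards [hQ, applyOp_eq_opQuot b hwne, hfw, hwne] with n h1 h2 h3 h4 h5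
    rw [h1] at h5
    rw [hQc, h5, Rat.cast_zero] at h2
    exact mul_ne_zero h3 h4 h2.symm
  refine ⟨hw1, hQ1, fun l => ?_⟩
  -- By linearity both errors are quotients built from this one solution, and convergence to `l`
  -- becomes convergence to zero.
  set yr : ℕ → ℝ := fun n => ur n - l * wr n with hyr
  set yc : ℕ → ℂ := fun n => (yr n : ℂ) with hyc
  have hs : ∀ᶠ n in atTop, ((((u n / w n : ℚ) : ℝ) - l : ℝ) : ℂ) = yc n / wc n := by
    filter_upwards [hw1] with n hn
    have : (w n : ℂ) ≠ 0 := by exact_mod_cast hn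
    simp only [hyc, hyr, hwc, hwr, hur]
    push_cast
    field_simp
  have hPQ : ∀ᶠ n in atTop, ((((P n / Q n : ℚ) : ℝ) - l : ℝ) : ℂ) =
      applyOp b yc n / applyOp b wc n := by
    filter_upwards [hQ1, hP, hQ] with n h1 h2 h3
    have h4 : applyOp b yc n = ((applyOp b u n : ℚ) : ℂ) - l * ((applyOp b w n : ℚ) : ℂ) := by
      rw [hyc, applyOp_ofReal, hyr, applyOp_sub_const_mul, hur, hwr, applyOp_ratCast_real,
        applyOp_ratCast_real]
      push_cast
      rfl
    rw [h4, hQc, ← h2, ← h3]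
    have : (Q n : ℂ) ≠ 0 := by exact_mod_cast h1
    push_cast
    field_simp
  by_cases hy0 : ∀ᶠ n in atTop, yc n = 0
  · have h1 : ∀ᶠ n in atTop, yc n / wc n = 0 := hy0.mono fun n hn => by rw [hn, zero_div]
    have h2 : ∀ᶠ n in atTop, applyOp b yc n / applyOp b wc n = 0 := by
      obtain ⟨N, hN⟩ := eventually_atTop.1 hy0
      refine eventually_atTop.2 ⟨N, fun n hn => ?_⟩
      rw [applyOp, Finset.sum_eq_zero, zero_div]
      intro i _
      rw [hN (n + i) (by omega), mul_zero]
    refine ⟨?_, fun _ => ⟨⊥, ?_, ?_⟩⟩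
    · rw [tendsto_iff_of_sub_eq hs, tendsto_iff_of_sub_eq hPQ]
      exact iff_of_true (tendsto_const_nhds.congr' (h2.mono fun n hn => hn.symm))
        (tendsto_const_nhds.congr' (h1.mono fun n hn => hn.symm))
    · refine tendsto_log_div_of_eventually_zero ?_
      filter_upwards [hPQ, h2] with n h3 h4
      rw [h4] at h3
      exact_mod_cast h3
    · refine tendsto_log_div_of_eventually_zero ?_
      filter_upwards [hs, h1] with n h3 h4
      rw [h4] at h3
      exact_mod_cast h3
  · have hyrec : ∀ᶠ n in atTop, RecurrenceAt a yc n := Eventually.of_forall fun n =>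
      ((hu.recurrenceAt n).sub_const_mul (hw.recurrenceAt n) l).ofReal
    obtain ⟨i, hyne, hyl⟩ := (solves_of_recurrenceAt hR hyrec).exists_root hy0
    have hfy := (opQuot_ratio hR hirr ha hb hyrec hyne hyl).1
    obtain ⟨h1, h2⟩ := quotient_comparison hR hirr ha hb hyrec hyne hwrec hwne hyl hwl
    refine ⟨?_, fun h => ?_⟩
    · rw [tendsto_iff_of_sub_eq hs, tendsto_iff_of_sub_eq hPQ, h1]
    · rw [tendsto_iff_of_sub_eq hs] at h
      obtain ⟨μ, h3, h4⟩ := h2 h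
      refine ⟨_, hasConvergenceRate_of_ratio hPQ ?_ h4, hasConvergenceRate_of_ratio hs ?_ h3⟩
      · filter_upwards [applyOp_eq_opQuot b hyne, applyOp_eq_opQuot b hwne, hfy, hfw, hyne, hwne]
          with n h5 h6 h7 h8 h9 h10
        rw [h5, h6]
        exact div_ne_zero (mul_ne_zero h7 h9) (mul_ne_zero h8 h10)
      · filter_upwards [hyne, hwne] with n h5 h6 using div_ne_zero h5 h6

end Comparison

/-! ### Values of rational functions in several variables -/

namespace MvRat

variable {K : Type} [Field K] {d : ℕ}

lemma mul_den (f : MvRat K d) :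
    f * algebraMap (MvPolynomial (Fin d) K) (MvRat K d) f.den =
      algebraMap (MvPolynomial (Fin d) K) (MvRat K d) f.num := by
  have h := IsFractionRing.mk'_num_den' (MvPolynomial (Fin d) K) f
  have h0 : algebraMap (MvPolynomial (Fin d) K) (MvRat K d) f.den ≠ 0 :=
    IsFractionRing.to_map_ne_zero_of_mem_nonZeroDivisors
      (IsFractionRing.den (MvPolynomial (Fin d) K) f).2
  exact ((div_eq_iff h0).1 h).symm

/-- The reduced denominator divides the denominator of any other representation, so a fraction whose
denominator does not vanish at `x` may be used as it stands. -/
lemma regularAt_of_mul_eq {f : MvRat K d} {a b : MvPolynomial (Fin d) K} {x : Fin d → K}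
    (h : f * algebraMap (MvPolynomial (Fin d) K) (MvRat K d) b =
      algebraMap (MvPolynomial (Fin d) K) (MvRat K d) a) (hb : MvPolynomial.eval x b ≠ 0) :
    f.RegularAt x ∧ f.evalAt x = MvPolynomial.eval x a / MvPolynomial.eval x b := by
  have h1 : f.num * b = a * f.den := by
    refine IsFractionRing.injective (MvPolynomial (Fin d) K) (MvRat K d) ?_
    rw [map_mul, map_mul, ← mul_den, ← h]
    ring
  have h2 : f.den ∣ b := by
    have h3 := IsFractionRing.num_den_reduced (MvPolynomial (Fin d) K) f
    exact h3.symm.dvd_of_dvd_mul_left ⟨a, by rw [mul_comm _ a]; exact h1⟩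
  have h4 : f.RegularAt x := fun h0 => hb (by
    obtain ⟨c, rfl⟩ := h2
    rw [map_mul, h0, zero_mul])
  refine ⟨h4, ?_⟩
  rw [evalAt, div_eq_div_iff h4 hb]
  simpa using congrArg (MvPolynomial.eval x) h1

lemma regularAt_algebraMap (p : MvPolynomial (Fin d) K) (x : Fin d → K) :
    RegularAt (algebraMap (MvPolynomial (Fin d) K) (MvRat K d) p) x ∧
      evalAt (algebraMap (MvPolynomial (Fin d) K) (MvRat K d) p) x = MvPolynomial.eval x p := by
  have := regularAt_of_mul_eq (f := algebraMap (MvPolynomial (Fin d) K) (MvRat K d) p) (a := p)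
    (b := 1) (x := x) (by simp) (by simp)
  simpa using this

lemma regularAt_add {f g : MvRat K d} {x : Fin d → K} (hf : f.RegularAt x) (hg : g.RegularAt x) :
    (f + g).RegularAt x ∧ (f + g).evalAt x = f.evalAt x + g.evalAt x := by
  have := regularAt_of_mul_eq (f := f + g) (a := f.num * g.den + g.num * f.den)
    (b := f.den * g.den) (x := x)
    (by simp only [map_mul, map_add, ← mul_den]; ring) (by rw [map_mul]; exact mul_ne_zero hf hg)
  refine ⟨this.1, this.2.trans ?_⟩
  simp only [evalAt, map_mul, map_add]
  rw [div_add_div _ _ hf hg]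
  ring

lemma regularAt_mul {f g : MvRat K d} {x : Fin d → K} (hf : f.RegularAt x) (hg : g.RegularAt x) :
    (f * g).RegularAt x ∧ (f * g).evalAt x = f.evalAt x * g.evalAt x := by
  have := regularAt_of_mul_eq (f := f * g) (a := f.num * g.num)
    (b := f.den * g.den) (x := x)
    (by simp only [map_mul, ← mul_den]; ring) (by rw [map_mul]; exact mul_ne_zero hf hg)
  refine ⟨this.1, this.2.trans ?_⟩
  simp only [evalAt, map_mul]
  rw [div_mul_div_comm]

lemma regularAt_zero (x : Fin d → K) : RegularAt (0 : MvRat K d) x ∧ evalAt (0 : MvRat K d) x = 0 := by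
  simpa using regularAt_algebraMap (0 : MvPolynomial (Fin d) K) x

lemma regularAt_one (x : Fin d → K) : RegularAt (1 : MvRat K d) x ∧ evalAt (1 : MvRat K d) x = 1 := by
  simpa using regularAt_algebraMap (1 : MvPolynomial (Fin d) K) x

lemma regularAt_sum {ι : Type*} (s : Finset ι) {f : ι → MvRat K d} {x : Fin d → K}
    (hf : ∀ i ∈ s, (f i).RegularAt x) :
    (∑ i ∈ s, f i).RegularAt x ∧ (∑ i ∈ s, f i).evalAt x = ∑ i ∈ s, (f i).evalAt x := by
  classical
  induction s using Finset.induction_on with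
  | empty => simpa using regularAt_zero x
  | insert i s hi ih =>
    obtain ⟨h1, h2⟩ := ih fun j hj => hf j (Finset.mem_insert_of_mem hj)
    rw [Finset.sum_insert hi, Finset.sum_insert hi, ← h2]
    exact regularAt_add (hf i (Finset.mem_insert_self i s)) h1

lemma eval_polyShift (v : Fin d → ℤ) (p : MvPolynomial (Fin d) K) (x : Fin d → K) :
    MvPolynomial.eval x (polyShift v p) = MvPolynomial.eval (fun i => x i + (v i : K)) p := by
  have h : (MvPolynomial.aeval (R := K) x).comp (polyShift (K := K) v).toAlgHom =
      MvPolynomial.aeval fun i => x i + (v i : K) := by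
    ext i
    simp [polyShift]
  simpa [MvPolynomial.aeval_eq_eval] using DFunLike.congr_fun h p

lemma shift_algebraMap (v : Fin d → ℤ) (p : MvPolynomial (Fin d) K) :
    shift v (algebraMap (MvPolynomial (Fin d) K) (MvRat K d) p) =
      algebraMap (MvPolynomial (Fin d) K) (MvRat K d) (polyShift v p) :=
  IsFractionRing.ringEquivOfRingEquiv_algebraMap _ _

lemma regularAt_shift {f : MvRat K d} {v : Fin d → ℤ} {x : Fin d → K}
    (hf : f.RegularAt fun i => x i + (v i : K)) :
    (shift v f).RegularAt x ∧ (shift v f).evalAt x = f.evalAt fun i => x i + (v i : K) := by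
  have := regularAt_of_mul_eq (f := shift v f) (a := polyShift v f.num)
    (b := polyShift v f.den) (x := x)
    (by rw [← shift_algebraMap, ← shift_algebraMap, ← map_mul, mul_den])
    (by rw [eval_polyShift]; exact hf)
  refine ⟨this.1, this.2.trans ?_⟩
  rw [eval_polyShift, eval_polyShift, evalAt]

/-- The point `x + t v`. -/
def linePoint (x : Fin d → K) (v : Fin d → ℤ) (t : K) : Fin d → K := fun i => x i + (v i : K) * t

lemma linePoint_zero (x : Fin d → K) (v : Fin d → ℤ) : linePoint x v 0 = x := by
  funext i
  simp [linePoint]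

lemma eval_polyOnLine (x : Fin d → K) (v : Fin d → ℤ) (t : K) (p : MvPolynomial (Fin d) K) :
    (polyOnLine x v p).eval t = MvPolynomial.eval (linePoint x v t) p := by
  have h : (Polynomial.aeval (R := K) t).comp (polyOnLine x v) =
      MvPolynomial.aeval (linePoint x v t) := by
    ext i
    simp [polyOnLine, linePoint]
  simpa [MvPolynomial.aeval_eq_eval] using DFunLike.congr_fun h p

lemma RegularAt.regularOnLine {f : MvRat K d} {x : Fin d → K} {v : Fin d → ℤ} {t : K}
    (hf : f.RegularAt (linePoint x v t)) : f.RegularOnLine x v := fun h => hf (by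
  rw [← eval_polyOnLine, h, Polynomial.eval_zero])

lemma RegularOnLine.eventually {f : MvRat ℚ d} {x : Fin d → ℚ} {v : Fin d → ℤ}
    (hf : f.RegularOnLine x v) : ∀ᶠ t in cofinite, f.RegularAt (linePoint x v t) ∧
      ratEval t (f.onLine x v) = f.evalAt (linePoint x v t) := by
  filter_upwards [eventually_polynomial_eval_ne_zero hf] with t ht
  refine ⟨by rwa [eval_polyOnLine] at ht, ?_⟩
  rw [onLine, ratEval_div ht, eval_polyOnLine, eval_polyOnLine, evalAt]

lemma continuousAt_evalAt {f : MvRat ℚ d} {x : Fin d → ℚ} {v : Fin d → ℤ} {t : ℚ}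
    (hf : f.RegularAt (linePoint x v t)) :
    ContinuousAt (fun t => f.evalAt (linePoint x v t)) t := by
  simp only [evalAt, ← eval_polyOnLine]
  refine ContinuousAt.div (Polynomial.continuous _).continuousAt
    (Polynomial.continuous _).continuousAt ?_
  rw [eval_polyOnLine]
  exact hf

end MvRat

lemma continuousAt_ratEval {f : RatFunc ℚ} {t : ℚ} (hf : f.denom.eval t ≠ 0) :
    ContinuousAt (fun t => ratEval t f) t := by
  simp only [ratEval_eq]
  exact ContinuousAt.div (Polynomial.continuous _).continuousAt
    (Polynomial.continuous _).continuousAt hf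

/-! ### Trajectories of conservative matrix fields -/

namespace CMF

open MvRat

variable {K : Type} [Field K] {d r : ℕ}

lemma matRegularAt_mul {A B : Matrix (Fin r) (Fin r) (MvRat K d)} {x : Fin d → K}
    (hA : MatRegularAt A x) (hB : MatRegularAt B x) :
    MatRegularAt (A * B) x ∧ matEval (A * B) x = matEval A x * matEval B x := by
  have h := fun i j => regularAt_sum Finset.univ (f := fun k => A i k * B k j) (x := x)
    fun k _ => (regularAt_mul (hA i k) (hB k j)).1
  refine ⟨fun i j => (h i j).1, ?_⟩
  ext i j
  simp only [matEval, Matrix.map_apply, Matrix.mul_apply, (h i j).2]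
  exact Finset.sum_congr rfl fun k _ => (regularAt_mul (hA i k) (hB k j)).2

lemma matRegularAt_one (x : Fin d → K) :
    MatRegularAt (1 : Matrix (Fin r) (Fin r) (MvRat K d)) x ∧
      matEval (1 : Matrix (Fin r) (Fin r) (MvRat K d)) x = 1 := by
  refine ⟨fun i j => ?_, ?_⟩
  · rw [Matrix.one_apply]
    split_ifs
    exacts [(regularAt_one x).1, (regularAt_zero x).1]
  · ext i j
    simp only [matEval, Matrix.map_apply, Matrix.one_apply]
    split_ifs
    exacts [(regularAt_one x).2, (regularAt_zero x).2]

lemma matRegularAt_shift {A : Matrix (Fin r) (Fin r) (MvRat K d)} {v : Fin d → ℤ} {x : Fin d → K}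
    (hA : MatRegularAt A fun i => x i + (v i : K)) :
    MatRegularAt (A.map (shift v)) x ∧
      matEval (A.map (shift v)) x = matEval A fun i => x i + (v i : K) := by
  refine ⟨fun i j => (regularAt_shift (hA i j)).1, ?_⟩
  ext i j
  exact (regularAt_shift (hA i j)).2

lemma cocycle_val (M : CMF K d r) (v w : Fin d → ℤ) :
    (M.mat (v + w)).val = (M.mat v).val * (M.mat w).val.map (shift v) := by
  rw [M.cocycle]
  rfl

/-- The cocycle identity at `(0, 0)` cancels to `σ₀(M₀) = 1`, and `σ₀` is injective. -/
lemma mat_zero (M : CMF K d r) : M.mat 0 = 1 := by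
  have h := M.cocycle 0 0
  rw [add_zero, left_eq_mul] at h
  ext i j
  have h1 := congrArg
    (fun g : Matrix.GeneralLinearGroup (Fin r) (MvRat K d) => g.val i j) h
  refine (shift (K := K) (d := d) 0).injective ?_
  refine Eq.trans h1 ?_
  rw [Units.val_one, Matrix.one_apply]
  split_ifs <;> simp

lemma MatRegularAt.matRegularOnLine {A : Matrix (Fin r) (Fin r) (MvRat K d)} {x : Fin d → K}
    {v : Fin d → ℤ} {t : K} (hA : MatRegularAt A (linePoint x v t)) : MatRegularOnLine A x v :=
  fun i j => (hA i j).regularOnLine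

lemma MatRegularOnLine.eventually {A : Matrix (Fin r) (Fin r) (MvRat ℚ d)} {x : Fin d → ℚ}
    {v : Fin d → ℤ} (hA : MatRegularOnLine A x v) :
    ∀ᶠ t in cofinite, MatRegularAt A (linePoint x v t) ∧
      (matOnLine A x v).map (ratEval t) = matEval A (linePoint x v t) := by
  filter_upwards [eventually_all.2 fun i => eventually_all.2 fun j => (hA i j).eventually] with t ht
  refine ⟨fun i j => (ht i j).1, ?_⟩
  ext i j
  exact (ht i j).2

lemma continuousAt_matEval {A : Matrix (Fin r) (Fin r) (MvRat ℚ d)} {x : Fin d → ℚ}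
    {v : Fin d → ℤ} {t : ℚ} (hA : MatRegularAt A (linePoint x v t)) :
    ContinuousAt (fun t => matEval A (linePoint x v t)) t :=
  continuousAt_pi.2 fun i => continuousAt_pi.2 fun j => continuousAt_evalAt (hA i j)

end CMF

open MvRat CMF

section Trajectory

variable {d r : ℕ} [NeZero r] {M : CMF ℚ d r} {x : Fin d → ℚ} {v : Fin d → ℤ}
  {A : Matrix.GeneralLinearGroup (Fin r) (MvRat ℚ d)} {a : Fin r → RatFunc ℚ}

/-- The product `C(t) C(t+1) ⋯ C(t+n-1)` of values of the companion matrix. -/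
def companionProd (a : Fin r → RatFunc ℚ) (t : ℚ) : ℕ → Matrix (Fin r) (Fin r) ℚ
  | 0 => 1
  | n + 1 => companionProd a t n * companionAt a (t + n)

lemma continuousAt_companionAt {t : ℚ} (ht : ∀ i, (a i).denom.eval t ≠ 0) :
    ContinuousAt (companionAt a) t := by
  refine continuousAt_pi.2 fun i => continuousAt_pi.2 fun j => ?_
  simp only [companionAt, Matrix.of_apply]
  split_ifs
  · exact (continuousAt_ratEval (ht i)).neg
  · exact continuousAt_const
  · exact continuousAt_const

lemma continuousAt_companionProd (ha : CoeffsDefined a) (n : ℕ) :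
    ContinuousAt (fun t => companionProd a t n) 0 := by
  induction n with
  | zero => exact continuousAt_const
  | succ n ih =>
    refine ContinuousAt.mul ih ?_
    have h1 : ContinuousAt (companionAt a) (0 + (n : ℚ)) := by
      rw [zero_add]
      exact continuousAt_companionAt fun i => ha i n
    exact ContinuousAt.comp (f := fun t : ℚ => t + n) h1 (by fun_prop)

lemma vecMul_companionProd {u : ℕ → ℚ} (hu : IsSolution a u) (n : ℕ) :
    Matrix.vecMul (fun i : Fin r => u i) (companionProd a 0 n) = fun i : Fin r => u (n + i) := by
  induction n with
  | zero => simp [companionProd]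
  | succ n ih =>
    rw [companionProd, ← Matrix.vecMul_vecMul, ih]
    funext j
    have h : RecurrenceAt a u n := by simpa [RecurrenceAt] using hu n
    have := h.window j
    simpa [Matrix.vecMul, dotProduct] using this

namespace IsCompanionTransform

variable (h : IsCompanionTransform M x v A a)
include h

lemma eventually_field_regular (n : ℕ) :
    ∀ᶠ t in cofinite, MatRegularAt (M.mat (n • v)).val (linePoint x v t) := by
  have h1 : MatRegularOnLine (M.mat (n • v)).val x v :=
    MatRegularAt.matRegularOnLine (t := 0) (by rw [linePoint_zero]; exact h.field_regular n)
  exact h1.eventually.mono fun t ht => ht.1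

lemma eventually_regular : ∀ᶠ t in cofinite, MatRegularAt A.val (linePoint x v t) := by
  have h1 : MatRegularOnLine A.val x v :=
    MatRegularAt.matRegularOnLine (t := 0) (by rw [linePoint_zero]; exact h.regular)
  exact h1.eventually.mono fun t ht => ht.1

lemma eventually_mul_inv : ∀ᶠ t in cofinite,
    matEval A.val (linePoint x v t) * matEval (A⁻¹).val (linePoint x v t) = 1 := by
  filter_upwards [h.eventually_regular, h.inv_regular.eventually] with t h1 h2
  rw [← (matRegularAt_mul h1 h2.1).2, ← Units.val_mul, mul_inv_cancel]
  exact (matRegularAt_one _).2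

lemma eventually_step : ∀ᶠ t in cofinite,
    matEval (M.mat v).val (linePoint x v t) * matEval A.val (linePoint x v (t + 1)) =
      matEval A.val (linePoint x v t) * companionAt a t := by
  have hl : ∀ t, linePoint (fun i => x i + (v i : ℚ)) v t = linePoint x v (t + 1) := fun t => by
    funext i
    simp only [linePoint]
    ring
  -- On the line through `x + v` the known regular point `x` has parameter `-1`.
  have h1 : MatRegularOnLine A.val (fun i => x i + (v i : ℚ)) v :=
    MatRegularAt.matRegularOnLine (t := -1) (by
      rw [hl, neg_add_cancel, linePoint_zero]
      exact h.regular)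
  have h2 : MatRegularOnLine (M.mat v).val x v :=
    MatRegularAt.matRegularOnLine (t := 0) (by
      rw [linePoint_zero]
      simpa using h.field_regular 1)
  have h3 := h.companion_eq
  rw [trajectory] at h3
  filter_upwards [h1.eventually, h2.eventually, h.inv_regular.eventually, h.eventually_mul_inv,
    eventually_companion_map a,
    eventually_ratEval_matrix_mul (matOnLine (A⁻¹).val x v * matOnLine (M.mat v).val x v)
      (matOnLine A.val (fun i => x i + (v i : ℚ)) v),
    eventually_ratEval_matrix_mul (matOnLine (A⁻¹).val x v) (matOnLine (M.mat v).val x v)]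
    with t h4 h5 h6 h7 h8 h9 h10
  rw [h3, h8, h10, h4.2, h5.2, h6.2, hl] at h9
  rw [h9, mul_assoc (matEval (A⁻¹).val _), ← mul_assoc, h7, one_mul]

/-- The telescoping is done at generic `t`, because `A` may have poles at some of the intermediate
points `x + jv`. -/
lemma eventually_field_mul (n : ℕ) : ∀ᶠ t in cofinite,
    matEval (M.mat (n • v)).val (linePoint x v t) * matEval A.val (linePoint x v (t + n)) =
      matEval A.val (linePoint x v t) * companionProd a t n := by
  induction n with
  | zero =>
    refine Eventually.of_forall fun t => ?_
    rw [zero_smul, mat_zero, Units.val_one, (matRegularAt_one _).2]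
    simp [companionProd]
  | succ n ih =>
    have hl : ∀ t, (fun i => linePoint x v t i + (((n • v) i : ℤ) : ℚ)) =
        linePoint x v (t + n) := fun t => by
      funext i
      simp [linePoint]
      ring
    filter_upwards [ih, (tendsto_add_const_cofinite n).eventually h.eventually_step,
      h.eventually_field_regular n,
      (tendsto_add_const_cofinite n).eventually (h.eventually_field_regular 1)] with t h1 h2 h3 h4
    rw [one_smul, ← hl] at h4
    obtain ⟨h5, h6⟩ := matRegularAt_shift h4
    rw [succ_nsmul, cocycle_val, (matRegularAt_mul h3 h5).2, h6, hl, mul_assoc, Nat.cast_succ,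
      ← add_assoc, h2, ← mul_assoc, h1, companionProd, mul_assoc]

/-- The generic identity is continued to `t = 0`. Only its two ends enter the statement, so poles of
`A` strictly between them do no harm. -/
lemma field_mul (n : ℕ) (hn : MatRegularAt A.val (linePoint x v n)) :
    matEval (M.mat (n • v)).val x * matEval A.val (linePoint x v n) =
      matEval A.val x * companionProd a 0 n := by
  have h1 : ContinuousAt (fun t => matEval (M.mat (n • v)).val (linePoint x v t) *
      matEval A.val (linePoint x v (t + n))) 0 := by
    refine ContinuousAt.mul (continuousAt_matEval
      (by rw [linePoint_zero]; exact h.field_regular n)) ?_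
    have h2 : ContinuousAt (fun t => matEval A.val (linePoint x v t)) (0 + (n : ℚ)) :=
      continuousAt_matEval (by rwa [zero_add])
    exact ContinuousAt.comp (f := fun t : ℚ => t + n) h2 (by fun_prop)
  have h2 : ContinuousAt (fun t => matEval A.val (linePoint x v t) * companionProd a t n) 0 :=
    ContinuousAt.mul (continuousAt_matEval (by rw [linePoint_zero]; exact h.regular))
      (continuousAt_companionProd h.coeffs_defined n)
  have h3 := (h1.tendsto.mono_left nhdsWithin_le_nhds).congr'
    ((h.eventually_field_mul n).filter_mono (nhdsNE_le_cofinite (0 : ℚ)))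
  have h4 := tendsto_nhds_unique h3 (h2.tendsto.mono_left nhdsWithin_le_nhds)
  simpa [linePoint_zero] using h4

/-- The CMF numerators and denominators are obtained from the solutions of the recurrence by
applying a fixed operator over `ℚ(n)`. -/
lemma exists_operator : ∃ b : Fin r → RatFunc ℚ, b ≠ 0 ∧ ∀ (p : Fin r → ℚ) (u : ℕ → ℚ),
    IsSolution a u → (∀ i : Fin r, u i = ((matEval A.val x).transpose.mulVec p) i) →
    ∀ᶠ n : ℕ in atTop,
      p ⬝ᵥ (matEval (M.mat (n • v)).val x).mulVec (lastVec ℚ r) = applyOp b u n := by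
  have h1 := tendsto_natCast_cofinite.eventually h.eventually_regular
  have h2 := tendsto_natCast_cofinite.eventually h.inv_regular.eventually
  have h3 := tendsto_natCast_cofinite.eventually h.eventually_mul_inv
  -- The operator is the last column of `A⁻¹` on the line. It is nonzero because `A A⁻¹ = 1` has
  -- last diagonal entry `1` at generic points.
  refine ⟨fun i => ((A⁻¹).val i (lastIdx r)).onLine x v, fun hb => ?_, fun p u hu hp => ?_⟩
  · obtain ⟨n, ⟨_, h4⟩, h5⟩ := (h2.and h3).exists
    have h6 := congrFun (congrFun h5 (lastIdx r)) (lastIdx r)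
    rw [Matrix.mul_apply, Finset.sum_eq_zero, Matrix.one_apply_eq] at h6
    · exact zero_ne_one h6
    · intro i _
      have h7 : ratEval n (matOnLine (A⁻¹).val x v i (lastIdx r)) = 0 := by
        have : matOnLine (A⁻¹).val x v i (lastIdx r) = 0 := congrFun hb i
        rw [this, ratEval_zero]
      rw [← h4, Matrix.map_apply, h7, mul_zero]
  · filter_upwards [h1, h2, h3] with n h4 h5 h6
    have h7 : matEval (M.mat (n • v)).val x = matEval A.val x * companionProd a 0 n *
        matEval (A⁻¹).val (linePoint x v n) := by
      rw [← h.field_mul n h4, mul_assoc, h6, mul_one]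
    have h8 : Matrix.vecMul p (matEval A.val x) = fun i : Fin r => u i := by
      funext i
      rw [hp i, Matrix.mulVec_transpose]
    rw [h7, Matrix.dotProduct_mulVec, ← Matrix.vecMul_vecMul, ← Matrix.vecMul_vecMul, h8,
      vecMul_companionProd hu, ← Matrix.dotProduct_mulVec, ← h5.2, lastVec,
      Matrix.mulVec_single_one]
    simp only [dotProduct, applyOp, Rat.cast_id]
    exact Finset.sum_congr rfl fun i _ => mul_comm _ _

theorem ratio_comparison (hPP : IsPoincarePerron a) (hirr : IsIrreducibleRecurrence a)
    {p q : Fin r → ℚ} {u w : ℕ → ℚ} (hu : IsSolution a u)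
    (hp : ∀ i : Fin r, u i = ((matEval A.val x).transpose.mulVec p) i) (hw : IsSolution a w)
    (hq : ∀ i : Fin r, w i = ((matEval A.val x).transpose.mulVec q) i)
    (hw0 : ¬ ∀ᶠ n in atTop, w n = 0) :
    (∀ᶠ n in atTop, w n ≠ 0) ∧
    (∀ᶠ n : ℕ in atTop, q ⬝ᵥ (matEval (M.mat (n • v)).val x).mulVec (lastVec ℚ r) ≠ 0) ∧
    ∀ l : ℝ,
      (Tendsto (fun n => ((M.ratio x v p q n : ℚ) : ℝ)) atTop (𝓝 l) ↔
        Tendsto (fun n => ((u n / w n : ℚ) : ℝ)) atTop (𝓝 l)) ∧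
      (Tendsto (fun n => ((u n / w n : ℚ) : ℝ)) atTop (𝓝 l) →
        ∃ ρ : EReal, HasConvergenceRate (M.ratio x v p q) l ρ ∧
          HasConvergenceRate (fun n => u n / w n) l ρ) := by
  obtain ⟨b, hb, hop⟩ := h.exists_operator
  exact operator_quotient_comparison hPP hirr hb hu hw hw0 (hop p u hu hp) (hop q w hw hq)

end IsCompanionTransform

end Trajectory

/-! ### The field of `ζ(3)`: values of the matrices -/

namespace Zeta3

open MvRat CMF
open MvPolynomial (X)

lemma x₁_ne_zero : x₁ ≠ 0 := by
  rw [x₁, Ne, IsFractionRing.to_map_eq_zero_iff]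
  exact MvPolynomial.X_ne_zero 0

lemma x₂_ne_zero : x₂ ≠ 0 := by
  rw [x₂, Ne, IsFractionRing.to_map_eq_zero_iff]
  exact MvPolynomial.X_ne_zero 1

lemma algebraMap_two : algebraMap (MvPolynomial (Fin 2) ℚ) (MvRat ℚ 2) 2 = 2 :=
  map_ofNat _ 2

lemma regularAt_of_eq_div {f : MvRat ℚ 2} {x : Fin 2 → ℚ} {c : ℚ} (p q : MvPolynomial (Fin 2) ℚ)
    (h : f = algebraMap _ (MvRat ℚ 2) p / algebraMap _ (MvRat ℚ 2) q)
    (hq : MvPolynomial.eval x q ≠ 0)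
    (hc : c = MvPolynomial.eval x p / MvPolynomial.eval x q) :
    f.RegularAt x ∧ f.evalAt x = c := by
  rw [hc]
  refine regularAt_of_mul_eq ?_ hq
  rw [h, div_mul_cancel₀]
  rw [Ne, IsFractionRing.to_map_eq_zero_iff]
  rintro rfl
  simp at hq

/-- The values of `M₁`. -/
def val₁ (x y : ℚ) : Matrix (Fin 2) (Fin 2) ℚ :=
  !![0, -1; (x + 1) ^ 3 / x ^ 3,
    (x ^ 3 + 2 * y * (2 * x + 1) * (y - 1) + (x + 1) ^ 3) / x ^ 3]

/-- The values of `M₂`. -/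
def val₂ (x y : ℚ) : Matrix (Fin 2) (Fin 2) ℚ :=
  !![(-x ^ 3 + 2 * x ^ 2 * y - 2 * x * y ^ 2 + y ^ 3) / y ^ 3, -(x ^ 3 / y ^ 3);
    x ^ 3 / y ^ 3, (x ^ 3 + 2 * x ^ 2 * y + 2 * x * y ^ 2 + y ^ 3) / y ^ 3]

/-- The values of `A`. -/
def valA (x y : ℚ) : Matrix (Fin 2) (Fin 2) ℚ :=
  !![1 / x ^ 3, -(1 / y ^ 3);
    0, (x ^ 3 + 2 * x ^ 2 * y + 2 * x * y ^ 2 + y ^ 3) / (x ^ 3 * y ^ 3)]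

lemma matRegularAt_of_entries {B : Matrix (Fin 2) (Fin 2) (MvRat ℚ 2)}
    {C : Matrix (Fin 2) (Fin 2) ℚ} {x : Fin 2 → ℚ}
    (h : ∀ i j, (B i j).RegularAt x ∧ (B i j).evalAt x = C i j) :
    MatRegularAt B x ∧ matEval B x = C :=
  ⟨fun i j => (h i j).1, by ext i j; exact (h i j).2⟩

lemma matEval_M₁ {x : Fin 2 → ℚ} (hx : x 0 ≠ 0) :
    MatRegularAt M₁ x ∧ matEval M₁ x = val₁ (x 0) (x 1) := by
  refine matRegularAt_of_entries fun i j => ?_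
  fin_cases i <;> fin_cases j
  · refine regularAt_of_eq_div (0) (1) ?_ ?_ ?_ <;>
      simp [M₁, val₁, x₁, x₂]
  · refine regularAt_of_eq_div (-1) (1) ?_ ?_ ?_ <;>
      simp [M₁, val₁, x₁, x₂]
  · refine regularAt_of_eq_div ((X 0 + 1) ^ 3) (X 0 ^ 3) ?_ ?_ ?_ <;>
      simp [M₁, val₁, x₁, x₂, hx]
  · refine regularAt_of_eq_div (X 0 ^ 3 + 2 * X 1 * (2 * X 0 + 1) * (X 1 - 1) + (X 0 + 1) ^ 3) (X 0 ^ 3) ?_ ?_ ?_ <;>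
      simp [M₁, val₁, x₁, x₂, algebraMap_two, hx]

lemma matEval_M₂ {x : Fin 2 → ℚ} (hx : x 1 ≠ 0) :
    MatRegularAt M₂ x ∧ matEval M₂ x = val₂ (x 0) (x 1) := by
  refine matRegularAt_of_entries fun i j => ?_
  fin_cases i <;> fin_cases j
  · refine regularAt_of_eq_div (-X 0 ^ 3 + 2 * X 0 ^ 2 * X 1 - 2 * X 0 * X 1 ^ 2 + X 1 ^ 3) (X 1 ^ 3) ?_ ?_ ?_ <;>
      simp [M₂, val₂, x₁, x₂, algebraMap_two, hx]
  · refine regularAt_of_eq_div (-X 0 ^ 3) (X 1 ^ 3) ?_ ?_ ?_ <;>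
      simp [M₂, val₂, x₁, x₂, neg_div, hx]
  · refine regularAt_of_eq_div (X 0 ^ 3) (X 1 ^ 3) ?_ ?_ ?_ <;>
      simp [M₂, val₂, x₁, x₂, hx]
  · refine regularAt_of_eq_div (X 0 ^ 3 + 2 * X 0 ^ 2 * X 1 + 2 * X 0 * X 1 ^ 2 + X 1 ^ 3) (X 1 ^ 3) ?_ ?_ ?_ <;>
      simp [M₂, val₂, x₁, x₂, algebraMap_two, hx]

lemma matEval_A {x : Fin 2 → ℚ} (hx : x 0 ≠ 0) (hy : x 1 ≠ 0) :
    MatRegularAt A x ∧ matEval A x = valA (x 0) (x 1) := by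
  refine matRegularAt_of_entries fun i j => ?_
  fin_cases i <;> fin_cases j
  · refine regularAt_of_eq_div (1) (X 0 ^ 3) ?_ ?_ ?_ <;>
      simp [A, valA, x₁, x₂, hx]
  · refine regularAt_of_eq_div (-1) (X 1 ^ 3) ?_ ?_ ?_ <;>
      simp [A, valA, x₁, x₂, neg_div, hy]
  · refine regularAt_of_eq_div (0) (1) ?_ ?_ ?_ <;>
      simp [A, valA, x₁, x₂]
  · refine regularAt_of_eq_div (X 0 ^ 3 + 2 * X 0 ^ 2 * X 1 + 2 * X 0 * X 1 ^ 2 + X 1 ^ 3) (X 0 ^ 3 * X 1 ^ 3) ?_ ?_ ?_ <;>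
      simp [A, valA, x₁, x₂, algebraMap_two, hx, hy]

/-- The denominator of `A⁻¹`. -/
def corner : MvRat ℚ 2 := x₁ ^ 3 + 2 * x₁ ^ 2 * x₂ + 2 * x₁ * x₂ ^ 2 + x₂ ^ 3

lemma corner_ne_zero : corner ≠ 0 := by
  have h : corner = algebraMap (MvPolynomial (Fin 2) ℚ) (MvRat ℚ 2)
      (X 0 ^ 3 + 2 * X 0 ^ 2 * X 1 + 2 * X 0 * X 1 ^ 2 + X 1 ^ 3) := by
    simp [corner, x₁, x₂, algebraMap_two]
  rw [h, Ne, IsFractionRing.to_map_eq_zero_iff]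
  intro h0
  have := congrArg (MvPolynomial.eval fun _ => (1 : ℚ)) h0
  norm_num at this

/-- The inverse of `A`. -/
def AInv : Matrix (Fin 2) (Fin 2) (MvRat ℚ 2) :=
  !![x₁ ^ 3, x₁ ^ 6 / corner; 0, x₁ ^ 3 * x₂ ^ 3 / corner]

lemma inverse_identities {F : Type*} [Field F] {a b D : F} (ha : a ≠ 0) (hb : b ≠ 0) (hD : D ≠ 0) :
    !![1 / a ^ 3, -(1 / b ^ 3); 0, D / (a ^ 3 * b ^ 3)] *
      !![a ^ 3, a ^ 6 / D; 0, a ^ 3 * b ^ 3 / D] = 1 ∧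
    !![a ^ 3, a ^ 6 / D; 0, a ^ 3 * b ^ 3 / D] *
      !![1 / a ^ 3, -(1 / b ^ 3); 0, D / (a ^ 3 * b ^ 3)] = 1 := by
  constructor <;> ext i j <;> fin_cases i <;> fin_cases j <;> simp [Matrix.mul_apply] <;>
    field_simp <;> ring

/-- The matrix `A` as an invertible matrix. -/
def AUnit : Matrix.GeneralLinearGroup (Fin 2) (MvRat ℚ 2) where
  val := A
  inv := AInv
  val_inv := (inverse_identities x₁_ne_zero x₂_ne_zero corner_ne_zero).1
  inv_val := (inverse_identities x₁_ne_zero x₂_ne_zero corner_ne_zero).2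

lemma matRegularAt_AInv : MatRegularAt AInv ![1, 1] := by
  intro i j
  fin_cases i <;> fin_cases j
  · refine (regularAt_of_eq_div (X 0 ^ 3) 1 ?_ ?_ rfl).1 <;> simp [AInv, x₁]
  · refine (regularAt_of_eq_div (X 0 ^ 6)
      (X 0 ^ 3 + 2 * X 0 ^ 2 * X 1 + 2 * X 0 * X 1 ^ 2 + X 1 ^ 3) ?_ ?_ rfl).1
    · simp [AInv, corner, x₁, x₂, algebraMap_two]
    · norm_num
  · refine (regularAt_of_eq_div 0 1 ?_ ?_ rfl).1 <;> simp [AInv]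
  · refine (regularAt_of_eq_div (X 0 ^ 3 * X 1 ^ 3)
      (X 0 ^ 3 + 2 * X 0 ^ 2 * X 1 + 2 * X 0 * X 1 ^ 2 + X 1 ^ 3) ?_ ?_ rfl).1
    · simp [AInv, corner, x₁, x₂, algebraMap_two]
    · norm_num

end Zeta3

/-! ### Two-dimensional fields from commuting generators -/

namespace MvRat

variable {K : Type} [Field K] {d : ℕ}

lemma polyShift_add (v w : Fin d → ℤ) (p : MvPolynomial (Fin d) K) :
    polyShift (v + w) p = polyShift v (polyShift w p) := by
  have h : (polyShift (K := K) (v + w)).toAlgHom =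
      (polyShift (K := K) v).toAlgHom.comp (polyShift w).toAlgHom := by
    ext i
    simp [polyShift, add_assoc]
  exact DFunLike.congr_fun h p

lemma shift_add (v w : Fin d → ℤ) (f : MvRat K d) : shift (v + w) f = shift v (shift w f) := by
  have h : ((shift (K := K) (v + w) : MvRat K d ≃+* MvRat K d) : MvRat K d →+* MvRat K d) =
      (shift (K := K) v : MvRat K d →+* MvRat K d).comp
        (shift (K := K) w : MvRat K d →+* MvRat K d) := by
    refine IsLocalization.ringHom_ext (nonZeroDivisors (MvPolynomial (Fin d) K)) ?_
    refine RingHom.ext fun p => ?_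
    simp only [RingHom.comp_apply, RingHom.coe_coe, shift_algebraMap, polyShift_add]
  exact DFunLike.congr_fun h f

lemma shift_zero (f : MvRat K d) : shift 0 f = f := by
  have h := shift_add 0 0 f
  rw [add_zero] at h
  exact (shift (K := K) (d := d) 0).injective h.symm

/-- The action of `ℤ^d` on invertible matrices by shifts. -/
def shiftAction (K : Type) [Field K] (d r : ℕ) :
    Multiplicative (Fin d → ℤ) →* MulAut (Matrix.GeneralLinearGroup (Fin r) (MvRat K d)) where
  toFun v := Units.mapEquiv (shift (K := K) v.toAdd).mapMatrix.toMulEquiv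
  map_one' := by
    ext g i j
    exact shift_zero _
  map_mul' v w := by
    ext g i j
    exact shift_add _ _ _

end MvRat

namespace CMF

open MvRat

variable {K : Type} [Field K] {r : ℕ}

/-- A cocycle is the first component of a homomorphism from `ℤ²` to the semidirect product that
splits the projection; such a homomorphism is given by a commuting pair lying over the standard
basis. -/
lemma semidirect_left_cocycle {N : Type*} [Group N]
    {φ : Multiplicative (Fin 2 → ℤ) →* MulAut N} {a b : N ⋊[φ] Multiplicative (Fin 2 → ℤ)}
    (hc : Commute a b) (ha : a.right = Multiplicative.ofAdd ![1, 0])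
    (hb : b.right = Multiplicative.ofAdd ![0, 1]) (v w : Fin 2 → ℤ) :
    (a ^ (v + w) 0 * b ^ (v + w) 1).left =
      (a ^ v 0 * b ^ v 1).left * φ (Multiplicative.ofAdd v) (a ^ w 0 * b ^ w 1).left := by
  have hr : (a ^ v 0 * b ^ v 1).right = Multiplicative.ofAdd v := by
    have h1 : ∀ (g : N ⋊[φ] Multiplicative (Fin 2 → ℤ)) (n : ℤ), (g ^ n).right = g.right ^ n :=
      fun g n => map_zpow SemidirectProduct.rightHom g n
    rw [SemidirectProduct.mul_right, h1, h1, ha, hb, ← ofAdd_zsmul, ← ofAdd_zsmul, ← ofAdd_add]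
    congr 1
    ext i
    fin_cases i <;> simp
  have h2 := (hc.zpow_zpow (w 0) (v 1)).eq
  rw [← hr, ← SemidirectProduct.mul_left, Pi.add_apply, Pi.add_apply, zpow_add, zpow_add]
  congr 1
  rw [mul_assoc, mul_assoc, ← mul_assoc (a ^ w 0), h2, mul_assoc]

/-- The generator `(g, v)` of the semidirect product. -/
def generator (g : Matrix.GeneralLinearGroup (Fin r) (MvRat K 2)) (v : Fin 2 → ℤ) :
    Matrix.GeneralLinearGroup (Fin r) (MvRat K 2) ⋊[shiftAction K 2 r]
      Multiplicative (Fin 2 → ℤ) :=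
  ⟨g, Multiplicative.ofAdd v⟩

lemma generator_commute {g₁ g₂ : Matrix.GeneralLinearGroup (Fin r) (MvRat K 2)}
    {v w : Fin 2 → ℤ} (h : g₁.val * g₂.val.map (shift v) = g₂.val * g₁.val.map (shift w)) :
    Commute (generator g₁ v) (generator g₂ w) :=
  SemidirectProduct.ext (Units.ext h) (mul_comm (Multiplicative.ofAdd v) (Multiplicative.ofAdd w))

/-- The field with prescribed matrices in the two coordinate directions. -/
def ofCommute (g₁ g₂ : Matrix.GeneralLinearGroup (Fin r) (MvRat K 2))
    (h : g₁.val * g₂.val.map (shift ![1, 0]) = g₂.val * g₁.val.map (shift ![0, 1])) :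
    CMF K 2 r where
  mat v := (generator g₁ ![1, 0] ^ v 0 * generator g₂ ![0, 1] ^ v 1).left
  cocycle := semidirect_left_cocycle (generator_commute h) rfl rfl

variable {g₁ g₂ : Matrix.GeneralLinearGroup (Fin r) (MvRat K 2)}
  {h : g₁.val * g₂.val.map (shift ![1, 0]) = g₂.val * g₁.val.map (shift ![0, 1])}

lemma ofCommute_fst : (ofCommute g₁ g₂ h).mat ![1, 0] = g₁ := by
  change (generator g₁ ![1, 0] ^ (1 : ℤ) * generator g₂ ![0, 1] ^ (0 : ℤ)).left = g₁
  simp [generator]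

lemma ofCommute_snd : (ofCommute g₁ g₂ h).mat ![0, 1] = g₂ := by
  change (generator g₁ ![1, 0] ^ (0 : ℤ) * generator g₂ ![0, 1] ^ (1 : ℤ)).left = g₂
  simp [generator]

end CMF

/-! ### Compatibility of the two generators -/

namespace Zeta3

open MvRat CMF

lemma shift_x₁ (v : Fin 2 → ℤ) : shift v x₁ = x₁ + (v 0 : MvRat ℚ 2) := by
  rw [x₁, shift_algebraMap]
  simp [polyShift]

lemma shift_x₂ (v : Fin 2 → ℤ) : shift v x₂ = x₂ + (v 1 : MvRat ℚ 2) := by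
  rw [x₂, shift_algebraMap]
  simp [polyShift]

lemma shift_ne_zero {v : Fin 2 → ℤ} {f : MvRat ℚ 2} (h : f ≠ 0) : shift v f ≠ 0 := by
  simpa using h

lemma x₁_add_one_ne_zero : x₁ + 1 ≠ 0 := by
  have := shift_ne_zero (v := ![1, 0]) x₁_ne_zero
  rwa [shift_x₁, Matrix.cons_val_zero, Int.cast_one] at this

lemma det_M₁_ne_zero : M₁.det ≠ 0 := by
  have h : M₁.det = (x₁ + 1) ^ 3 / x₁ ^ 3 := by
    rw [M₁, Matrix.det_fin_two_of]
    ring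
  rw [h]
  exact div_ne_zero (pow_ne_zero 3 x₁_add_one_ne_zero) (pow_ne_zero 3 x₁_ne_zero)

lemma det_M₂_ne_zero : M₂.det ≠ 0 := by
  have h : M₂.det = 1 := by
    have := x₂_ne_zero
    rw [M₂, Matrix.det_fin_two_of]
    field_simp
    ring
  rw [h]
  exact one_ne_zero

lemma generators_identity {F : Type*} [Field F] {a b : F} (ha : a ≠ 0) (ha' : a + 1 ≠ 0)
    (hb : b ≠ 0) :
    (!![0, -1; (a + 1) ^ 3 / a ^ 3,
        (a ^ 3 + 2 * b * (2 * a + 1) * (b - 1) + (a + 1) ^ 3) / a ^ 3] :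
      Matrix (Fin 2) (Fin 2) F) *
      !![(-(a + 1) ^ 3 + 2 * (a + 1) ^ 2 * b - 2 * (a + 1) * b ^ 2 + b ^ 3) / b ^ 3,
        -((a + 1) ^ 3 / b ^ 3);
        (a + 1) ^ 3 / b ^ 3,
        ((a + 1) ^ 3 + 2 * (a + 1) ^ 2 * b + 2 * (a + 1) * b ^ 2 + b ^ 3) / b ^ 3] =
    !![(-a ^ 3 + 2 * a ^ 2 * b - 2 * a * b ^ 2 + b ^ 3) / b ^ 3, -(a ^ 3 / b ^ 3);
        a ^ 3 / b ^ 3, (a ^ 3 + 2 * a ^ 2 * b + 2 * a * b ^ 2 + b ^ 3) / b ^ 3] *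
      !![0, -1; (a + 1) ^ 3 / a ^ 3,
        (a ^ 3 + 2 * (b + 1) * (2 * a + 1) * ((b + 1) - 1) + (a + 1) ^ 3) / a ^ 3] := by
  rw [Matrix.mul_fin_two, Matrix.mul_fin_two]
  ext i j
  fin_cases i <;> fin_cases j <;> simp <;> field_simp <;> ring

lemma shift_two (v : Fin 2 → ℤ) : shift v (2 : MvRat ℚ 2) = 2 := map_ofNat (shift v) 2

lemma generators_commute :
    M₁ * M₂.map (shift ![1, 0]) = M₂ * M₁.map (shift ![0, 1]) := by
  have h := generators_identity x₁_ne_zero x₁_add_one_ne_zero x₂_ne_zero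
  convert h using 2 <;> ext i j <;> fin_cases i <;> fin_cases j <;>
    simp [M₁, M₂, shift_x₁, shift_x₂, shift_two]

/-- The conservative matrix field of `ζ(3)`. -/
def field : CMF ℚ 2 2 :=
  CMF.ofCommute (Matrix.GeneralLinearGroup.mkOfDetNeZero M₁ det_M₁_ne_zero)
    (Matrix.GeneralLinearGroup.mkOfDetNeZero M₂ det_M₂_ne_zero) generators_commute

lemma field_fst : (field.mat ![1, 0]).val = M₁ := congrArg Units.val CMF.ofCommute_fst

lemma field_snd : (field.mat ![0, 1]).val = M₂ := congrArg Units.val CMF.ofCommute_snd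

end Zeta3

lemma ratFunc_eq_of_eventually {f g : RatFunc ℚ}
    (h : ∀ᶠ t in cofinite, ratEval t f = ratEval t g) : f = g := by
  by_contra hfg
  obtain ⟨t, h1, h2, h3, h4⟩ := (h.and ((eventually_ratEval_ne_zero (sub_ne_zero.2 hfg)).and
    ((eventually_ratEval_add f (-g)).and (eventually_ratEval_neg g)))).exists
  rw [sub_eq_add_neg, h3, h4, h1] at h2
  exact h2 (add_neg_cancel _)

lemma matrix_eq_of_eventually {r : ℕ} {B C : Matrix (Fin r) (Fin r) (RatFunc ℚ)}
    (h : ∀ᶠ t in cofinite, B.map (ratEval t) = C.map (ratEval t)) : B = C := by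
  ext i j
  exact ratFunc_eq_of_eventually (h.mono fun t ht => congrFun (congrFun ht i) j)

namespace Zeta3

open MvRat CMF

/-! ### Values of the field along coordinate directions -/

/-- The values of `M_{(n,0)}`. -/
def prod₁ (a b : ℚ) : ℕ → Matrix (Fin 2) (Fin 2) ℚ
  | 0 => 1
  | n + 1 => prod₁ a b n * val₁ (a + n) b

/-- The values of `M_{(0,n)}`. -/
def prod₂ (a : ℚ) : ℕ → ℚ → Matrix (Fin 2) (Fin 2) ℚ
  | 0, _ => 1
  | n + 1, b => val₂ a b * prod₂ a n (b + 1)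

lemma matEval_field_fst {a : ℚ} (ha : 0 < a) (b : ℚ) (n : ℕ) :
    MatRegularAt (field.mat (n • ![1, 0])).val ![a, b] ∧
      matEval (field.mat (n • ![1, 0])).val ![a, b] = prod₁ a b n := by
  induction n with
  | zero =>
    rw [zero_smul, mat_zero, Units.val_one]
    exact matRegularAt_one _
  | succ n ih =>
    have hp : (fun i => (![a, b] : Fin 2 → ℚ) i + (((n • ![1, 0] : Fin 2 → ℤ) i : ℤ) : ℚ)) =
        ![a + n, b] := by
      ext i
      fin_cases i <;> simp
    have h1 := matEval_M₁ (x := ![a + n, b]) (by simp; positivity)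
    have h2 := matRegularAt_shift (A := M₁) (v := n • ![1, 0]) (x := ![a, b]) (by rw [hp]; exact h1.1)
    rw [succ_nsmul, cocycle_val, field_fst]
    have h3 := matRegularAt_mul ih.1 h2.1
    refine ⟨h3.1, ?_⟩
    rw [h3.2, ih.2, h2.2, hp, h1.2]
    rfl

/-- Here the new factor is split off on the left, since the last column of this product is studied
later. In the other direction it is appended on the right, to follow row vectors. -/
lemma matEval_field_snd (a : ℚ) {b : ℚ} (hb : 0 < b) (n : ℕ) :
    MatRegularAt (field.mat (n • ![0, 1])).val ![a, b] ∧
      matEval (field.mat (n • ![0, 1])).val ![a, b] = prod₂ a n b := by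
  induction n generalizing b with
  | zero =>
    rw [zero_smul, mat_zero, Units.val_one]
    exact matRegularAt_one _
  | succ n ih =>
    have hp : (fun i => (![a, b] : Fin 2 → ℚ) i + (((![0, 1] : Fin 2 → ℤ) i : ℤ) : ℚ)) =
        ![a, b + 1] := by
      ext i
      fin_cases i <;> simp
    have h1 := matEval_M₂ (x := ![a, b]) (by simpa using hb.ne')
    have h0 := ih (b := b + 1) (by positivity)
    have h2 := matRegularAt_shift (A := (field.mat (n • ![0, 1])).val) (v := ![0, 1]) (x := ![a, b])
      (by rw [hp]; exact h0.1)
    rw [succ_nsmul', cocycle_val, field_snd]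
    have h3 := matRegularAt_mul h1.1 h2.1
    refine ⟨h3.1, ?_⟩
    rw [h3.2, h1.2, h2.2, hp, h0.2]
    rfl

/-- Path independence: the diagonal is replaced by a horizontal leg at `x₂ = 1` and a vertical leg
at `x₁ = n + 1`. -/
lemma matEval_field_diag (n : ℕ) :
    MatRegularAt (field.mat (n • ![1, 1])).val ![1, 1] ∧
      matEval (field.mat (n • ![1, 1])).val ![1, 1] = prod₁ 1 1 n * prod₂ (1 + n) n 1 := by
  have hv : (n • ![1, 1] : Fin 2 → ℤ) = n • ![1, 0] + n • ![0, 1] := by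
    ext i
    fin_cases i <;> simp
  have hp : (fun i => (![1, 1] : Fin 2 → ℚ) i + (((n • ![1, 0] : Fin 2 → ℤ) i : ℤ) : ℚ)) =
      ![1 + (n : ℚ), 1] := by
    ext i
    fin_cases i <;> simp
  have h1 := matEval_field_fst one_pos 1 n
  have h0 := matEval_field_snd (1 + n) one_pos n
  have h2 := matRegularAt_shift (A := (field.mat (n • ![0, 1])).val) (v := n • ![1, 0])
    (x := ![1, 1]) (by rw [hp]; exact h0.1)
  rw [hv, cocycle_val]
  have h3 := matRegularAt_mul h1.1 h2.1
  refine ⟨h3.1, ?_⟩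
  rw [h3.2, h1.2, h2.2, hp, h0.2]

lemma matEval_field_one_one {a b : ℚ} (ha : a ≠ 0) (hb : b ≠ 0) :
    MatRegularAt (field.mat ![1, 1]).val ![a, b] ∧
      matEval (field.mat ![1, 1]).val ![a, b] = val₁ a b * val₂ (a + 1) b := by
  have hv : (![1, 1] : Fin 2 → ℤ) = ![1, 0] + ![0, 1] := by
    ext i
    fin_cases i <;> simp
  have hp : (fun i => (![a, b] : Fin 2 → ℚ) i + (((![1, 0] : Fin 2 → ℤ) i : ℤ) : ℚ)) =
      ![a + 1, b] := by
    ext i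
    fin_cases i <;> simp
  have h1 := matEval_M₁ (x := ![a, b]) ha
  have h0 := matEval_M₂ (x := ![a + 1, b]) hb
  have h2 := matRegularAt_shift (A := M₂) (v := ![1, 0]) (x := ![a, b]) (by rw [hp]; exact h0.1)
  rw [hv, cocycle_val, field_fst, field_snd]
  have h3 := matRegularAt_mul h1.1 h2.1
  refine ⟨h3.1, ?_⟩
  rw [h3.2, h1.2, h2.2, hp, h0.2]
  rfl

/-! ### Apéry's recurrence -/

open Polynomial in
lemma apery_zero_eq : apery 0 = algebraMap ℚ[X] (RatFunc ℚ) ((X + 1) ^ 3) /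
    algebraMap ℚ[X] (RatFunc ℚ) ((X + 2) ^ 3) := by
  simp [apery, map_ofNat]

open Polynomial in
lemma apery_one_eq : apery 1 = algebraMap ℚ[X] (RatFunc ℚ)
    (-((2 * X + 3) * (17 * X ^ 2 + 51 * X + 39))) /
    algebraMap ℚ[X] (RatFunc ℚ) ((X + 2) ^ 3) := by
  simp [apery, map_ofNat, neg_div]

lemma ratEval_apery_zero {t : ℚ} (ht : t + 2 ≠ 0) :
    ratEval t (apery 0) = (t + 1) ^ 3 / (t + 2) ^ 3 := by
  rw [apery_zero_eq, ratEval_div] <;> simp [ht]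

lemma ratEval_apery_one {t : ℚ} (ht : t + 2 ≠ 0) :
    ratEval t (apery 1) = -((2 * t + 3) * (17 * t ^ 2 + 51 * t + 39)) / (t + 2) ^ 3 := by
  rw [apery_one_eq, ratEval_div] <;> simp [ht]

lemma coeffsDefined_apery : CoeffsDefined apery := by
  intro i n
  have hn : (n : ℚ) + 2 ≠ 0 := by positivity
  fin_cases i
  · change (apery 0).denom.eval (n : ℚ) ≠ 0
    rw [apery_zero_eq]
    exact denom_div_eval_ne_zero (by simpa using hn)
  · change (apery 1).denom.eval (n : ℚ) ≠ 0
    rw [apery_one_eq]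
    exact denom_div_eval_ne_zero (by simpa using hn)

lemma companionAt_apery {t : ℚ} (ht : t + 2 ≠ 0) : companionAt apery t =
    !![0, -((t + 1) ^ 3 / (t + 2) ^ 3);
      1, (2 * t + 3) * (17 * t ^ 2 + 51 * t + 39) / (t + 2) ^ 3] := by
  have h0 := ratEval_apery_zero ht
  have h1 := ratEval_apery_one ht
  ext i j
  fin_cases i <;> fin_cases j <;> simp [companionAt, lastIdx, h0, h1, neg_div]

lemma companion_identity {t : ℚ} (h1 : t + 1 ≠ 0) (h2 : t + 2 ≠ 0) :
    val₁ (t + 1) (t + 1) * val₂ (t + 2) (t + 1) * valA (t + 2) (t + 2) =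
      valA (t + 1) (t + 1) * companionAt apery t := by
  rw [companionAt_apery h2, val₁, val₂, valA, valA, Matrix.mul_fin_two, Matrix.mul_fin_two,
    Matrix.mul_fin_two]
  ext i j
  fin_cases i <;> fin_cases j <;> simp <;> field_simp <;> ring

lemma isCompanionTransform_field : IsCompanionTransform field ![1, 1] ![1, 1] AUnit apery where
  field_regular n := (matEval_field_diag n).1
  regular := (matEval_A (x := ![1, 1]) one_ne_zero one_ne_zero).1
  inv_regular := MatRegularAt.matRegularOnLine (t := 0) (by
    rw [linePoint_zero]
    exact matRegularAt_AInv)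
  coeffs_defined := coeffsDefined_apery
  companion_eq := by
    have hp : ∀ t : ℚ, linePoint ![1, 1] ![1, 1] t = ![t + 1, t + 1] := fun t => by
      ext i
      fin_cases i <;> simp [linePoint, add_comm]
    have hp' : ∀ t : ℚ, linePoint (fun i => (![1, 1] : Fin 2 → ℚ) i +
        (((![1, 1] : Fin 2 → ℤ) i : ℤ) : ℚ)) ![1, 1] t = ![t + 2, t + 2] := fun t => by
      ext i
      fin_cases i <;> simp [linePoint] <;> ring
    have hA : MatRegularOnLine AUnit.val ![1, 1] ![1, 1] :=
      MatRegularAt.matRegularOnLine (t := 0) (by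
        rw [linePoint_zero]
        exact (matEval_A (x := ![1, 1]) one_ne_zero one_ne_zero).1)
    have hA' : MatRegularOnLine AUnit.val (fun i => (![1, 1] : Fin 2 → ℚ) i +
        (((![1, 1] : Fin 2 → ℤ) i : ℤ) : ℚ)) ![1, 1] :=
      MatRegularAt.matRegularOnLine (t := 0) (by
        rw [hp']
        exact (matEval_A (x := ![0 + 2, 0 + 2]) (by simp) (by simp)).1)
    have hI : MatRegularOnLine (AUnit⁻¹).val ![1, 1] ![1, 1] :=
      MatRegularAt.matRegularOnLine (t := 0) (by
        rw [linePoint_zero]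
        exact matRegularAt_AInv)
    have hM : MatRegularOnLine (field.mat ![1, 1]).val ![1, 1] ![1, 1] :=
      MatRegularAt.matRegularOnLine (t := 0) (by
        rw [linePoint_zero]
        exact (matEval_field_one_one one_ne_zero one_ne_zero).1)
    -- An identity in `ℚ(n)` follows from its values at all but finitely many `t`, where it reduces
    -- to the explicit `companion_identity`.
    refine matrix_eq_of_eventually ?_
    rw [trajectory]
    have hne : ∀ c : ℚ, ∀ᶠ t : ℚ in cofinite, t + c ≠ 0 := fun c => by
      filter_upwards [eventually_cofinite_ne (-c)] with t ht h
      exact ht (eq_neg_of_add_eq_zero_left h)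
    filter_upwards [hA.eventually, hA'.eventually, hI.eventually, hM.eventually,
      eventually_companion_map apery, hne 1, hne 2,
      eventually_ratEval_matrix_mul (matOnLine (AUnit⁻¹).val ![1, 1] ![1, 1] *
        matOnLine (field.mat ![1, 1]).val ![1, 1] ![1, 1])
        (matOnLine AUnit.val (fun i => (![1, 1] : Fin 2 → ℚ) i +
          (((![1, 1] : Fin 2 → ℤ) i : ℤ) : ℚ)) ![1, 1]),
      eventually_ratEval_matrix_mul (matOnLine (AUnit⁻¹).val ![1, 1] ![1, 1])
        (matOnLine (field.mat ![1, 1]).val ![1, 1] ![1, 1])]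
      with t h1 h2 h3 h4 h5 h6 h7 h8 h9
    rw [h8, h9, h5, h2.2, h3.2, h4.2, hp, hp']
    rw [hp] at h1 h3
    have hinv : matEval (AUnit⁻¹).val ![t + 1, t + 1] * valA (t + 1) (t + 1) = 1 := by
      have := (matRegularAt_mul h3.1 h1.1).2
      rw [← Units.val_mul, inv_mul_cancel, Units.val_one, (matRegularAt_one _).2] at this
      rw [this]
      congr 1
      exact (matEval_A (x := ![t + 1, t + 1]) h6 h6).2.symm
    have hAv : matEval AUnit.val ![t + 2, t + 2] = valA (t + 2) (t + 2) :=
      (matEval_A (x := ![t + 2, t + 2]) h7 h7).2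
    rw [hAv, (matEval_field_one_one h6 h6).2, mul_assoc,
      show t + 1 + 1 = t + 2 by ring, companion_identity h6 h7, ← mul_assoc, hinv, one_mul]

lemma initial_values :
    (matEval AUnit.val ![1, 1]).transpose.mulVec ![0, 1] = ![0, 6] ∧
    (matEval AUnit.val ![1, 1]).transpose.mulVec ![1, 1] = ![1, 5] := by
  have h : matEval AUnit.val ![1, 1] = valA 1 1 :=
    (matEval_A (x := ![1, 1]) one_ne_zero one_ne_zero).2
  rw [h]
  constructor <;> ext i <;> fin_cases i <;>
    norm_num [valA, Matrix.mulVec, dotProduct, Fin.sum_univ_two]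

end Zeta3

/-! ### Characteristic roots and irreducibility of Apéry's recurrence -/

open Polynomial in
-- Comparing degrees, a finite limit is zero or the quotient of the leading coefficients.
lemma exists_ratCast_of_tendsto {f : RatFunc ℚ} {l : ℝ}
    (h : Tendsto (fun n : ℕ => ((RatFunc.atNat f n : ℚ) : ℝ)) atTop (𝓝 l)) : ∃ q : ℚ, l = q := by
  set P : ℝ[X] := f.num.map (algebraMap ℚ ℝ) with hP
  set Q : ℝ[X] := f.denom.map (algebraMap ℚ ℝ) with hQ
  have hQ0 : Q ≠ 0 := (Polynomial.map_ne_zero_iff (algebraMap ℚ ℝ).injective).2 f.denom_ne_zero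
  have hev : ∀ n : ℕ, ((RatFunc.atNat f n : ℚ) : ℝ) = P.eval (n : ℝ) / Q.eval (n : ℝ) := fun n => by
    have h1 : ∀ p : ℚ[X], (p.map (algebraMap ℚ ℝ)).eval (n : ℝ) = ((p.eval (n : ℚ) : ℚ) : ℝ) := by
      intro p
      have := Polynomial.eval_map_apply (p := p) (algebraMap ℚ ℝ) (n : ℚ)
      simpa using this
    rw [atNat_eq_ratEval, ratEval_eq, h1, h1, Rat.cast_div]
  simp only [hev] at h
  rcases lt_trichotomy P.degree Q.degree with hd | hd | hd
  · refine ⟨0, tendsto_nhds_unique h ?_⟩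
    rw [Rat.cast_zero]
    exact (Polynomial.div_tendsto_atTop_zero_of_degree_lt P Q hd).comp tendsto_natCast_atTop_atTop
  · refine ⟨f.num.leadingCoeff / f.denom.leadingCoeff, tendsto_nhds_unique h ?_⟩
    have h1 : P.leadingCoeff = (f.num.leadingCoeff : ℝ) := by simp [hP]
    have h2 : Q.leadingCoeff = (f.denom.leadingCoeff : ℝ) := by simp [hQ]
    rw [Rat.cast_div, ← h1, ← h2]
    exact (Polynomial.div_tendsto_atTop_leadingCoeff_div_of_degree_eq P Q hd).comp
      tendsto_natCast_atTop_atTop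
  · exact absurd h.abs (not_tendsto_nhds_of_tendsto_atTop
      ((Polynomial.abs_div_tendsto_atTop_atTop_of_degree_gt P Q hd hQ0).comp
        tendsto_natCast_atTop_atTop) _)

lemma eq_zero_of_eventually_atNat {f : RatFunc ℚ} (h : ∀ᶠ n : ℕ in atTop, RatFunc.atNat f n = 0) :
    f = 0 := by
  by_contra hf
  obtain ⟨n, h1, h2⟩ :=
    (h.and (tendsto_natCast_cofinite.eventually (eventually_ratEval_ne_zero hf))).exists
  exact h2 h1

lemma eventually_atNat_div (f g : RatFunc ℚ) (hg : g ≠ 0) : ∀ᶠ n : ℕ in atTop,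
    RatFunc.atNat (f / g) n = RatFunc.atNat f n / RatFunc.atNat g n := by
  filter_upwards [tendsto_natCast_cofinite.eventually (eventually_ratEval_ne_zero hg),
    tendsto_natCast_cofinite.eventually (eventually_ratEval_mul (f / g) g)] with n h1 h2
  rw [div_mul_cancel₀ f hg] at h2
  exact (eq_div_iff h1).2 h2.symm

namespace Zeta3

/-- The characteristic roots of Apéry's recurrence. -/
def root : Fin 2 → ℝ := ![17 + 12 * √2, 17 - 12 * √2]

lemma sqrt_two_bounds : 1.4 < √2 ∧ √2 < 17 / 12 :=
  ⟨Real.lt_sqrt_of_sq_lt (by norm_num), (Real.sqrt_lt' (by norm_num)).2 (by norm_num)⟩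

lemma root_pos (i : Fin 2) : 0 < root i := by
  have := sqrt_two_bounds
  fin_cases i <;> simp [root] <;> linarith

lemma irrational_root (i : Fin 2) : Irrational (root i) := by
  fin_cases i
  · have h := (irrational_sqrt_two.ratCast_mul (q := 12) (by norm_num)).ratCast_add 17
    simpa [root] using h
  · have h := (irrational_sqrt_two.ratCast_mul (q := 12) (by norm_num)).ratCast_sub 17
    simpa [root] using h

lemma atNat_apery_zero (n : ℕ) : RatFunc.atNat (apery 0) n = ((n : ℚ) + 1) ^ 3 / (n + 2) ^ 3 :=
  ratEval_apery_zero (by positivity)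

lemma atNat_apery_one (n : ℕ) : RatFunc.atNat (apery 1) n =
    -((2 * (n : ℚ) + 3) * (17 * n ^ 2 + 51 * n + 39)) / (n + 2) ^ 3 :=
  ratEval_apery_one (by positivity)

lemma tendsto_apery (i : Fin 2) :
    Tendsto (fun n : ℕ => ((RatFunc.atNat (apery i) n : ℚ) : ℝ)) atTop (𝓝 (![1, -34] i)) := by
  have h0 : Tendsto (fun n : ℕ => 1 / ((n : ℝ) + 2)) atTop (𝓝 0) :=
    tendsto_const_nhds.div_atTop (tendsto_natCast_atTop_atTop.atTop_add tendsto_const_nhds)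
  have hf : ∀ g : ℝ → ℝ, Continuous g → Tendsto (fun n : ℕ => g (1 / ((n : ℝ) + 2))) atTop (𝓝 (g 0)) :=
    fun g hg => (hg.tendsto 0).comp h0
  fin_cases i
  · have h1 := hf (fun s => (1 - s) ^ 3) (by fun_prop)
    simp only [sub_zero, one_pow] at h1
    refine h1.congr fun n => ?_
    have : (n : ℝ) + 2 ≠ 0 := by positivity
    rw [show apery ((fun i => i) ⟨0, by decide⟩) = apery 0 from rfl, atNat_apery_zero]
    push_cast
    field_simp
    ring
  -- With `s = 1/(n+2)` one has `2n+3 = (n+2)(2-s)` and `17n²+51n+39 = (n+2)²(17-17s+5s²)`.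
  · have h1 := hf (fun s => -((2 - s) * (17 - 17 * s + 5 * s ^ 2))) (by fun_prop)
    rw [show -((2 - (0 : ℝ)) * (17 - 17 * 0 + 5 * 0 ^ 2)) = -34 by norm_num] at h1
    refine h1.congr fun n => ?_
    have : (n : ℝ) + 2 ≠ 0 := by positivity
    rw [show apery ((fun i => i) ⟨1, by decide⟩) = apery 1 from rfl, atNat_apery_one]
    push_cast
    field_simp
    ring

open Polynomial in
lemma characteristic_factorization :
    X ^ 2 + ∑ i : Fin 2, C ((![1, -34] i : ℝ) : ℂ) * X ^ (i : ℕ) =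
      ∏ i : Fin 2, (X - C ((root i : ℝ) : ℂ)) := by
  have h1 : (C ((root 0 : ℝ) : ℂ) + C ((root 1 : ℝ) : ℂ) : ℂ[X]) = C 34 := by
    rw [← C_add, ← Complex.ofReal_add]
    norm_num [root]
  have h2 : (C ((root 0 : ℝ) : ℂ) * C ((root 1 : ℝ) : ℂ) : ℂ[X]) = C 1 := by
    rw [← C_mul, ← Complex.ofReal_mul]
    have : root 0 * root 1 = 1 := by
      have := Real.mul_self_sqrt (zero_le_two (α := ℝ))
      simp only [root, Matrix.cons_val_zero, Matrix.cons_val_one]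
      linear_combination (-144) * this
    rw [this, Complex.ofReal_one]
  rw [Fin.sum_univ_two, Fin.prod_univ_two]
  have h3 : (C ((![1, -34] (0 : Fin 2) : ℝ) : ℂ) : ℂ[X]) = C 1 := by simp
  have h4 : (C ((![1, -34] (1 : Fin 2) : ℝ) : ℂ) : ℂ[X]) = -C 34 := by
    rw [← C_neg]
    simp
  rw [h3, h4]
  simp only [Fin.val_zero, Fin.val_one, pow_zero, pow_one, mul_one]
  linear_combination (-1 : ℂ[X]) * h2 + X * h1

lemma strictAnti_root : StrictAnti fun i => ‖((root i : ℝ) : ℂ)‖ := by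
  have h : ∀ i, ‖((root i : ℝ) : ℂ)‖ = root i := fun i => by
    rw [Complex.norm_real, Real.norm_of_nonneg (root_pos i).le]
  simp only [h]
  intro i j hij
  have := sqrt_two_bounds
  fin_cases i <;> fin_cases j <;> simp [root] at hij ⊢
  linarith

lemma isPoincarePerron_apery : IsPoincarePerron apery :=
  ⟨![1, -34], fun i => (root i : ℂ), tendsto_apery, characteristic_factorization, strictAnti_root⟩

lemma exists_perronRecurrence_apery : ∃ R : PerronRecurrence 2,
    R.coeff = (fun i => ratSeq (apery i)) ∧ R.root = fun i => (root i : ℂ) :=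
  exists_perronRecurrence_of_roots tendsto_apery characteristic_factorization strictAnti_root

lemma exists_tendsto_ratio {y : ℕ → ℝ} (hy : ∀ᶠ n in atTop, RecurrenceAt apery y n)
    (h0 : ¬ ∀ᶠ n in atTop, y n = 0) : ∃ i, (∀ᶠ n in atTop, y n ≠ 0) ∧
      Tendsto (fun n => y (n + 1) / y n) atTop (𝓝 (root i)) := by
  obtain ⟨R, hR, hl⟩ := exists_perronRecurrence_apery
  have h1 : R.Solves fun n => (y n : ℂ) :=
    solves_of_recurrenceAt hR (hy.mono fun n hn => hn.ofReal)
  obtain ⟨i, h2, h3⟩ := h1.exists_root (by simpa using h0)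
  refine ⟨i, by simpa using h2, ?_⟩
  have h4 := tendsto_of_decay_sub h3
  rw [hl] at h4
  have h5 := (Complex.continuous_re.tendsto _).comp h4
  refine h5.congr fun n => ?_
  simp only [Function.comp_apply]
  rw [← Complex.ofReal_div, Complex.ofReal_re]

/-- A relation `b₀(n) y(n) + b₁(n) y(n+1) = 0` with `b₁ ≠ 0` makes `y(n+1)/y(n)` eventually a
rational function of `n`, with rational limit; both characteristic roots are irrational. Then `b₀ =
0` since `y` is eventually nonzero. -/
lemma isIrreducible_apery : IsIrreducibleRecurrence apery := by
  intro y hy h0 b hb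
  obtain ⟨i, hy0, hlim⟩ := exists_tendsto_ratio (by simpa [RecurrenceAt] using hy) h0
  simp only [Fin.sum_univ_two, Fin.val_zero, Fin.val_one, add_zero] at hb
  have h1 : b 1 = 0 := by
    by_contra h1
    have h2 : Tendsto (fun n : ℕ => ((RatFunc.atNat (-b 0 / b 1) n : ℚ) : ℝ)) atTop
        (𝓝 (root i)) := by
      refine hlim.congr' ?_
      filter_upwards [hb, hy0, eventually_atNat_div (-b 0) (b 1) h1,
        tendsto_natCast_cofinite.eventually (eventually_ratEval_neg (b 0)),
        tendsto_natCast_cofinite.eventually (eventually_ratEval_ne_zero h1)] with n h2 h3 h4 h5 h6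
      rw [← atNat_eq_ratEval] at h6
      rw [← atNat_eq_ratEval, ← atNat_eq_ratEval] at h5
      have h7 : ((RatFunc.atNat (b 1) n : ℚ) : ℝ) ≠ 0 := by exact_mod_cast h6
      rw [h4, h5, Rat.cast_div, Rat.cast_neg, div_eq_div_iff h3 h7]
      linarith
    obtain ⟨q, hq⟩ := exists_ratCast_of_tendsto h2
    exact irrational_root i ⟨q, hq.symm⟩
  have h2 : b 0 = 0 := eq_zero_of_eventually_atNat (by
    filter_upwards [hb, hy0] with n h2 h3
    rw [h1, atNat_eq_ratEval (0 : RatFunc ℚ), ratEval_zero, Rat.cast_zero, zero_mul, add_zero] at h2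
    exact_mod_cast (mul_eq_zero.1 h2).resolve_right h3)
  ext i
  fin_cases i
  exacts [h2, h1]

end Zeta3

namespace Zeta3

open MvRat CMF

/-! ### The limit of the ratio -/

/-- The partial sums of `ζ(3)`. -/
def partialSum (n : ℕ) : ℚ := ∑ k ∈ Finset.range n, 1 / ((k : ℚ) + 1) ^ 3

lemma partialSum_succ (n : ℕ) : partialSum (n + 1) = partialSum n + 1 / ((n : ℚ) + 1) ^ 3 :=
  Finset.sum_range_succ _ _

lemma tendsto_partialSum :
    Tendsto (fun n => ((partialSum n : ℚ) : ℝ)) atTop (𝓝 (riemannZeta 3).re) := by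
  have h1 : (riemannZeta 3).re = ∑' n : ℕ, 1 / (n : ℝ) ^ 3 := by
    have h := zeta_nat_eq_tsum_of_gt_one (k := 3) (by norm_num)
    rw [Nat.cast_ofNat] at h
    rw [h, ← Complex.ofReal_re (∑' n : ℕ, 1 / (n : ℝ) ^ 3), Complex.ofReal_tsum]
    simp
  rw [h1]
  have h2 : Summable fun n : ℕ => 1 / (n : ℝ) ^ 3 := Real.summable_one_div_nat_pow.2 (by norm_num)
  refine ((tendsto_add_atTop_iff_nat 1).2 h2.hasSum.tendsto_sum_nat).congr fun n => ?_
  rw [Finset.sum_range_succ']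
  simp [partialSum]

/-- On the line `x₂ = 1` the middle term of the last entry of `M₁` vanishes. The remaining
recurrence, divided by cubes, adds up the terms `1/k³`. -/
lemma vecMul_prod₁_fst (n : ℕ) : Matrix.vecMul ![0, 1] (prod₁ 1 1 n) =
    ![((n : ℚ) + 1) ^ 3 * partialSum n, ((n : ℚ) + 1) ^ 3 * partialSum (n + 1)] := by
  induction n with
  | zero => simp [prod₁, partialSum]
  | succ n ih =>
    have h : (n : ℚ) + 1 ≠ 0 := by positivity
    have h' : (n : ℚ) + 1 + 1 ≠ 0 := by positivity
    rw [prod₁, ← Matrix.vecMul_vecMul, ih, partialSum_succ (n + 1), partialSum_succ n]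
    ext i
    fin_cases i
    · simp [val₁, Matrix.vecMul, dotProduct, Fin.sum_univ_two, add_comm (1 : ℚ)]
      field_simp
    · simp [val₁, Matrix.vecMul, dotProduct, Fin.sum_univ_two, add_comm (1 : ℚ)]
      field_simp
      ring

lemma vecMul_prod₁_one (n : ℕ) : Matrix.vecMul ![1, 1] (prod₁ 1 1 n) =
    ![((n : ℚ) + 1) ^ 3, ((n : ℚ) + 1) ^ 3] := by
  induction n with
  | zero => simp [prod₁]
  | succ n ih =>
    have h : (n : ℚ) + 1 ≠ 0 := by positivity
    rw [prod₁, ← Matrix.vecMul_vecMul, ih]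
    ext i
    fin_cases i
    · simp [val₁, Matrix.vecMul, dotProduct, Fin.sum_univ_two, add_comm (1 : ℚ)]
      field_simp
    · simp [val₁, Matrix.vecMul, dotProduct, Fin.sum_univ_two, add_comm (1 : ℚ)]
      field_simp
      ring

lemma prod₂_succ_col (a b : ℚ) (hb : b ≠ 0) (m : ℕ) :
    b ^ 3 * prod₂ a (m + 1) b 1 1 = a ^ 3 * (prod₂ a m (b + 1) 0 1 + prod₂ a m (b + 1) 1 1) +
      (2 * a ^ 2 * b + 2 * a * b ^ 2 + b ^ 3) * prod₂ a m (b + 1) 1 1 ∧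
    b ^ 3 * prod₂ a (m + 1) b 0 1 = -a ^ 3 * (prod₂ a m (b + 1) 0 1 + prod₂ a m (b + 1) 1 1) +
      (2 * a ^ 2 * b - 2 * a * b ^ 2 + b ^ 3) * prod₂ a m (b + 1) 0 1 := by
  simp only [prod₂, Matrix.mul_apply, Fin.sum_univ_two, val₂, Matrix.of_apply, Matrix.cons_val_zero,
    Matrix.cons_val_one]
  constructor
  · field_simp
    ring
  · field_simp
    ring

/-- The sign pattern of the last column is preserved when a factor is added on the left. The
restriction on `b` ensures `b ≤ a` at every step, which makes `2a²b - 2ab² + b³` nonnegative. -/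
lemma prod₂_col_signs {a : ℚ} (m : ℕ) {b : ℚ} (hb : 0 < b) (hbm : b + m ≤ a + 1) :
    0 < prod₂ a m b 1 1 ∧ prod₂ a m b 0 1 ≤ 0 ∧ 0 ≤ prod₂ a m b 0 1 + prod₂ a m b 1 1 := by
  induction m generalizing b with
  | zero => simp [prod₂]
  | succ m ih =>
    obtain ⟨h1, h2, h3⟩ := ih (b := b + 1) (by positivity) (by push_cast at hbm; linarith)
    obtain ⟨h4, h5⟩ := prod₂_succ_col a b hb.ne' m
    have hba : b ≤ a := by
      push_cast at hbm
      have : (0 : ℚ) ≤ m := Nat.cast_nonneg m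
      linarith
    have ha : 0 < a := hb.trans_le hba
    have hb3 : 0 < b ^ 3 := by positivity
    have hq : 0 ≤ 2 * a ^ 2 * b - 2 * a * b ^ 2 + b ^ 3 := by
      have : 0 ≤ 2 * a * b * (a - b) := by
        have := sub_nonneg.2 hba
        positivity
      nlinarith
    set c₁ := prod₂ a m (b + 1) 0 1
    set c₂ := prod₂ a m (b + 1) 1 1
    refine ⟨(mul_pos_iff_of_pos_left hb3).1 ?_, ?_, ?_⟩
    · rw [h4]
      have : 0 ≤ a ^ 3 * (c₁ + c₂) := mul_nonneg (by positivity) h3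
      have : 0 < (2 * a ^ 2 * b + 2 * a * b ^ 2 + b ^ 3) * c₂ := by positivity
      linarith
    · refine nonpos_of_mul_nonpos_right (a := b ^ 3) ?_ hb3
      rw [h5]
      have : 0 ≤ a ^ 3 * (c₁ + c₂) := mul_nonneg (by positivity) h3
      have := mul_nonpos_of_nonneg_of_nonpos hq h2
      linarith
    · refine nonneg_of_mul_nonneg_right (a := b ^ 3) ?_ hb3
      have h6 : 0 ≤ (2 * a ^ 2 * b - 2 * a * b ^ 2 + b ^ 3) * (c₁ + c₂) := mul_nonneg hq h3
      have h7 : 0 ≤ 4 * a * b ^ 2 * c₂ := by positivity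
      linarith

/-- The step to `b = 1` is used once more, now quantitatively: the term `4a c₂` keeps the sum of the
two entries away from zero relative to the lower one. -/
lemma prod₂_col_bound {n : ℕ} (hn : 0 < n) :
    0 < prod₂ (1 + n) n 1 0 1 + prod₂ (1 + n) n 1 1 1 ∧ 0 < prod₂ (1 + n) n 1 1 1 ∧
      prod₂ (1 + n) n 1 1 1 ≤ 3 * ((n : ℚ) + 1) * (prod₂ (1 + n) n 1 0 1 + prod₂ (1 + n) n 1 1 1) := by
  obtain ⟨m, rfl⟩ := Nat.exists_eq_succ_of_ne_zero hn.ne'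
  obtain ⟨h1, h2, h3⟩ := prod₂_col_signs (a := 1 + (m + 1 : ℕ)) m (b := 1 + 1) (by norm_num)
    (by push_cast; linarith)
  obtain ⟨h4, h5⟩ := prod₂_succ_col (1 + (m + 1 : ℕ)) 1 one_ne_zero m
  have ha : (1 : ℚ) ≤ 1 + (m + 1 : ℕ) := by
    have : (0 : ℚ) ≤ (m + 1 : ℕ) := Nat.cast_nonneg _
    linarith
  rw [add_comm (((m + 1 : ℕ) : ℚ)) 1]
  set a : ℚ := 1 + (m + 1 : ℕ)
  set c₁ := prod₂ a m (1 + 1) 0 1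
  set c₂ := prod₂ a m (1 + 1) 1 1
  simp only [one_pow, one_mul, mul_one] at h4 h5
  have h6 : prod₂ a (m + 1) 1 0 1 + prod₂ a (m + 1) 1 1 1 =
      (2 * a ^ 2 - 2 * a + 1) * (c₁ + c₂) + 4 * a * c₂ := by
    rw [h4, h5]
    ring
  have h7 : 0 ≤ (2 * a ^ 2 - 2 * a + 1) * (c₁ + c₂) := mul_nonneg (by nlinarith) h3
  have h8 : 0 < 4 * a * c₂ := by positivity
  refine ⟨by rw [h6]; linarith, ?_, ?_⟩
  · rw [h4]
    have : 0 ≤ a ^ 3 * (c₁ + c₂) := mul_nonneg (by positivity) h3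
    have : 0 < (2 * a ^ 2 + 2 * a + 1) * c₂ := by positivity
    linarith
  · rw [h6, h4]
    -- The claimed inequality is the sum of `h9` and `h10`, once the difference of its sides is
    -- written in terms of `c₁ + c₂` and `c₂`.
    have h9 : 0 ≤ (a * (5 * a ^ 2 - 6 * a + 3)) * (c₁ + c₂) :=
      mul_nonneg (mul_nonneg (by positivity) (by nlinarith [sq_nonneg (5 * a - 3)])) h3
    have h10 : 0 ≤ (10 * a ^ 2 - 2 * a - 1) * c₂ := mul_nonneg (by nlinarith) h1.le
    linarith

/-- With last column `(c₁, c₂)` of the vertical leg, the ratio is the weighted mean `(Sₙ c₁ + Sₙ₊₁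
c₂)/(c₁ + c₂)` of two partial sums, so it exceeds `Sₙ` by `c₂ / ((n+1)³ (c₁ + c₂))`. -/
lemma ratio_sub_partialSum {n : ℕ} (hn : 0 < n) :
    0 ≤ field.ratio ![1, 1] ![1, 1] ![0, 1] ![1, 1] n - partialSum n ∧
      field.ratio ![1, 1] ![1, 1] ![0, 1] ![1, 1] n - partialSum n ≤ 3 / ((n : ℚ) + 1) := by
  obtain ⟨h1, h2, h3⟩ := prod₂_col_bound hn
  have hN : (1 : ℚ) ≤ (n : ℚ) + 1 := by
    have : (0 : ℚ) ≤ n := Nat.cast_nonneg n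
    linarith
  have hcol : (prod₂ (1 + n) n 1).mulVec (lastVec ℚ 2) =
      ![prod₂ (1 + n) n 1 0 1, prod₂ (1 + n) n 1 1 1] := by
    rw [lastVec, Matrix.mulVec_single_one]
    ext i
    fin_cases i <;> rfl
  have key : field.ratio ![1, 1] ![1, 1] ![0, 1] ![1, 1] n - partialSum n =
      prod₂ (1 + n) n 1 1 1 / ((n + 1) ^ 3 *
        (prod₂ (1 + n) n 1 0 1 + prod₂ (1 + n) n 1 1 1)) := by
    rw [ratio, ratio₄, (matEval_field_diag n).2, ← Matrix.mulVec_mulVec, hcol,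
      Matrix.dotProduct_mulVec, Matrix.dotProduct_mulVec, vecMul_prod₁_fst, vecMul_prod₁_one,
      partialSum_succ]
    simp only [dotProduct, Fin.sum_univ_two, Matrix.cons_val_zero, Matrix.cons_val_one]
    set c₁ := prod₂ (1 + n) n 1 0 1
    set c₂ := prod₂ (1 + n) n 1 1 1
    rw [← mul_add]
    have h4 := h1.ne'
    have h5 : (n : ℚ) + 1 ≠ 0 := by positivity
    field_simp
    ring
  rw [key]
  refine ⟨by positivity, ?_⟩
  rw [div_le_div_iff₀ (by positivity) (by positivity)]
  calc _ ≤ 3 * ((n : ℚ) + 1) * (prod₂ (1 + n) n 1 0 1 + prod₂ (1 + n) n 1 1 1) * (n + 1) := by gcongr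
    _ = 3 * (((n : ℚ) + 1) ^ 2 * (prod₂ (1 + n) n 1 0 1 + prod₂ (1 + n) n 1 1 1)) := by ring
    _ ≤ _ := by (gcongr; norm_num)

lemma tendsto_ratio : Tendsto
    (fun n => ((field.ratio ![1, 1] ![1, 1] ![0, 1] ![1, 1] n : ℚ) : ℝ)) atTop
    (𝓝 (riemannZeta 3).re) := by
  have h1 : Tendsto (fun n : ℕ => 3 / ((n : ℝ) + 1)) atTop (𝓝 0) :=
    tendsto_const_nhds.div_atTop (tendsto_natCast_atTop_atTop.atTop_add tendsto_const_nhds)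
  have h2 : Tendsto (fun n => ((field.ratio ![1, 1] ![1, 1] ![0, 1] ![1, 1] n - partialSum n : ℚ) : ℝ))
      atTop (𝓝 0) := by
    refine tendsto_of_tendsto_of_tendsto_of_le_of_le' tendsto_const_nhds h1 ?_ ?_
    · filter_upwards [eventually_gt_atTop 0] with n hn
      exact_mod_cast (ratio_sub_partialSum hn).1
    · filter_upwards [eventually_gt_atTop 0] with n hn
      have h2 := (Rat.cast_le (K := ℝ)).2 (ratio_sub_partialSum hn).2
      push_cast at h2 ⊢
      exact h2
  have h3 := h2.add tendsto_partialSum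
  rw [zero_add] at h3
  exact h3.congr fun n => by push_cast; ring

end Zeta3

namespace Zeta3

open MvRat CMF

/-! ### The convergence rate -/

lemma isSolution_apery_iff {u : ℕ → ℚ} : IsSolution apery u ↔ ∀ n : ℕ,
    ((n : ℚ) + 2) ^ 3 * u (n + 2) =
      (2 * n + 3) * (17 * n ^ 2 + 51 * n + 39) * u (n + 1) - (n + 1) ^ 3 * u n := by
  refine forall_congr' fun n => ?_
  have h : (n : ℚ) + 2 ≠ 0 := by positivity
  rw [Fin.sum_univ_two, atNat_apery_zero, atNat_apery_one, Fin.val_zero, Fin.val_one, add_zero]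
  constructor
  · intro h1
    field_simp at h1
    linear_combination h1
  · intro h1
    field_simp
    linear_combination h1

lemma exists_solution_apery (a b : ℚ) : ∃ u, IsSolution apery u ∧ u 0 = a ∧ u 1 = b := by
  obtain ⟨u, h1, h2⟩ := exists_solution_from (a := apery) (K := ℚ) 0 ![a, b]
  refine ⟨u, fun n => by simpa [RecurrenceAt] using h1 n (Nat.zero_le n), ?_, ?_⟩
  · simpa using h2 0
  · simpa using h2 1

/-! ### Apéry's two solutions -/

section Pair

variable {u w : ℕ → ℚ} (hu : IsSolution apery u) (hw : IsSolution apery w) (hu0 : u 0 = 0)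
  (hu1 : u 1 = 6) (hw0 : w 0 = 1) (hw1 : w 1 = 5)

include hw hw0 hw1 in
-- Doubling is a crude bound, but it suffices to exclude the small root, which is less than `1`.
lemma growth (n : ℕ) : 1 ≤ w n ∧ 2 * w n ≤ w (n + 1) := by
  induction n with
  | zero => norm_num [hw0, hw1]
  | succ n ih =>
    have h1 : 1 ≤ w (n + 1) := by linarith
    refine ⟨h1, ?_⟩
    have h2 := isSolution_apery_iff.1 hw n
    have hn : (0 : ℚ) ≤ n := Nat.cast_nonneg n
    refine le_of_mul_le_mul_left (a := ((n : ℚ) + 2) ^ 3) ?_ (by positivity)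
    rw [h2]
    have h3 : ((n : ℚ) + 1) ^ 3 * (2 * w n) ≤ ((n : ℚ) + 1) ^ 3 * w (n + 1) :=
      mul_le_mul_of_nonneg_left ih.2 (by positivity)
    have h4 : 0 ≤ (2 * ((2 * (n : ℚ) + 3) * (17 * n ^ 2 + 51 * n + 39)) - (n + 1) ^ 3 -
        4 * (n + 2) ^ 3) * w (n + 1) := by
      refine mul_nonneg ?_ (by linarith)
      ring_nf
      positivity
    linarith

include hu hw hu0 hu1 hw0 hw1 in
-- The outer coefficients are consecutive cubes, so `(n+1)³` times the Casoratian is constant.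
lemma casoratian (n : ℕ) : u (n + 1) * w n - u n * w (n + 1) = 6 / ((n : ℚ) + 1) ^ 3 := by
  induction n with
  | zero => norm_num [hu0, hu1, hw0, hw1]
  | succ n ih =>
    have h1 := isSolution_apery_iff.1 hu n
    have h2 := isSolution_apery_iff.1 hw n
    have h3 : (n : ℚ) + 1 ≠ 0 := by positivity
    have h4 : (n : ℚ) + 2 ≠ 0 := by positivity
    rw [eq_div_iff (by positivity)] at ih ⊢
    push_cast
    rw [show (n : ℚ) + 1 + 1 = n + 2 by ring]
    linear_combination ih + w (n + 1) * h1 - u (n + 1) * h2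

include hu hw hu0 hu1 hw0 hw1

/-- Nested intervals: the increment of `u/w` is at most `6/(w(n) w(n+1))`, and `6/w` falls by at
least as much since `w(n+1) - w(n) ≥ w(n) ≥ 1`. This gives a bounded error form without knowledge of
the limit's value. -/
lemma quotient_step (n : ℕ) : u n / w n ≤ u (n + 1) / w (n + 1) ∧
    u (n + 1) / w (n + 1) + 6 / w (n + 1) ≤ u n / w n + 6 / w n := by
  obtain ⟨h1, h2⟩ := growth hw hw0 hw1 n
  have h3 : 0 < w n := by linarith
  have h4 : 0 < w (n + 1) := by linarith
  have h5 := casoratian hu hw hu0 hu1 hw0 hw1 n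
  have h6 : 0 ≤ 6 / ((n : ℚ) + 1) ^ 3 := by positivity
  have h7 : 6 / ((n : ℚ) + 1) ^ 3 ≤ 6 := by
    refine div_le_self (by norm_num) (one_le_pow₀ ?_)
    have : (0 : ℚ) ≤ n := Nat.cast_nonneg n
    linarith
  constructor
  · rw [div_le_div_iff₀ h3 h4]
    linarith
  · rw [← add_div, ← add_div, div_le_div_iff₀ h4 h3]
    linarith

lemma error_bounds {l : ℝ} (h : Tendsto (fun n => ((u n / w n : ℚ) : ℝ)) atTop (𝓝 l)) (n : ℕ) :
    |(u n : ℝ) - l * w n| ≤ 6 := by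
  have hm : Monotone fun n => u n / w n :=
    monotone_nat_of_le_succ fun n => (quotient_step hu hw hu0 hu1 hw0 hw1 n).1
  have ha : Antitone fun n => u n / w n + 6 / w n :=
    antitone_nat_of_succ_le fun n => (quotient_step hu hw hu0 hu1 hw0 hw1 n).2
  have hpos : ∀ n, 0 < w n := fun n => by linarith [(growth hw hw0 hw1 n).1]
  have h1 : ((u n / w n : ℚ) : ℝ) ≤ l := by
    refine Monotone.ge_of_tendsto (f := fun n => ((u n / w n : ℚ) : ℝ)) (fun i j hij => ?_) h n
    exact Rat.cast_le.2 (hm hij)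
  have h2 : l ≤ ((u n / w n + 6 / w n : ℚ) : ℝ) := by
    refine le_of_tendsto h ?_
    filter_upwards [eventually_ge_atTop n] with m hnm
    refine Rat.cast_le.2 (le_trans ?_ (ha hnm))
    have : 0 ≤ 6 / w m := div_nonneg (by norm_num) (hpos m).le
    linarith
  have h3 : (0 : ℝ) < w n := by exact_mod_cast hpos n
  push_cast at h1 h2
  rw [div_le_iff₀ h3] at h1
  rw [← add_div, le_div_iff₀ h3] at h2
  rw [abs_le]
  constructor <;> linarith

lemma error_not_eventually_zero (l : ℝ) :
    ¬ ∀ᶠ n in atTop, (u n : ℝ) - l * w n = 0 := by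
  intro h
  obtain ⟨n, h1, h2⟩ := (h.and ((tendsto_add_atTop_nat 1).eventually h)).exists
  have h3 : ((u (n + 1) * w n - u n * w (n + 1) : ℚ) : ℝ) = ((6 / ((n : ℚ) + 1) ^ 3 : ℚ) : ℝ) :=
    congrArg _ (casoratian hu hw hu0 hu1 hw0 hw1 n)
  have h4 : (0 : ℝ) < 6 / ((n : ℝ) + 1) ^ 3 := by positivity
  push_cast at h3
  rw [← h3] at h4
  refine h4.ne' ?_
  linear_combination (w n : ℝ) * h2 - (w (n + 1) : ℝ) * h1

omit hu hu0 hu1 in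
lemma tendsto_denominator_ratio :
    Tendsto (fun n => (w (n + 1) : ℝ) / w n) atTop (𝓝 (root 0)) := by
  have hg : ∀ n, (1 : ℝ) ≤ w n ∧ 2 * (w n : ℝ) ≤ w (n + 1) := fun n => by
    exact_mod_cast growth hw hw0 hw1 n
  obtain ⟨i, _, h1⟩ := exists_tendsto_ratio (y := fun n => (w n : ℝ))
    (Eventually.of_forall fun n => hw.recurrenceAt n) fun h => by
      obtain ⟨n, hn⟩ := h.exists
      linarith [(hg n).1]
  have h2 : 2 ≤ root i := ge_of_tendsto' h1 fun n => by
    rw [le_div_iff₀ (by linarith [(hg n).1])]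
    exact (hg n).2
  fin_cases i
  · exact h1
  · have := sqrt_two_bounds
    simp [root] at h2
    linarith

/-- The error form is not eventually zero, by the Casoratian, so it follows one of the roots.
Following the large root would make it unbounded, against the bound `6`. -/
lemma tendsto_error_ratio {l : ℝ}
    (h : Tendsto (fun n => ((u n / w n : ℚ) : ℝ)) atTop (𝓝 l)) :
    (∀ᶠ n in atTop, (u n : ℝ) - l * w n ≠ 0) ∧
    Tendsto (fun n => ((u (n + 1) : ℝ) - l * w (n + 1)) / (u n - l * w n)) atTop (𝓝 (root 1)) := by
  obtain ⟨i, h0, h1⟩ := exists_tendsto_ratio (y := fun n => (u n : ℝ) - l * w n)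
    (Eventually.of_forall fun n => (hu.recurrenceAt n).sub_const_mul (hw.recurrenceAt n) l)
    (error_not_eventually_zero hu hw hu0 hu1 hw0 hw1 l)
  refine ⟨h0, ?_⟩
  have hb := error_bounds hu hw hu0 hu1 hw0 hw1 h
  suffices H : i = 1 by rwa [H] at h1
  by_contra hi
  have hi0 : i = 0 := by
    fin_cases i
    · rfl
    · exact absurd rfl hi
  rw [hi0] at h1
  have hr : 1 < root 0 := by
    have := sqrt_two_bounds
    simp [root]
    linarith
  have h2 : Tendsto (fun n => ((((u n : ℝ) - l * w n)⁻¹ : ℝ) : ℂ)) atTop (𝓝 0) := by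
    refine tendsto_zero_of_ratio (μ := (((root 0)⁻¹ : ℝ) : ℂ)) ?_ ?_ ?_
    · filter_upwards [h0] with n hn
      exact Complex.ofReal_ne_zero.2 (inv_ne_zero hn)
    · rw [Complex.norm_real, Real.norm_of_nonneg (by positivity)]
      exact inv_lt_one_of_one_lt₀ hr
    · refine ((Complex.continuous_ofReal.tendsto _).comp (h1.inv₀ (by positivity))).congr fun n => ?_
      rw [Function.comp_apply, ← Complex.ofReal_div, inv_div_inv, inv_div]
  have h3 := h2.norm
  rw [norm_zero] at h3
  have h4 : (1 : ℝ) / 6 ≤ 0 := by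
    refine ge_of_tendsto h3 ?_
    filter_upwards [h0] with n hn
    rw [Complex.norm_real, norm_inv, Real.norm_eq_abs, ← one_div]
    exact one_div_le_one_div_of_le (abs_pos.2 hn) (hb n)
  norm_num at h4

lemma hasConvergenceRate_quotient {l : ℝ}
    (h : Tendsto (fun n => ((u n / w n : ℚ) : ℝ)) atTop (𝓝 l)) :
    HasConvergenceRate (fun n => u n / w n) l ((-8 * Real.log (√2 + 1) : ℝ) : EReal) := by
  obtain ⟨h0, h1⟩ := tendsto_error_ratio hu hw hu0 hu1 hw0 hw1 h
  have h2 := tendsto_denominator_ratio hw hw0 hw1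
  have hw' : ∀ n, (w n : ℝ) ≠ 0 := fun n => by
    have : w n ≠ 0 := by linarith [(growth hw hw0 hw1 n).1]
    exact_mod_cast this
  have he : ∀ n, ((u n / w n : ℚ) : ℝ) - l = ((u n : ℝ) - l * w n) / w n := fun n => by
    have := hw' n
    push_cast
    field_simp
  -- The roots are `(√2+1)⁴` and its inverse, so their quotient is `(√2+1)⁻⁸`.
  have hr : Real.log (root 1 / root 0) = -8 * Real.log (√2 + 1) := by
    have hs := Real.sq_sqrt (zero_le_two (α := ℝ))
    have hs' : (√2 + 1) ^ 2 = 3 + 2 * √2 := by linear_combination hs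
    have h3 : root 0 = (√2 + 1) ^ 4 := by
      rw [show (√2 + 1) ^ 4 = ((√2 + 1) ^ 2) ^ 2 by ring, hs']
      simp only [root, Matrix.cons_val_zero]
      linear_combination (-4) * hs
    have h4 : root 1 = (root 0)⁻¹ := by
      refine eq_inv_of_mul_eq_one_left ?_
      simp only [root, Matrix.cons_val_zero, Matrix.cons_val_one]
      linear_combination (-144) * hs
    rw [h4, h3, ← one_div, div_div, ← pow_add, Real.log_div one_ne_zero (by positivity),
      Real.log_one, Real.log_pow]
    push_cast
    ring
  have h5 := tendsto_log_div_of_ratio (e := fun n => ((u n / w n : ℚ) : ℝ) - l)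
    (μ := root 1 / root 0) ?_ ?_
  · rw [ENNReal.log_ofReal_of_pos (div_pos (root_pos 1) (root_pos 0)), hr] at h5
    exact h5
  · filter_upwards [h0] with n hn
    rw [he]
    exact div_ne_zero hn (hw' n)
  · have h6 := (h1.div h2 (root_pos 0).ne').abs
    rw [abs_of_pos (div_pos (root_pos 1) (root_pos 0))] at h6
    refine h6.congr fun n => ?_
    simp only [he, Pi.div_apply]
    rw [← abs_div, div_div_div_comm]

end Pair

/-- The comparison is used twice: it carries the limit `ζ(3)` from the field to Apéry's quotient,
and the rate of that quotient back to the field. -/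
lemma hasConvergenceRate_ratio :
    HasConvergenceRate (field.ratio ![1, 1] ![1, 1] ![0, 1] ![1, 1]) (riemannZeta 3).re
      ((-8 * Real.log (√2 + 1) : ℝ) : EReal) := by
  obtain ⟨u, hu, hu0, hu1⟩ := exists_solution_apery 0 6
  obtain ⟨w, hw, hw0, hw1⟩ := exists_solution_apery 1 5
  have hp : ∀ i : Fin 2, u i = ((matEval AUnit.val ![1, 1]).transpose.mulVec ![0, 1]) i := fun i => by
    rw [initial_values.1]
    fin_cases i
    exacts [hu0, hu1]
  have hq : ∀ i : Fin 2, w i = ((matEval AUnit.val ![1, 1]).transpose.mulVec ![1, 1]) i := fun i => by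
    rw [initial_values.2]
    fin_cases i
    exacts [hw0, hw1]
  have hne : ¬ ∀ᶠ n in atTop, w n = 0 := fun h => by
    obtain ⟨n, hn⟩ := h.exists
    linarith [(growth hw hw0 hw1 n).1]
  obtain ⟨_, _, h⟩ := isCompanionTransform_field.ratio_comparison isPoincarePerron_apery
    isIrreducible_apery hu hp hw hq hne
  obtain ⟨h1, h2⟩ := h (riemannZeta 3).re
  have h3 := h1.1 tendsto_ratio
  obtain ⟨ρ, h4, h5⟩ := h2 h3
  rwa [tendsto_nhds_unique h5 (hasConvergenceRate_quotient hu hw hu0 hu1 hw0 hw1 h3)] at h4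

end Zeta3

end

theorem mainTheorem10 :
    (∀ (d r : ℕ) [NeZero r] (M : CMF ℚ d r) (x : Fin d → ℚ) (v : Fin d → ℤ)
      (A : Matrix.GeneralLinearGroup (Fin r) (MvRat ℚ d)) (a : Fin r → RatFunc ℚ),
      IsCompanionTransform M x v A a → IsPoincarePerron a → IsIrreducibleRecurrence a →
      ∀ (p q : Fin r → ℚ) (u w : ℕ → ℚ),
        IsSolution a u → (∀ i : Fin r, u i = ((CMF.matEval A.val x).transpose.mulVec p) i) →
        IsSolution a w → (∀ i : Fin r, w i = ((CMF.matEval A.val x).transpose.mulVec q) i) →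
        (¬ ∀ᶠ n in atTop, w n = 0) →
        (∀ᶠ n in atTop, w n ≠ 0) ∧
        (∀ᶠ n : ℕ in atTop,
          q ⬝ᵥ (CMF.matEval (M.mat (n • v)).val x).mulVec (CMF.lastVec ℚ r) ≠ 0) ∧
        ∀ l : ℝ,
          (Tendsto (fun n => ((M.ratio x v p q n : ℚ) : ℝ)) atTop (𝓝 l) ↔
            Tendsto (fun n => ((u n / w n : ℚ) : ℝ)) atTop (𝓝 l)) ∧
          (Tendsto (fun n => ((u n / w n : ℚ) : ℝ)) atTop (𝓝 l) →
            ∃ ρ : EReal, HasConvergenceRate (M.ratio x v p q) l ρ ∧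
              HasConvergenceRate (fun n => u n / w n) l ρ)) ∧
    (∃ (M : CMF ℚ 2 2) (A : Matrix.GeneralLinearGroup (Fin 2) (MvRat ℚ 2)),
      (M.mat ![1, 0]).val = Zeta3.M₁ ∧ (M.mat ![0, 1]).val = Zeta3.M₂ ∧ A.val = Zeta3.A ∧
      IsCompanionTransform M ![1, 1] ![1, 1] A Zeta3.apery ∧
      IsPoincarePerron Zeta3.apery ∧ IsIrreducibleRecurrence Zeta3.apery ∧
      (CMF.matEval A.val ![1, 1]).transpose.mulVec ![0, 1] = ![0, 6] ∧
      (CMF.matEval A.val ![1, 1]).transpose.mulVec ![1, 1] = ![1, 5] ∧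
      Tendsto (fun n => ((M.ratio ![1, 1] ![1, 1] ![0, 1] ![1, 1] n : ℚ) : ℝ)) atTop
        (𝓝 (riemannZeta 3).re) ∧
      HasConvergenceRate (M.ratio ![1, 1] ![1, 1] ![0, 1] ![1, 1]) (riemannZeta 3).re
        ((-8 * Real.log (√2 + 1) : ℝ) : EReal)) := by
  refine ⟨fun d r _ M x v A a h hPP hirr p q u w hu hp hw hq hw0 =>
    h.ratio_comparison hPP hirr hu hp hw hq hw0, Zeta3.field, Zeta3.AUnit, Zeta3.field_fst,
    Zeta3.field_snd, rfl, Zeta3.isCompanionTransform_field, Zeta3.isPoincarePerron_apery,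
    Zeta3.isIrreducible_apery, Zeta3.initial_values.1, Zeta3.initial_values.2,
    Zeta3.tendsto_ratio, Zeta3.hasConvergenceRate_ratio⟩
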